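/- Let $g\ge 2$, let $\Sigma$ be a closed oriented surface of genus $g$, i.e. a smooth surface presented as the connected sum of a chain of $g$ tori $\mathbb T_i=\mathbb R^2/\mathbb Z^2$ ($i=1,\dots,g$), and let $\omega$ be any symplectic form on $\Sigma$. Let $a_i$ and $b_i$ be the loops in $\Sigma$ given by a vertical and a horizontal circle of $\mathbb T_i$ that avoid the regions where the tori are glued, and identify $H^1(\Sigma;\mathbb R)$ with $\mathbb R^{2g}$ by $[\theta]\mapsto\left(\int_{a_1}\theta,\int_{b_1}\theta,\dots,\int_{a_g}\theta,\int_{b_g}\theta\right)$. The flux of a symplectic isotopy $\phi_t$, $t\in[0,1]$, of $(\Sigma,\omega)$ with $\phi_0=\mathrm{id}$ and $\frac{d}{dt}\phi_t=X_t\circ\phi_t$ is $\left[\int_0^1\omega(X_t,\cdot)\,dt\right]\in H^1(\Sigma;\mathbb R)\cong\mathbb R^{2g}$. Then for every $(u_1,v_1,\dots,u_g,v_g)\in\mathbb R^{2g}$ such that $u_i\ne 0$ and $v_i/u_i\in\mathbb R\setminus\mathbb Q$ for $i=1,\dots,g$, there is a smooth flow $\psi^t\colon\Sigma\to\Sigma$,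 $t\in\mathbb R$, that preserves $\omega$, such that 1. every periodic orbit of $\psi^t$ is a fixed point, i.e. if $\psi^T(p)=p$ for some $T>0$, then $\psi^t(p)=p$ for all $t$; 2. $\psi^t$ has exactly $2g-2$ fixed points, and each fixed point $p$ is hyperbolic, i.e. the eigenvalues of $d\psi^1_p\colon T_p\Sigma\to T_p\Sigma$ are real and different from $\pm1$; 3. the flux of $\psi^t|_{t\in[0,1]}$ is $(u_1,v_1,\dots,u_g,v_g)$. -/

import Mathlib

open scoped Manifold ContDiff

noncomputable section

namespace SurfaceFlow

/-! ### Closed surfaces of genus `g` as connected sums of `g` tori -/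

/-- The lattice `ℤ + ℤ i` in `ℂ`. -/
def IsLattice (c : ℂ) : Prop := ∃ m n : ℤ, c = m + n * Complex.I

/-- Centre of the disc removed from a torus `ℂ / (ℤ + ℤ i)` to attach the previous torus. -/
def leftCentre : ℂ := 0

/-- Centre of the disc removed from a torus `ℂ / (ℤ + ℤ i)` to attach the next torus. -/
def rightCentre : ℂ := 1 / 2 + 1 / 2 * Complex.I

/-- `c` is a lift to `ℂ` of the centre of a removed disc of the `i`-th torus. The first torus has
no left disc and the last one has no right disc. -/
def IsHoleCentre (g : ℕ) (i : Fin g) (c : ℂ) : Prop :=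
  (0 < (i : ℕ) ∧ IsLattice (c - leftCentre)) ∨ ((i : ℕ) + 1 < g ∧ IsLattice (c - rightCentre))

/-- The lift to `ℂ` of the `i`-th torus minus its closed discs, which have radius `1/16`. -/
def holedPlane (g : ℕ) (i : Fin g) : Set ℂ :=
  {z | ∀ c, IsHoleCentre g i c → 1 / 16 < ‖z - c‖}

/-- The gluing of the annulus `1/16 < |z - rightCentre| < 1/4` of a torus with the annulus
`1/16 < |w - leftCentre| < 1/4` of the next one: `z` and `w` are identified if, for suitable lifts,
`(z - rightCentre) (w - leftCentre) = 1/64`. For points of holed planes both factors have modulus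
larger than `1/16`, hence also smaller than `1/4`. -/
def Glued (z w : ℂ) : Prop :=
  ∃ l m : ℂ, IsLattice l ∧ IsLattice m ∧
    (z - rightCentre - l) * (w - leftCentre - m) = 1 / 64

/-- A presentation of the smooth surface `S` as the connected sum of a chain of `g` tori
`ℂ / (ℤ + ℤ i)`: the `i`-th holed torus is embedded in `S` as an open set by `param i`, these open
sets cover `S`, consecutive ones overlap exactly in the gluing annulus and other ones are disjoint.
For `g ≥ 1`, a compact Hausdorff smooth surface is a closed (connected, orientable) surface of genus
`g` if and only if it has such a presentation. -/
structure TorusSum (g : ℕ) (S : Type*) [TopologicalSpace S]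
    [ChartedSpace (EuclideanSpace ℝ (Fin 2)) S] where
  param : Fin g → ℂ → S
  localDiffeo : ∀ i, ∀ z ∈ holedPlane g i, IsLocalDiffeomorphAt 𝓘(ℝ, ℂ) (𝓡 2) ∞ (param i) z
  cover : ∀ x : S, ∃ i, ∃ z ∈ holedPlane g i, param i z = x
  eq_same : ∀ i, ∀ z ∈ holedPlane g i, ∀ w ∈ holedPlane g i,
    (param i z = param i w ↔ IsLattice (z - w))
  eq_lt : ∀ i j, i < j → ∀ z ∈ holedPlane g i, ∀ w ∈ holedPlane g j,
    (param i z = param j w ↔ (j : ℕ) = i + 1 ∧ Glued z w)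

variable {S : Type*} [TopologicalSpace S] [ChartedSpace (EuclideanSpace ℝ (Fin 2)) S]

/-- The loop `a_i`: the vertical circle `Re z = 1/4` of the `i`-th torus, `s ∈ [0, 1]`. -/
def TorusSum.loopA {g : ℕ} (d : TorusSum g S) (i : Fin g) (s : ℝ) : S :=
  d.param i (1 / 4 + s * Complex.I)

/-- The loop `b_i`: the horizontal circle `Im z = 1/4` of the `i`-th torus, `s ∈ [0, 1]`. -/
def TorusSum.loopB {g : ℕ} (d : TorusSum g S) (i : Fin g) (s : ℝ) : S :=
  d.param i (s + 1 / 4 * Complex.I)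

/-! ### Vector fields, differential forms, periods -/

variable (S) in
/-- Vector fields on `S` (no regularity required). -/
abbrev VField := (p : S) → TangentSpace (𝓡 2) p

variable (S) in
/-- Differential 1-forms on `S` (no regularity required). -/
abbrev OneForm := (p : S) → TangentSpace (𝓡 2) p →L[ℝ] ℝ

variable (S) in
/-- Bilinear forms on the tangent spaces of `S`. -/
abbrev BilinForm := (p : S) → TangentSpace (𝓡 2) p →L[ℝ] TangentSpace (𝓡 2) p →L[ℝ] ℝ

/-- Symplectic forms on a surface: smooth, alternating and non-degenerate (closedness is automatic,
as there are no non-zero 3-forms in dimension two). -/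
structure IsSymplecticForm [IsManifold (𝓡 2) ∞ S] (Ω : BilinForm S) : Prop where
  smooth : ContMDiff (𝓡 2) ((𝓡 2).prod
      𝓘(ℝ, EuclideanSpace ℝ (Fin 2) →L[ℝ] EuclideanSpace ℝ (Fin 2) →L[ℝ] ℝ)) ∞
    (fun p => Bundle.TotalSpace.mk'
      (EuclideanSpace ℝ (Fin 2) →L[ℝ] EuclideanSpace ℝ (Fin 2) →L[ℝ] ℝ)
      (E := fun p : S => TangentSpace (𝓡 2) p →L[ℝ] TangentSpace (𝓡 2) p →L[ℝ] ℝ) p (Ω p))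
  alternating : ∀ p v, Ω p v v = 0
  nondegenerate : ∀ p v, (∀ w, Ω p v w = 0) → v = 0

/-- The contraction `Ω(X, ·)`. -/
def contraction (Ω : BilinForm S) (X : VField S) : OneForm S := fun p => Ω p (X p)

/-- The coordinate expression of a 1-form in the preferred chart at `p`. -/
def OneForm.inChart (α : OneForm S) (p : S) (y : EuclideanSpace ℝ (Fin 2)) :
    EuclideanSpace ℝ (Fin 2) →L[ℝ] ℝ :=
  (α ((extChartAt (𝓡 2) p).symm y)).comp
    (mfderiv 𝓘(ℝ, EuclideanSpace ℝ (Fin 2)) (𝓡 2) (extChartAt (𝓡 2) p).symm y)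

/-- A closed 1-form: smooth in the charts, and with `dα = 0` there. -/
def OneForm.IsClosed (α : OneForm S) : Prop :=
  ∀ p : S, ContDiffOn ℝ ∞ (α.inChart p) (extChartAt (𝓡 2) p).target ∧
    ∀ y ∈ (extChartAt (𝓡 2) p).target, ∀ v w,
      fderiv ℝ (α.inChart p) y v w = fderiv ℝ (α.inChart p) y w v

/-- The integral of a 1-form along a curve parametrized by `[0, 1]`. -/
def OneForm.period (α : OneForm S) (γ : ℝ → S) : ℝ :=
  ∫ s in (0 : ℝ)..1, α (γ s) (mfderiv 𝓘(ℝ, ℝ) (𝓡 2) γ s (1 : ℝ))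

/-! ### Symplectic flows, flux, hyperbolic fixed points -/

/-- A symplectic flow on `(S, Ω)`: a smooth action of `ℝ` on `S` by maps that preserve `Ω`,
together with the vector field `field` that generates it (which it determines). -/
structure SymplecticFlow (Ω : BilinForm S) where
  toFun : ℝ → S → S
  field : VField S
  smooth : ContMDiff (𝓘(ℝ, ℝ).prod (𝓡 2)) (𝓡 2) ∞ (fun x : ℝ × S => toFun x.1 x.2)
  map_zero : ∀ p, toFun 0 p = p
  map_add : ∀ s t p, toFun (s + t) p = toFun s (toFun t p)
  generates : ∀ p, IsMIntegralCurve (I := 𝓡 2) (fun t => toFun t p) field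
  preserves : ∀ t p v w, Ω (toFun t p) (mfderiv (𝓡 2) (𝓡 2) (toFun t) p v)
    (mfderiv (𝓡 2) (𝓡 2) (toFun t) p w) = Ω p v w

/-- The value on a loop `γ` of the flux `[∫₀¹ Ω(X_t, ·) dt]` of an isotopy `φ_t`, `t ∈ [0, 1]`,
with `dφ_t/dt = X_t ∘ φ_t`. -/
def fluxOn (Ω : BilinForm S) (X : ℝ → VField S) (γ : ℝ → S) : ℝ :=
  ∫ t in (0 : ℝ)..1, (contraction Ω (X t)).period γ

/-- The flux of the path `ψ^t`, `t ∈ [0, 1]`, of a symplectic flow is the class with coordinates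
`(u_1, v_1, …, u_g, v_g)`, where the first cohomology is identified with `ℝ^{2g}` by evaluation on
`a_1, b_1, …, a_g, b_g`. The vector field of the path is `X_t = ψ.field` for all `t`. -/
def HasFlux {g : ℕ} (d : TorusSum g S) {Ω : BilinForm S} (ψ : SymplecticFlow Ω)
    (u v : Fin g → ℝ) : Prop :=
  (contraction Ω ψ.field).IsClosed ∧
    ∀ i, fluxOn Ω (fun _ => ψ.field) (d.loopA i) = u i ∧
      fluxOn Ω (fun _ => ψ.field) (d.loopB i) = v i

/-- The derivative of `φ` at a fixed point `p`, as an endomorphism of the tangent space. -/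
def derivAtFixed (φ : S → S) (p : S) (hp : φ p = p) :
    TangentSpace (𝓡 2) p →L[ℝ] TangentSpace (𝓡 2) p :=
  Eq.rec (motive := fun q _ => TangentSpace (𝓡 2) p →L[ℝ] TangentSpace (𝓡 2) q)
    (mfderiv (𝓡 2) (𝓡 2) φ p) hp

/-- A hyperbolic endomorphism of the plane, area-preserving in the applications: all complex
eigenvalues are real and different from `1` and `-1`. -/
def IsHyperbolicMap (A : EuclideanSpace ℝ (Fin 2) →L[ℝ] EuclideanSpace ℝ (Fin 2)) : Prop :=
  ∀ z : ℂ, (A.toLinearMap.charpoly.map (algebraMap ℝ ℂ)).IsRoot z →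
    z.im = 0 ∧ z ≠ 1 ∧ z ≠ -1

/-- A hyperbolic fixed point of a symplectomorphism of a surface. (The tangent space of `S` at `p`
is by definition a copy of `EuclideanSpace ℝ (Fin 2)`.) -/
def IsHyperbolicFixedPoint (φ : S → S) (p : S) : Prop :=
  ∃ hp : φ p = p, IsHyperbolicMap (derivAtFixed φ p hp)

/-- The fixed points of a flow. -/
def SymplecticFlow.fixedPoints {Ω : BilinForm S} (ψ : SymplecticFlow Ω) : Set S :=
  {p | ∀ t, ψ.toFun t p = p}

/-- `p` lies on a periodic orbit (possibly constant) of the flow. -/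
def SymplecticFlow.IsPeriodicPoint {Ω : BilinForm S} (ψ : SymplecticFlow Ω) (p : S) : Prop :=
  ∃ T : ℝ, 0 < T ∧ ψ.toFun T p = p

/-! ### Existence of closed surfaces of genus `g`

The compact Hausdorff smooth surface `Model g`, glued from `g` holed tori, has a presentation
`Model.torusSum g` as a connected sum, so closed surfaces of genus `g` in the above sense exist. -/

theorem IsLattice.neg {c : ℂ} (h : IsLattice c) : IsLattice (-c) := by
  obtain ⟨m, n, rfl⟩ := h
  exact ⟨-m, -n, by push_cast; ring⟩

theorem IsLattice.add {c d : ℂ} (h : IsLattice c) (h' : IsLattice d) : IsLattice (c + d) := by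
  obtain ⟨m, n, rfl⟩ := h
  obtain ⟨m', n', rfl⟩ := h'
  exact ⟨m + m', n + n', by push_cast; ring⟩

theorem IsLattice.sub {c d : ℂ} (h : IsLattice c) (h' : IsLattice d) : IsLattice (c - d) := by
  rw [sub_eq_add_neg]; exact h.add h'.neg

theorem isLattice_zero : IsLattice 0 := ⟨0, 0, by simp⟩

theorem IsLattice.eq_zero {c : ℂ} (h : IsLattice c) (hc : ‖c‖ < 1) : c = 0 := by
  obtain ⟨m, n, rfl⟩ := h
  have h1 := (Complex.abs_re_le_norm _).trans_lt hc
  have h2 := (Complex.abs_im_le_norm _).trans_lt hc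
  simp only [Complex.add_re, Complex.intCast_re, Complex.mul_re, Complex.intCast_im, Complex.I_re,
    Complex.I_im, mul_zero, sub_zero, add_zero, Complex.add_im, Complex.mul_im, mul_one,
    zero_add] at h1 h2
  have h3 : |m| < 1 := by exact_mod_cast h1
  have h4 : |n| < 1 := by exact_mod_cast h2
  rw [Int.abs_lt_one_iff] at h3 h4
  simp [h3, h4]

theorem IsLattice.eq_of_near {l m a : ℂ} (hl : IsLattice l) (hm : IsLattice m)
    (h : ‖a - l‖ + ‖a - m‖ < 1) : l = m := by
  have : l - m = 0 := (hl.sub hm).eq_zero <| by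
    have : l - m = (a - m) - (a - l) := by ring
    rw [this]
    linarith [norm_sub_le (a - m) (a - l)]
  exact sub_eq_zero.1 this

theorem half_le_norm {c d : ℂ} (hc : IsLattice (c - leftCentre))
    (hd : IsLattice (d - rightCentre)) : 1 / 2 ≤ ‖c - d‖ := by
  obtain ⟨m, n, h⟩ := hc.sub hd
  have h' : c - d = m + n * Complex.I - rightCentre := by
    rw [← h]; simp only [leftCentre]; ring
  have hre : (c - d).re = m - 1 / 2 := by
    rw [h']; simp [rightCentre]
  refine le_trans ?_ (Complex.abs_re_le_norm _)
  rw [hre]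
  rcases le_or_gt m 0 with hm | hm
  · have : (m : ℝ) ≤ 0 := by exact_mod_cast hm
    rw [abs_of_nonpos] <;> linarith
  · have : (1 : ℝ) ≤ m := by exact_mod_cast hm
    rw [abs_of_nonneg] <;> linarith

theorem holes_apart {g : ℕ} {i : Fin g} {c d : ℂ} (hc : IsHoleCentre g i c)
    (hd : IsHoleCentre g i d) (h : ‖c - d‖ < 1 / 2) : c = d := by
  rcases hc with ⟨_, hc⟩ | ⟨_, hc⟩ <;> rcases hd with ⟨_, hd⟩ | ⟨_, hd⟩
  · have := (hc.sub hd).eq_zero (by simpa using by linarith)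
    simpa [sub_eq_zero] using this
  · linarith [half_le_norm hc hd]
  · rw [norm_sub_rev] at h; linarith [half_le_norm hd hc]
  · have := (hc.sub hd).eq_zero (by simpa using by linarith)
    simpa [sub_eq_zero] using this

theorem IsHoleCentre.add {g : ℕ} {i : Fin g} {c l : ℂ} (hc : IsHoleCentre g i c)
    (hl : IsLattice l) : IsHoleCentre g i (c + l) := by
  rcases hc with ⟨h, hc⟩ | ⟨h, hc⟩
  · exact Or.inl ⟨h, by have := hc.add hl; rwa [add_sub_right_comm]⟩
  · exact Or.inr ⟨h, by have := hc.add hl; rwa [add_sub_right_comm]⟩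

theorem add_mem_holedPlane {g : ℕ} {i : Fin g} {z l : ℂ} (hz : z ∈ holedPlane g i)
    (hl : IsLattice l) : z + l ∈ holedPlane g i := by
  intro c hc
  have := hz _ (hc.add hl.neg)
  rwa [show z - (c + -l) = z + l - c by ring] at this

theorem isOpen_holedPlane (g : ℕ) (i : Fin g) : IsOpen (holedPlane g i) := by
  rw [Metric.isOpen_iff]
  intro z hz
  by_cases h : ∃ c, IsHoleCentre g i c ∧ ‖z - c‖ < 1 / 4
  · obtain ⟨c, hc, hzc⟩ := h
    have h1 := hz c hc
    refine ⟨min (‖z - c‖ - 1 / 16) (1 / 16), lt_min (by linarith) (by norm_num), ?_⟩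
    intro w hw d hd
    rw [Metric.mem_ball, dist_eq_norm, lt_min_iff] at hw
    have hzw : ‖z - c‖ ≤ ‖w - c‖ + ‖w - z‖ := by
      have : z - c = (w - c) - (w - z) := by ring
      rw [this]; exact norm_sub_le _ _
    by_cases hdc : c = d
    · subst hdc; linarith
    · have h2 : 1 / 2 ≤ ‖c - d‖ := by
        by_contra! h3; exact hdc (holes_apart hc hd h3)
      have h3 : ‖c - d‖ ≤ ‖w - d‖ + (‖w - z‖ + ‖z - c‖) := by
        have : c - d = (w - d) - ((w - z) + (z - c)) := by ring
        rw [this]; exact (norm_sub_le _ _).trans (by gcongr; exact norm_add_le _ _)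
      linarith
  · push Not at h
    refine ⟨1 / 8, by norm_num, fun w hw d hd => ?_⟩
    rw [Metric.mem_ball, dist_eq_norm] at hw
    have h3 : ‖z - d‖ ≤ ‖w - d‖ + ‖w - z‖ := by
      have : z - d = (w - d) - (w - z) := by ring
      rw [this]; exact norm_sub_le _ _
    linarith [h d hd]

/-- The gluing relation on points of holed planes. -/
def Rel (g : ℕ) (i : Fin g) (z : ℂ) (j : Fin g) (w : ℂ) : Prop :=
  (i = j ∧ IsLattice (z - w)) ∨ ((j : ℕ) = i + 1 ∧ Glued z w) ∨ ((i : ℕ) = j + 1 ∧ Glued w z)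

theorem Rel.symm {g : ℕ} {i j : Fin g} {z w : ℂ} (h : Rel g i z j w) : Rel g j w i z := by
  rcases h with ⟨h, h'⟩ | h | h
  · exact Or.inl ⟨h.symm, by simpa using h'.neg⟩
  · exact Or.inr (Or.inr h)
  · exact Or.inr (Or.inl h)

theorem glued_bounds {g : ℕ} {i j : Fin g} {z w l m : ℂ} (hij : (j : ℕ) = i + 1)
    (hz : z ∈ holedPlane g i) (hw : w ∈ holedPlane g j) (hl : IsLattice l) (hm : IsLattice m)
    (h : (z - rightCentre - l) * (w - leftCentre - m) = 1 / 64) :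
    1 / 16 < ‖z - rightCentre - l‖ ∧ ‖z - rightCentre - l‖ < 1 / 4 ∧
    1 / 16 < ‖w - leftCentre - m‖ ∧ ‖w - leftCentre - m‖ < 1 / 4 := by
  have h1 : 1 / 16 < ‖z - rightCentre - l‖ := by
    rw [sub_sub]
    exact hz _ (Or.inr ⟨by have := j.2; omega, by simpa using hl⟩)
  have h2 : 1 / 16 < ‖w - leftCentre - m‖ := by
    rw [sub_sub]
    exact hw _ (Or.inl ⟨by omega, by simpa using hm⟩)
  have h3 : ‖z - rightCentre - l‖ * ‖w - leftCentre - m‖ = 1 / 64 := by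
    rw [← norm_mul, h]; norm_num
  refine ⟨h1, ?_, h2, ?_⟩ <;> nlinarith

theorem Rel.trans {g : ℕ} {i j k : Fin g} {z w x : ℂ} (hz : z ∈ holedPlane g i)
    (hw : w ∈ holedPlane g j) (hx : x ∈ holedPlane g k)
    (h : Rel g i z j w) (h' : Rel g j w k x) : Rel g i z k x := by
  rcases h with ⟨rfl, h⟩ | ⟨e, l, m, hl, hm, h⟩ | ⟨e, l, m, hl, hm, h⟩
  · rcases h' with ⟨rfl, h'⟩ | ⟨e', l', m', hl', hm', h'⟩ | ⟨e', l', m', hl', hm', h'⟩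
    · exact Or.inl ⟨rfl, by simpa using h.add h'⟩
    · exact Or.inr (Or.inl ⟨e', l' + (z - w), m', hl'.add h, hm', by rw [← h']; ring⟩)
    · exact Or.inr (Or.inr ⟨e', l', m' + (z - w), hl', hm'.add h, by rw [← h']; ring⟩)
  · have b := glued_bounds e hz hw hl hm h
    rcases h' with ⟨rfl, h'⟩ | ⟨e', l', m', hl', hm', h'⟩ | ⟨e', l', m', hl', hm', h'⟩
    · exact Or.inr (Or.inl ⟨e, l, m - (w - x), hl, hm.sub h', by rw [← h]; ring⟩)
    · exfalso
      have b' := glued_bounds e' hw hx hl' hm' h'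
      have := half_le_norm (c := leftCentre + m) (d := rightCentre + l') (by simpa using hm)
        (by simpa using hl')
      rw [show leftCentre + m - (rightCentre + l')
        = (w - rightCentre - l') - (w - leftCentre - m) by ring] at this
      linarith [norm_sub_le (w - rightCentre - l') (w - leftCentre - m)]
    · have b' := glued_bounds e' hx hw hl' hm' h'
      have hmm : m = m' := hm.eq_of_near hm' (a := w - leftCentre) (by linarith)
      subst hmm
      have hik : i = k := Fin.ext (by omega)
      refine Or.inl ⟨hik, ?_⟩
      have h0 : w - leftCentre - m ≠ 0 := by
        intro h0; rw [h0] at h; norm_num at h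
      have := mul_right_cancel₀ h0 (h.trans h'.symm)
      have h3 : z - x = l - l' := by linear_combination this
      rw [h3]; exact hl.sub hl'
  · have b := glued_bounds e hw hz hl hm h
    rcases h' with ⟨rfl, h'⟩ | ⟨e', l', m', hl', hm', h'⟩ | ⟨e', l', m', hl', hm', h'⟩
    · exact Or.inr (Or.inr ⟨e, l - (w - x), m, hl.sub h', hm, by rw [← h]; ring⟩)
    · have b' := glued_bounds e' hw hx hl' hm' h'
      have hmm : l = l' := hl.eq_of_near hl' (a := w - rightCentre) (by linarith)
      subst hmm
      have hik : i = k := Fin.ext (by omega)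
      refine Or.inl ⟨hik, ?_⟩
      have h0 : w - rightCentre - l ≠ 0 := by
        intro h0; rw [h0] at h; norm_num at h
      have := mul_left_cancel₀ h0 (h.trans h'.symm)
      have h3 : z - x = m - m' := by linear_combination this
      rw [h3]; exact hm.sub hm'
    · exfalso
      have b' := glued_bounds e' hx hw hl' hm' h'
      have := half_le_norm (c := leftCentre + m') (d := rightCentre + l) (by simpa using hm')
        (by simpa using hl)
      rw [show leftCentre + m' - (rightCentre + l)
        = (w - rightCentre - l) - (w - leftCentre - m') by ring] at this
      linarith [norm_sub_le (w - rightCentre - l) (w - leftCentre - m')]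

/-- Identified points are identified through a local smooth map. -/
theorem Rel.local_map {g : ℕ} {i j : Fin g} {z w : ℂ} (h : Rel g i z j w) :
    ∃ f : ℂ → ℂ, ContDiffAt ℝ ∞ f z ∧ f z = w ∧
      ∀ᶠ z' in nhds z, Rel g i z' j (f z') := by
  rcases h with ⟨rfl, h⟩ | ⟨e, l, m, hl, hm, h⟩ | ⟨e, l, m, hl, hm, h⟩
  · refine ⟨fun z' => z' - (z - w), by fun_prop, by ring, Filter.Eventually.of_forall fun z' => ?_⟩
    exact Or.inl ⟨rfl, by simpa using h⟩
  · have h0 : z - rightCentre - l ≠ 0 := by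
      intro h0; rw [h0] at h; norm_num at h
    refine ⟨fun z' => 1 / 64 * (z' - rightCentre - l)⁻¹ + leftCentre + m, ?_, ?_, ?_⟩
    · have : ContDiffAt ℝ ∞ (fun z' : ℂ => (z' - rightCentre - l)⁻¹) z :=
        ContDiffAt.inv (by fun_prop) h0
      fun_prop
    · rw [← h]; field_simp; ring
    · have : ∀ᶠ z' in nhds z, z' - rightCentre - l ≠ 0 :=
        ContinuousAt.eventually_ne (by fun_prop) h0
      filter_upwards [this] with z' hz'
      exact Or.inr (Or.inl ⟨e, l, m, hl, hm, by field_simp; ring⟩)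
  · have h0 : z - leftCentre - m ≠ 0 := by
      intro h0; rw [h0] at h; norm_num at h
    refine ⟨fun z' => 1 / 64 * (z' - leftCentre - m)⁻¹ + rightCentre + l, ?_, ?_, ?_⟩
    · have : ContDiffAt ℝ ∞ (fun z' : ℂ => (z' - leftCentre - m)⁻¹) z :=
        ContDiffAt.inv (by fun_prop) h0
      fun_prop
    · rw [← h]; field_simp; ring
    · have : ∀ᶠ z' in nhds z, z' - leftCentre - m ≠ 0 :=
        ContinuousAt.eventually_ne (by fun_prop) h0
      filter_upwards [this] with z' hz'
      exact Or.inr (Or.inr ⟨e, l, m, hl, hm, by field_simp; ring⟩)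

theorem eventually_not_isLattice {z : ℂ} (h : ¬ IsLattice z) :
    ∀ᶠ z' in nhds z, ¬ IsLattice z' := by
  have hb : ∀ᶠ z' in nhds z, ‖z - z'‖ < 1 / 4 := by
    filter_upwards [Metric.ball_mem_nhds z (show (0 : ℝ) < 1 / 4 by norm_num)] with z' hz'
    rwa [Metric.mem_ball, dist_comm, dist_eq_norm] at hz'
  by_cases hl : ∃ l, IsLattice l ∧ ‖z - l‖ < 1 / 4
  · obtain ⟨l, hl, hzl⟩ := hl
    have hne : z ≠ l := fun e => h (e ▸ hl)
    filter_upwards [hb, (continuousAt_id (x := z)).eventually_ne hne] with z' h1 h2 h3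
    have h4 : z' = l := h3.eq_of_near hl (a := z) (by linarith)
    exact h2 h4
  · push Not at hl
    filter_upwards [hb] with z' h1 h3
    linarith [hl z' h3]

theorem eventually_not_glued {g : ℕ} {i j : Fin g} {z w : ℂ} (hij : (j : ℕ) = i + 1)
    (h : ¬ Glued z w) :
    ∀ᶠ p in nhds (z, w), p.1 ∈ holedPlane g i → p.2 ∈ holedPlane g j → ¬ Glued p.1 p.2 := by
  have hb : ∀ᶠ p : ℂ × ℂ in nhds (z, w), ‖z - p.1‖ < 1 / 16 ∧ ‖w - p.2‖ < 1 / 16 := by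
    have hc : ContinuousAt (fun p : ℂ × ℂ => max ‖z - p.1‖ ‖w - p.2‖) (z, w) := by fun_prop
    filter_upwards [hc.eventually_lt (continuousAt_const (y := (1 / 16 : ℝ))) (by simp)] with p hp
    exact max_lt_iff.1 hp
  have key : ∀ p : ℂ × ℂ, ‖z - p.1‖ < 1 / 16 ∧ ‖w - p.2‖ < 1 / 16 → p.1 ∈ holedPlane g i →
      p.2 ∈ holedPlane g j → ∀ l m, IsLattice l → IsLattice m →
      (p.1 - rightCentre - l) * (p.2 - leftCentre - m) = 1 / 64 →
      ‖z - rightCentre - l‖ < 5 / 16 ∧ ‖w - leftCentre - m‖ < 5 / 16 := by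
    intro p hp h1 h2 l m hl hm e
    have b := glued_bounds hij h1 h2 hl hm e
    constructor
    · rw [show z - rightCentre - l = (z - p.1) + (p.1 - rightCentre - l) by ring]
      linarith [norm_add_le (z - p.1) (p.1 - rightCentre - l), hp.1]
    · rw [show w - leftCentre - m = (w - p.2) + (p.2 - leftCentre - m) by ring]
      linarith [norm_add_le (w - p.2) (p.2 - leftCentre - m), hp.2]
  by_cases hl : ∃ l m, IsLattice l ∧ IsLattice m ∧ ‖z - rightCentre - l‖ < 5 / 16 ∧
      ‖w - leftCentre - m‖ < 5 / 16
  · obtain ⟨l, m, hl, hm, b1, b2⟩ := hl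
    have hne : (z - rightCentre - l) * (w - leftCentre - m) ≠ 1 / 64 :=
      fun e => h ⟨l, m, hl, hm, e⟩
    have hc : ContinuousAt (fun p : ℂ × ℂ => (p.1 - rightCentre - l) * (p.2 - leftCentre - m))
        (z, w) := by fun_prop
    filter_upwards [hb, hc.eventually_ne hne] with p hp hpne h1 h2 ⟨l', m', hl', hm', e⟩
    have b := key p hp h1 h2 l' m' hl' hm' e
    have e1 : l' = l := hl'.eq_of_near hl (a := z - rightCentre) (by linarith)
    have e2 : m' = m := hm'.eq_of_near hm (a := w - leftCentre) (by linarith)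
    subst e1 e2
    exact hpne e
  · filter_upwards [hb] with p hp h1 h2 ⟨l', m', hl', hm', e⟩
    exact hl ⟨l', m', hl', hm', key p hp h1 h2 l' m' hl' hm' e⟩

theorem eventually_not_rel {g : ℕ} {i j : Fin g} {z w : ℂ} (h : ¬ Rel g i z j w) :
    ∀ᶠ p in nhds (z, w), p.1 ∈ holedPlane g i → p.2 ∈ holedPlane g j →
      ¬ Rel g i p.1 j p.2 := by
  simp only [Rel, not_or, not_and] at h ⊢
  obtain ⟨h1, h2, h3⟩ := h
  have e1 : ∀ᶠ p in nhds (z, w), i = j → ¬ IsLattice (p.1 - p.2) := by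
    by_cases hij : i = j
    · have hc : ContinuousAt (fun p : ℂ × ℂ => p.1 - p.2) (z, w) := by fun_prop
      filter_upwards [hc.eventually (eventually_not_isLattice (h1 hij))] with p hp _ using hp
    · exact Filter.Eventually.of_forall fun _ h => absurd h hij
  have e2 : ∀ᶠ p in nhds (z, w), (j : ℕ) = i + 1 → p.1 ∈ holedPlane g i →
      p.2 ∈ holedPlane g j → ¬ Glued p.1 p.2 := by
    by_cases hij : (j : ℕ) = i + 1
    · filter_upwards [eventually_not_glued hij (h2 hij)] with p hp _ using hp
    · exact Filter.Eventually.of_forall fun _ h => absurd h hij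
  have e3 : ∀ᶠ p in nhds (z, w), (i : ℕ) = j + 1 → p.2 ∈ holedPlane g j →
      p.1 ∈ holedPlane g i → ¬ Glued p.2 p.1 := by
    by_cases hij : (i : ℕ) = j + 1
    · have hc : Filter.Tendsto (Prod.swap : ℂ × ℂ → ℂ × ℂ) (nhds (z, w)) (nhds (w, z)) :=
        continuous_swap.tendsto (z, w)
      filter_upwards [hc.eventually (eventually_not_glued hij (h3 hij))] with p hp _ using hp
    · exact Filter.Eventually.of_forall fun _ h => absurd h hij
  filter_upwards [e1, e2, e3] with p h1 h2 h3 h4 h5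
  exact ⟨h1, fun e => h2 e h4 h5, fun e => h3 e h5 h4⟩

/-- The relation that glues the holed tori. -/
def glueSetoid (g : ℕ) : Setoid (Σ i : Fin g, holedPlane g i) where
  r x y := Rel g x.1 x.2 y.1 y.2
  iseqv :=
    { refl := fun _ => Or.inl ⟨rfl, by simpa using isLattice_zero⟩
      symm := fun h => h.symm
      trans := fun {x y z} h h' => Rel.trans x.2.2 y.2.2 z.2.2 h h' }

/-- The connected sum of a chain of `g` tori. -/
def Model (g : ℕ) : Type := Quotient (glueSetoid g)

instance (g : ℕ) : TopologicalSpace (Model g) :=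
  inferInstanceAs (TopologicalSpace (Quotient (glueSetoid g)))

/-- The projection of the `i`-th holed plane to the connected sum. -/
def proj {g : ℕ} (i : Fin g) (z : holedPlane g i) : Model g := Quotient.mk (glueSetoid g) ⟨i, z⟩

theorem proj_eq {g : ℕ} {i j : Fin g} {z : holedPlane g i} {w : holedPlane g j} :
    proj i z = proj j w ↔ Rel g i z j w := Quotient.eq (r := glueSetoid g)

theorem exists_proj {g : ℕ} (q : Model g) : ∃ (i : Fin g) (z : holedPlane g i), proj i z = q := by
  obtain ⟨⟨i, z⟩, h⟩ := Quotient.exists_rep q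
  exact ⟨i, z, h⟩

theorem isOpen_model {g : ℕ} {V : Set (Model g)} :
    IsOpen V ↔ ∀ i, IsOpen ((proj i : holedPlane g i → Model g) ⁻¹' V) := by
  have h : Topology.IsQuotientMap (Quotient.mk (glueSetoid g)) := isQuotientMap_quotient_mk'
  exact h.isOpen_preimage.symm.trans isOpen_sigma_iff

theorem continuous_proj {g : ℕ} (i : Fin g) : Continuous (proj i : holedPlane g i → Model g) :=
  continuous_def.2 fun _ hV => isOpen_model.1 hV i

theorem local_lift {g : ℕ} {i j : Fin g} {z : holedPlane g i} {w : holedPlane g j}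
    (h : proj i z = proj j w) :
    ∃ f : ℂ → ℂ, ContDiffAt ℝ ∞ f z ∧ f z = w ∧
      ∀ᶠ z' in nhds (z : ℂ), ∀ hz' : z' ∈ holedPlane g i, ∃ hf : f z' ∈ holedPlane g j,
        proj i ⟨z', hz'⟩ = proj j ⟨f z', hf⟩ := by
  obtain ⟨f, hf, hfz, hr⟩ := (proj_eq.1 h).local_map
  refine ⟨f, hf, hfz, ?_⟩
  have : ∀ᶠ z' in nhds (z : ℂ), f z' ∈ holedPlane g j :=
    hf.continuousAt.eventually (by rw [hfz]; exact (isOpen_holedPlane g j).mem_nhds w.2)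
  filter_upwards [hr, this] with z' h1 h2 h3
  exact ⟨h2, proj_eq.2 h1⟩

theorem isOpenMap_proj {g : ℕ} (j : Fin g) : IsOpenMap (proj j : holedPlane g j → Model g) := by
  intro V hV
  rw [isOpen_model]
  intro i
  rw [isOpen_iff_mem_nhds]
  rintro z ⟨w, hw, hwz⟩
  obtain ⟨f, hf, hfz, hr⟩ := local_lift hwz.symm
  obtain ⟨V', hV', rfl⟩ := isOpen_induced_iff.1 hV
  have h1 : ∀ᶠ z' in nhds (z : ℂ), f z' ∈ V' :=
    hf.continuousAt.eventually (by rw [hfz]; exact hV'.mem_nhds hw)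
  have h2 := (continuous_subtype_val.tendsto z).eventually (h1.and hr)
  filter_upwards [h2] with z' hz'
  obtain ⟨hm, he⟩ := hz'.2 z'.2
  exact ⟨⟨f z', hm⟩, hz'.1, he.symm⟩

theorem proj_injOn {g : ℕ} {i : Fin g} {z w : holedPlane g i} {a : ℂ}
    (hz : ‖(z : ℂ) - a‖ < 1 / 4) (hw : ‖(w : ℂ) - a‖ < 1 / 4) (h : proj i z = proj i w) :
    z = w := by
  rcases proj_eq.1 h with ⟨_, h⟩ | ⟨h, _⟩ | ⟨h, _⟩
  · have : (z : ℂ) - w = 0 := h.eq_zero <| by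
      rw [show (z : ℂ) - w = (z - a) - (w - a) by ring]
      linarith [norm_sub_le ((z : ℂ) - a) (w - a)]
    exact Subtype.ext (sub_eq_zero.1 this)
  · omega
  · omega

instance (g : ℕ) : T2Space (Model g) := by
  refine ⟨fun p q hpq => ?_⟩
  obtain ⟨i, z, rfl⟩ := exists_proj p
  obtain ⟨j, w, rfl⟩ := exists_proj q
  have h := eventually_not_rel (fun h => hpq (proj_eq.2 h))
  rw [nhds_prod_eq, Filter.eventually_prod_iff] at h
  obtain ⟨P, hP, Q, hQ, h⟩ := h
  obtain ⟨A, hA, hAo, hzA⟩ := eventually_nhds_iff.1 hP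
  obtain ⟨B, hB, hBo, hwB⟩ := eventually_nhds_iff.1 hQ
  refine ⟨proj i '' (Subtype.val ⁻¹' A), proj j '' (Subtype.val ⁻¹' B),
    isOpenMap_proj i _ (hAo.preimage continuous_subtype_val),
    isOpenMap_proj j _ (hBo.preimage continuous_subtype_val), ⟨z, hzA, rfl⟩, ⟨w, hwB, rfl⟩, ?_⟩
  rw [Set.disjoint_left]
  rintro _ ⟨z', hz', rfl⟩ ⟨w', hw', e⟩
  exact h (hA _ hz') (hB _ hw') z'.2 w'.2 (proj_eq.1 e.symm)

/-- Representatives at distance at least `1/8` from the centres of the holes. -/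
theorem exists_far {g : ℕ} (q : Model g) : ∃ (i : Fin g) (z : holedPlane g i),
    proj i z = q ∧ ∀ c, IsHoleCentre g i c → 1 / 8 ≤ ‖(z : ℂ) - c‖ := by
  obtain ⟨i, z, rfl⟩ := exists_proj q
  by_cases h : ∀ c, IsHoleCentre g i c → 1 / 8 ≤ ‖(z : ℂ) - c‖
  · exact ⟨i, z, rfl, h⟩
  push Not at h
  obtain ⟨c, hc, hzc⟩ := h
  have hpos := z.2 c hc
  have h0 : (z : ℂ) - c ≠ 0 := by
    intro h; rw [h, norm_zero] at hpos; linarith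
  have hn : ‖(1 / 64 : ℂ) / (z - c)‖ = 1 / 64 / ‖(z : ℂ) - c‖ := by
    rw [norm_div]; norm_num
  have hlo : 1 / 8 < ‖(1 / 64 : ℂ) / (z - c)‖ := by
    rw [hn, lt_div_iff₀ (by linarith)]; linarith
  have hhi : ‖(1 / 64 : ℂ) / (z - c)‖ < 1 / 4 := by
    rw [hn, div_lt_iff₀ (by linarith)]; linarith
  have far : ∀ (j : Fin g) (d : ℂ), IsHoleCentre g j d →
      ∀ e, IsHoleCentre g j e → 1 / 8 < ‖d + (1 / 64 : ℂ) / (z - c) - e‖ := by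
    intro j d hd e he
    by_cases hde : d = e
    · subst hde; simpa using hlo
    · have h2 : 1 / 2 ≤ ‖d - e‖ := by
        by_contra! h3; exact hde (holes_apart hd he h3)
      have h3 : ‖d - e‖ ≤ ‖d + (1 / 64 : ℂ) / (z - c) - e‖ + ‖(1 / 64 : ℂ) / (z - c)‖ := by
        have : d - e = (d + (1 / 64 : ℂ) / (z - c) - e) - (1 / 64 : ℂ) / (z - c) := by ring
        conv_lhs => rw [this]
        exact norm_sub_le _ _
      linarith
  rcases hc with ⟨hi, hc⟩ | ⟨hi, hc⟩
  · let j : Fin g := ⟨i - 1, by omega⟩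
    have hd : IsHoleCentre g j rightCentre :=
      Or.inr ⟨by have := i.2; simp only [j]; omega, by simpa using isLattice_zero⟩
    refine ⟨j, ⟨rightCentre + (1 / 64 : ℂ) / (z - c),
      fun e he => by linarith [far j _ hd e he]⟩, ?_, fun e he => (far j _ hd e he).le⟩
    refine proj_eq.2 (Or.inr (Or.inl ⟨by simp only [j]; omega, 0, c - leftCentre,
      isLattice_zero, hc, ?_⟩))
    field_simp
    ring
  · let j : Fin g := ⟨i + 1, hi⟩
    have hd : IsHoleCentre g j leftCentre :=
      Or.inl ⟨by simp [j], by simpa using isLattice_zero⟩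
    refine ⟨j, ⟨leftCentre + (1 / 64 : ℂ) / (z - c),
      fun e he => by linarith [far j _ hd e he]⟩, ?_, fun e he => (far j _ hd e he).le⟩
    refine proj_eq.2 (Or.inr (Or.inr ⟨by simp [j], c - rightCentre, 0, hc,
      isLattice_zero, ?_⟩))
    field_simp
    ring

instance (g : ℕ) : CompactSpace (Model g) := by
  let K : Fin g → Set ℂ := fun i => {z | ∀ c, IsHoleCentre g i c → 1 / 8 ≤ ‖z - c‖} ∩
    Metric.closedBall 0 2
  have hKU : ∀ i, K i ⊆ holedPlane g i := fun i z hz c hc => by linarith [hz.1 c hc]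
  have hK : ∀ i, IsCompact (K i) := fun i => by
    refine (isCompact_closedBall 0 2).inter_left ?_
    simp only [Set.ofPred_forall]
    exact isClosed_iInter fun c => isClosed_iInter fun _ =>
      isClosed_le continuous_const (by fun_prop)
  have hc : ∀ i, IsCompact (proj i '' (Subtype.val ⁻¹' K i)) := fun i => by
    refine IsCompact.image ?_ (continuous_proj i)
    rw [Subtype.isCompact_iff, Subtype.image_preimage_coe,
      Set.inter_eq_right.2 (hKU i)]
    exact hK i
  refine ⟨?_⟩
  convert isCompact_iUnion hc
  symm
  rw [Set.eq_univ_iff_forall]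
  intro q
  obtain ⟨i, z, rfl, hz⟩ := exists_far q
  rw [Set.mem_iUnion]
  let l : ℂ := ⌊(z : ℂ).re⌋ + ⌊(z : ℂ).im⌋ * Complex.I
  have hl : IsLattice l := ⟨_, _, rfl⟩
  have hm : (z : ℂ) - l ∈ holedPlane g i := by
    rw [sub_eq_add_neg]; exact add_mem_holedPlane z.2 hl.neg
  refine ⟨i, ⟨(z : ℂ) - l, hm⟩, ⟨?_, ?_⟩, proj_eq.2 (Or.inl ⟨rfl, by simpa using hl.neg⟩)⟩
  · intro c hc
    have := hz _ (hc.add hl)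
    rwa [show (z : ℂ) - (c + l) = z - l - c by ring] at this
  · rw [mem_closedBall_zero_iff]
    refine (Complex.norm_le_abs_re_add_abs_im _).trans ?_
    have h1 : ((z : ℂ) - l).re = Int.fract (z : ℂ).re := by simp [l]
    have h2 : ((z : ℂ) - l).im = Int.fract (z : ℂ).im := by simp [l]
    rw [h1, h2, Int.abs_fract, Int.abs_fract]
    linarith [Int.fract_lt_one (z : ℂ).re, Int.fract_lt_one (z : ℂ).im]

/-- A linear identification of `ℂ` with the Euclidean plane. -/
def toPlane : ℂ ≃L[ℝ] EuclideanSpace ℝ (Fin 2) :=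
  Complex.orthonormalBasisOneI.repr.toContinuousLinearEquiv

/-- A small disc in a holed plane, on which the projection is injective. -/
def smallDisc (g : ℕ) (i : Fin g) (a : ℂ) : Set ℂ := holedPlane g i ∩ Metric.ball a (1 / 4)

theorem isOpen_smallDisc (g : ℕ) (i : Fin g) (a : ℂ) : IsOpen (smallDisc g i a) :=
  (isOpen_holedPlane g i).inter Metric.isOpen_ball

/-- The projection, extended arbitrarily to the plane. -/
def Model.param {g : ℕ} (i : Fin g) (a : holedPlane g i) (z : ℂ) : Model g :=
  open Classical in if hz : z ∈ holedPlane g i then proj i ⟨z, hz⟩ else proj i a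

theorem Model.param_of_mem {g : ℕ} {i : Fin g} {a : holedPlane g i} {z : ℂ}
    (hz : z ∈ holedPlane g i) : Model.param i a z = proj i ⟨z, hz⟩ := dif_pos hz

theorem Model.param_injOn {g : ℕ} (i : Fin g) (a : holedPlane g i) :
    Set.InjOn (Model.param i a) (smallDisc g i a) := by
  intro z hz w hw h
  rw [param_of_mem hz.1, param_of_mem hw.1] at h
  have h1 := hz.2
  have h2 := hw.2
  rw [Metric.mem_ball, dist_eq_norm] at h1 h2
  exact congrArg Subtype.val (proj_injOn (z := ⟨z, hz.1⟩) (w := ⟨w, hw.1⟩) h1 h2 h)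

theorem Model.continuousOn_param {g : ℕ} (i : Fin g) (a : holedPlane g i) :
    ContinuousOn (Model.param i a) (smallDisc g i a) := by
  refine ContinuousOn.mono ?_ Set.inter_subset_left
  rw [continuousOn_iff_continuous_domRestrict]
  convert continuous_proj i using 1
  ext z
  exact param_of_mem z.2

theorem Model.isOpenMap_param {g : ℕ} (i : Fin g) (a : holedPlane g i) :
    IsOpenMap ((smallDisc g i a).domRestrict (Model.param i a)) := by
  intro V hV
  have h2 : (smallDisc g i a).domRestrict (Model.param i a) '' V =
      proj i '' (Subtype.val ⁻¹' (Subtype.val '' V)) := by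
    ext q
    constructor
    · rintro ⟨z, hz, rfl⟩
      exact ⟨⟨z, z.2.1⟩, ⟨z, hz, rfl⟩, (param_of_mem z.2.1).symm⟩
    · rintro ⟨z, ⟨w, hw, e⟩, rfl⟩
      refine ⟨w, hw, ?_⟩
      rw [Set.domRestrict_apply, param_of_mem w.2.1]
      congr 1
      exact Subtype.ext e
  rw [h2]
  exact isOpenMap_proj i _ (((isOpen_smallDisc g i a).isOpenMap_subtype_val V hV).preimage
    continuous_subtype_val)

/-- The inverse chart at the image of a point. -/
def Model.invChart {g : ℕ} (i : Fin g) (a : holedPlane g i) : OpenPartialHomeomorph ℂ (Model g) :=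
  haveI : Nonempty ℂ := ⟨0⟩
  OpenPartialHomeomorph.ofContinuousOpenRestrict
    ((Model.param_injOn i a).toPartialEquiv (Model.param i a) (smallDisc g i a))
    (Model.continuousOn_param i a) (Model.isOpenMap_param i a) (isOpen_smallDisc g i a)

theorem Model.invChart_source {g : ℕ} (i : Fin g) (a : holedPlane g i) :
    (Model.invChart i a).source = smallDisc g i a := rfl

theorem Model.invChart_apply {g : ℕ} (i : Fin g) (a : holedPlane g i) (z : ℂ) :
    Model.invChart i a z = Model.param i a z := rfl

/-- The chart at the image of a point. -/
def Model.chart {g : ℕ} (x : Σ i : Fin g, holedPlane g i) :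
    OpenPartialHomeomorph (Model g) (EuclideanSpace ℝ (Fin 2)) :=
  (Model.invChart x.1 x.2).symm.trans toPlane.toHomeomorph.toOpenPartialHomeomorph

theorem mem_smallDisc {g : ℕ} (i : Fin g) (a : holedPlane g i) : (a : ℂ) ∈ smallDisc g i a :=
  ⟨a.2, Metric.mem_ball_self (by norm_num)⟩

theorem Model.mem_chart_source {g : ℕ} (x : Σ i : Fin g, holedPlane g i) :
    proj x.1 x.2 ∈ (Model.chart x).source := by
  have h := (Model.invChart x.1 x.2).map_source (mem_smallDisc x.1 x.2)
  rw [Model.invChart_apply, Model.param_of_mem x.2.2] at h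
  simpa [Model.chart] using h

instance (g : ℕ) : ChartedSpace (EuclideanSpace ℝ (Fin 2)) (Model g) where
  atlas := Set.range Model.chart
  chartAt q := Model.chart (Quotient.out q)
  mem_chart_source q := by
    have h := Model.mem_chart_source (Quotient.out q)
    have e : proj (Quotient.out q).1 (Quotient.out q).2 = q := Quotient.out_eq q
    rwa [e] at h
  chart_mem_atlas q := ⟨_, rfl⟩

theorem Model.transition {g : ℕ} {i j : Fin g} (a : holedPlane g i) (b : holedPlane g j) {z : ℂ}
    (hz : z ∈ smallDisc g i a) (hb : Model.param i a z ∈ (Model.invChart j b).target) :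
    ContDiffAt ℝ ∞ (fun z => (Model.invChart j b).symm (Model.param i a z)) z := by
  set w := (Model.invChart j b).symm (Model.param i a z) with hw
  have hwm : w ∈ smallDisc g j b := (Model.invChart j b).map_target hb
  have hwe : Model.param j b w = Model.param i a z := (Model.invChart j b).right_inv hb
  rw [param_of_mem hz.1, param_of_mem hwm.1] at hwe
  obtain ⟨f, hf, hfz, hr⟩ := local_lift hwe.symm
  refine hf.congr_of_eventuallyEq ?_
  have h1 : ∀ᶠ z' in nhds z, f z' ∈ smallDisc g j b :=
    hf.continuousAt.eventually (by
      simp only at hfz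
      rw [hfz]; exact (isOpen_smallDisc g j b).mem_nhds hwm)
  filter_upwards [hr, h1, (isOpen_smallDisc g i a).mem_nhds hz] with z' h2 h3 h4
  obtain ⟨hm, he⟩ := h2 h4.1
  rw [param_of_mem h4.1, he, ← param_of_mem (a := b) hm]
  exact (Model.invChart j b).left_inv h3

instance (g : ℕ) : IsManifold (𝓡 2) ∞ (Model g) := by
  refine isManifold_of_contDiffOn _ _ _ ?_
  rintro _ _ ⟨⟨i, a⟩, rfl⟩ ⟨⟨j, b⟩, rfl⟩ y hy
  refine ContDiffAt.contDiffWithinAt ?_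
  have hy1 : toPlane.symm y ∈ smallDisc g i a ∧
      Model.param i a (toPlane.symm y) ∈ (Model.invChart j b).target := by
    simpa [Model.chart, Model.invChart_source, Model.invChart_apply] using hy
  exact toPlane.contDiff.contDiffAt.comp y
    ((Model.transition a b hy1.1 hy1.2).comp y toPlane.symm.contDiff.contDiffAt)

theorem quarter_mem_holedPlane (g : ℕ) (i : Fin g) : (1 / 4 : ℂ) ∈ holedPlane g i := by
  intro c hc
  rcases hc with ⟨_, m, n, h⟩ | ⟨_, m, n, h⟩
  · have hre : (1 / 4 - c : ℂ).re = 1 / 4 - m := by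
      rw [sub_eq_iff_eq_add.1 h]; simp [leftCentre]
    refine lt_of_lt_of_le ?_ (Complex.abs_re_le_norm _)
    rw [hre]
    rcases le_or_gt m 0 with hm | hm
    · have : (m : ℝ) ≤ 0 := by exact_mod_cast hm
      rw [abs_of_nonneg] <;> linarith
    · have : (1 : ℝ) ≤ m := by exact_mod_cast hm
      rw [abs_of_nonpos] <;> linarith
  · have hre : (1 / 4 - c : ℂ).re = -1 / 4 - m := by
      rw [sub_eq_iff_eq_add.1 h]; simp [rightCentre]; ring
    refine lt_of_lt_of_le ?_ (Complex.abs_re_le_norm _)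
    rw [hre]
    rcases le_or_gt m (-1) with hm | hm
    · have : (m : ℝ) ≤ -1 := by exact_mod_cast hm
      rw [abs_of_nonneg] <;> linarith
    · have : (0 : ℝ) ≤ m := by exact_mod_cast (show (0 : ℤ) ≤ m by omega)
      rw [abs_of_nonpos] <;> linarith

/-- The standard closed surface of genus `g`. -/
def Model.torusSum (g : ℕ) : TorusSum g (Model g) where
  param i := Model.param i ⟨1 / 4, quarter_mem_holedPlane g i⟩
  localDiffeo i z hz := by
    have hmem : Model.chart ⟨i, ⟨z, hz⟩⟩ ∈ IsManifold.maximalAtlas (𝓡 2) ∞ (Model g) :=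
      IsManifold.subset_maximalAtlas ⟨_, rfl⟩
    refine ⟨⟨(Model.invChart i ⟨z, hz⟩).toPartialEquiv, (Model.invChart i ⟨z, hz⟩).open_source,
      (Model.invChart i ⟨z, hz⟩).open_target, ?_, ?_⟩, mem_smallDisc i ⟨z, hz⟩, ?_⟩
    · have h1 := contMDiffOn_symm_of_mem_maximalAtlas hmem
      have h2 : ContMDiffOn 𝓘(ℝ, ℂ) (𝓡 2) ∞ toPlane (smallDisc g i z) :=
        toPlane.contDiff.contMDiff.contMDiffOn
      refine (h1.comp h2 ?_).congr ?_
      · intro w hw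
        simpa [Model.chart, Model.invChart_source] using hw
      · intro w _
        simp [Model.chart]
    · have h1 := contMDiffOn_of_mem_maximalAtlas hmem
      have h2 : ContMDiff (𝓡 2) 𝓘(ℝ, ℂ) ∞ toPlane.symm := toPlane.symm.contDiff.contMDiff
      refine (h2.comp_contMDiffOn (h1.mono ?_)).congr ?_
      · intro w hw
        simpa [Model.chart] using hw
      · intro w _
        simp [Model.chart]
    · intro w hw
      exact (Model.param_of_mem hw.1).trans (Model.param_of_mem hw.1).symm
  cover q := by
    obtain ⟨i, z, rfl⟩ := exists_proj q
    exact ⟨i, z, z.2, Model.param_of_mem z.2⟩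
  eq_same i z hz w hw := by
    rw [Model.param_of_mem hz, Model.param_of_mem hw, proj_eq]
    simp [Rel]
  eq_lt i j hij z hz w hw := by
    rw [Model.param_of_mem hz, Model.param_of_mem hw, proj_eq]
    have h1 : i ≠ j := hij.ne
    have h2 : (i : ℕ) ≠ j + 1 := by have : (i : ℕ) < j := hij; omega
    simp [Rel, h1, h2]

end SurfaceFlow

end

open scoped Manifold ContDiff

/-!
The flow is the Hamiltonian vector field, with respect to the symplectic form, of the imaginary part
of a multivalued complex potential. Away from the holes of the `i`-th torus the potential is
`μ_i z` with `μ_i = u_i + v_i √-1`, which gives the flux; near the centre `c` of a hole it is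
`ε (ζ + 1 / (64 ζ))` with `ζ = z - c`, up to a constant. This Joukowski map takes the same value at
`ζ` and at `1 / (64 ζ)`, so the potentials of neighbouring tori agree, up to a constant, across the
neck. Its critical points `ζ = ± 1 / 8` are the only zeros of the vector field: two for each of the
`g - 1` necks, and they are saddles.

The circles `‖ζ‖ = 1 / 8` are invariant, so that an orbit stays in a single holed torus and lifts to
the plane. Along an orbit that is not a fixed point the imaginary part of the potential is constant,
while its real part is strictly monotone. A periodic orbit would hence lift to a path from `z` to
`z + l` with a lattice vector `l ≠ 0` such that `Im (μ_i l) = 0`, against the irrationality of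
`v_i / u_i`.
-/

noncomputable section

namespace SurfaceFlow

open Set Filter Topology

/-! ### Smooth dependence of solutions of differential equations on the initial value -/

section Composition

theorem eventually_forall_norm_sub_lt {K E F : Type*} [TopologicalSpace K] [CompactSpace K]
    [NormedAddCommGroup E] [NormedAddCommGroup F] {f : E → F} (hf : Continuous f)
    (γ : C(K, E)) {c : ℝ} (hc : 0 < c) :
    ∀ᶠ h in 𝓝 (0 : E), ∀ k : K, ‖f (γ k + h) - f (γ k)‖ < c := by
  have hK := (isCompact_univ (X := K)).eventually_forall_of_forall_eventually (x₀ := (0 : E))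
    (P := fun h k => ‖f (γ k + h) - f (γ k)‖ < c) fun k _ => by
      have : Continuous fun p : E × K => ‖f (γ p.2 + p.1) - f (γ p.2)‖ := by fun_prop
      exact this.continuousAt.eventually_lt continuousAt_const (by simpa using hc)
  filter_upwards [hK] with h hh k using hh k (mem_univ k)

universe w
variable {K : Type*} [TopologicalSpace K] [CompactSpace K]
  {E F : Type w} [NormedAddCommGroup E] [NormedSpace ℝ E] [NormedAddCommGroup F] [NormedSpace ℝ F]

variable (K E F) in
/-- The pointwise application of a continuous family of operators to a continuous function. It
expresses the derivative of `γ ↦ f ∘ γ` in terms of that of `f`. -/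
def pointwiseApply : C(K, E →L[ℝ] F) →L[ℝ] C(K, E) →L[ℝ] C(K, F) :=
  LinearMap.mkContinuous₂
    (LinearMap.mk₂ ℝ (fun (A : C(K, E →L[ℝ] F)) (δ : C(K, E)) =>
        (⟨fun k => A k (δ k), by fun_prop⟩ : C(K, F)))
      (fun _ _ _ => by ext; simp) (fun _ _ _ => by ext; simp) (fun _ _ _ => by ext; simp)
      (fun _ _ _ => by ext; simp)) 1
    (fun A δ => by
      rw [ContinuousMap.norm_le _ (by positivity), one_mul]
      intro k
      refine ((A k).le_opNorm (δ k)).trans ?_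
      gcongr
      · exact A.norm_coe_le_norm k
      · exact δ.norm_coe_le_norm k)

theorem hasFDerivAt_postcomp (f : C(E, F)) (f' : C(E, E →L[ℝ] F))
    (hf : ∀ x, HasFDerivAt f (f' x) x) (γ : C(K, E)) :
    HasFDerivAt (fun γ : C(K, E) => f.comp γ) (pointwiseApply K E F (f'.comp γ)) γ := by
  rw [hasFDerivAt_iff_isLittleO_nhds_zero, Asymptotics.isLittleO_iff]
  intro c hc
  obtain ⟨δ, hδ, hball⟩ :=
    Metric.eventually_nhds_iff_ball.1 (eventually_forall_norm_sub_lt f'.continuous γ hc)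
  filter_upwards [Metric.ball_mem_nhds (0 : C(K, E)) hδ] with h hh
  rw [ContinuousMap.norm_le _ (by positivity)]
  intro k
  have hk : ‖h k‖ ≤ ‖h‖ := h.norm_coe_le_norm k
  have hderiv : ∀ y, HasFDerivAt (fun y => f (γ k + y) - f' (γ k) y) (f' (γ k + y) - f' (γ k)) y :=
    fun y => ((hasFDerivAt_comp_add_left (γ k)).2 (hf (γ k + y))).sub (f' (γ k)).hasFDerivAt
  have hmean := (convex_ball (0 : E) δ).norm_image_sub_le_of_norm_hasFDerivWithin_le
    (fun y _ => (hderiv y).hasFDerivWithinAt) (fun y hy => (hball y hy k).le)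
    (Metric.mem_ball_self hδ) (mem_ball_zero_iff.2 (hk.trans_lt (mem_ball_zero_iff.1 hh)))
  calc ‖f (γ k + h k) - f (γ k) - f' (γ k) (h k)‖
      = ‖f (γ k + h k) - f' (γ k) (h k) - (f (γ k + 0) - f' (γ k) 0)‖ := by
        rw [add_zero, map_zero, sub_zero, sub_right_comm]
    _ ≤ c * ‖h k - 0‖ := hmean
    _ ≤ c * ‖h‖ := by rw [sub_zero]; gcongr

theorem contDiff_nat_postcomp (n : ℕ) (f : C(E, F)) (hf : ContDiff ℝ n f) :
    ContDiff ℝ n (fun γ : C(K, E) => f.comp γ) := by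
  induction n generalizing F with
  | zero =>
    rw [Nat.cast_zero, contDiff_zero]
    exact f.continuous_postcomp
  | succ n ih =>
    obtain ⟨f', hf', hd⟩ := contDiff_succ_iff_hasFDerivAt.1 hf
    exact contDiff_succ_iff_hasFDerivAt.2
      ⟨_, (pointwiseApply K E F).contDiff.comp (ih ⟨f', hf'.continuous⟩ hf'),
        hasFDerivAt_postcomp f ⟨f', hf'.continuous⟩ hd⟩

theorem contDiff_infty_postcomp (f : C(E, F)) (hf : ContDiff ℝ ∞ f) :
    ContDiff ℝ ∞ (fun γ : C(K, E) => f.comp γ) :=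
  contDiff_infty.2 fun n => contDiff_nat_postcomp n f (contDiff_infty.1 hf n)

end Composition

section LocalFlow

variable {E : Type*} [NormedAddCommGroup E]

/-- The extension of a curve on `[-1, 1]` to the line by constants. -/
def extendCurve (γ : C(Icc (-1 : ℝ) 1, E)) : C(ℝ, E) := γ.IccExtend (neg_le_self zero_le_one)

theorem extendCurve_of_mem (γ : C(Icc (-1 : ℝ) 1, E)) {s : ℝ} (hs : s ∈ Icc (-1 : ℝ) 1) :
    extendCurve γ s = γ ⟨s, hs⟩ :=
  IccExtend_of_mem _ _ hs

/-- Multiplication by a number of modulus at most one on `[-1, 1]`. It is used to compare the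
solution curves of `γ' = s f(γ)` for different speeds `s`. -/
def scaleIcc (ρ : Icc (-1 : ℝ) 1) : C(Icc (-1 : ℝ) 1, Icc (-1 : ℝ) 1) :=
  ⟨fun t => ⟨ρ * t, abs_le.1 (by
    rw [abs_mul]
    exact mul_le_one₀ (abs_le.2 ρ.2) (abs_nonneg _) (abs_le.2 t.2))⟩, by fun_prop⟩

theorem extendCurve_scaleIcc (γ : C(Icc (-1 : ℝ) 1, E)) (ρ : Icc (-1 : ℝ) 1) {s : ℝ}
    (hs : s ∈ Icc (-1 : ℝ) 1) :
    extendCurve (γ.comp (scaleIcc ρ)) s = extendCurve γ (ρ * s) := by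
  rw [extendCurve_of_mem _ hs]
  exact (extendCurve_of_mem γ (scaleIcc ρ ⟨s, hs⟩).2).symm

variable [NormedSpace ℝ E]

variable (E) in
/-- The integration operator `γ ↦ ∫₀ᵗ γ` on curves. -/
def curveIntegral : C(Icc (-1 : ℝ) 1, E) →L[ℝ] C(Icc (-1 : ℝ) 1, E) :=
  LinearMap.mkContinuous
    { toFun := fun γ => ⟨fun t => ∫ s in (0 : ℝ)..t, extendCurve γ s,
        (intervalIntegral.continuous_primitive
          (fun a b => (extendCurve γ).continuous.intervalIntegrable a b) 0).comp
          continuous_subtype_val⟩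
      map_add' := fun γ γ' => by
        ext t
        exact intervalIntegral.integral_add ((extendCurve γ).continuous.intervalIntegrable _ _)
          ((extendCurve γ').continuous.intervalIntegrable _ _)
      map_smul' := fun c γ => by
        ext t
        exact intervalIntegral.integral_smul c _ } 1
    (fun γ => by
      rw [one_mul, ContinuousMap.norm_le _ (norm_nonneg γ)]
      intro t
      refine (intervalIntegral.norm_integral_le_of_norm_le_const
        (C := ‖γ‖) fun s _ => γ.norm_coe_le_norm _).trans ?_
      rw [sub_zero]
      exact mul_le_of_le_one_right (norm_nonneg γ) (abs_le.2 t.2))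

theorem smul_curveIntegral_comp_scaleIcc (γ : C(Icc (-1 : ℝ) 1, E)) (ρ : Icc (-1 : ℝ) 1) :
    (ρ : ℝ) • curveIntegral E (γ.comp (scaleIcc ρ)) = (curveIntegral E γ).comp (scaleIcc ρ) := by
  ext t
  have hsub : uIcc (0 : ℝ) t ⊆ Icc (-1) 1 := uIcc_subset_Icc ⟨by norm_num, by norm_num⟩ t.2
  calc (ρ : ℝ) • ∫ s in (0 : ℝ)..t, extendCurve (γ.comp (scaleIcc ρ)) s
      = (ρ : ℝ) • ∫ s in (0 : ℝ)..t, extendCurve γ (ρ * s) := by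
        rw [intervalIntegral.integral_congr fun s hs => extendCurve_scaleIcc γ ρ (hsub hs)]
    _ = ∫ s in (0 : ℝ)..(ρ * t), extendCurve γ s := by
        rw [intervalIntegral.smul_integral_comp_mul_left, mul_zero]

/-- The defect of `γ` as a solution of `γ' = s f(γ)`, `γ(0) = x`, in integral form. The time is
turned into the parameter `s`, so that all curves live on the same interval. -/
def flowDefect (f : C(E, E)) (p : (ℝ × E) × C(Icc (-1 : ℝ) 1, E)) : C(Icc (-1 : ℝ) 1, E) :=
  p.2 - ContinuousMap.const _ p.1.2 - p.1.1 • curveIntegral E (f.comp p.2)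

theorem contDiff_flowDefect {f : C(E, E)} (hf : ContDiff ℝ ∞ f) :
    ContDiff ℝ ∞ (flowDefect f) := by
  have hconst : ContDiff ℝ ∞ fun p : (ℝ × E) × C(Icc (-1 : ℝ) 1, E) =>
      ContinuousMap.const (Icc (-1 : ℝ) 1) p.1.2 :=
    (ContinuousLinearMap.const ℝ (Icc (-1 : ℝ) 1) : E →L[ℝ] _).contDiff.comp contDiff_fst.snd
  have hintegral : ContDiff ℝ ∞ fun p : (ℝ × E) × C(Icc (-1 : ℝ) 1, E) =>
      curveIntegral E (f.comp p.2) :=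
    (curveIntegral E).contDiff.comp ((contDiff_infty_postcomp f hf).comp contDiff_snd)
  exact (contDiff_snd.sub hconst).sub (contDiff_fst.fst.smul hintegral)

theorem flowDefect_comp_scaleIcc {f : C(E, E)} {s : ℝ} {x : E} {γ : C(Icc (-1 : ℝ) 1, E)}
    (h : flowDefect f ((s, x), γ) = 0) (ρ : Icc (-1 : ℝ) 1) :
    flowDefect f ((s * ρ, x), γ.comp (scaleIcc ρ)) = 0 := by
  have hcomp : (flowDefect f ((s, x), γ)).comp (scaleIcc ρ) = 0 := by rw [h]; rfl
  rw [← hcomp, flowDefect, mul_smul, ← ContinuousMap.comp_assoc, smul_curveIntegral_comp_scaleIcc]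
  rfl

theorem apply_eq_of_flowDefect_eq_zero {f : C(E, E)} {s : ℝ} {x : E} {γ : C(Icc (-1 : ℝ) 1, E)}
    (h : flowDefect f ((s, x), γ) = 0) (t : Icc (-1 : ℝ) 1) :
    γ t = x + s • ∫ τ in (0 : ℝ)..t, extendCurve (f.comp γ) τ := by
  have ht : γ t - x - s • ∫ τ in (0 : ℝ)..t, extendCurve (f.comp γ) τ = 0 :=
    congrArg (fun c : C(Icc (-1 : ℝ) 1, E) => c t) h
  rw [← sub_eq_zero, ← ht, sub_sub]

theorem hasDerivAt_of_flowDefect_eq_zero [CompleteSpace E] {f : C(E, E)} {s : ℝ} (hs : 0 < s)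
    {x : E} {γ : C(Icc (-1 : ℝ) 1, E)} (h : flowDefect f ((s, x), γ) = 0) {t : ℝ}
    (ht : t ∈ Ioo (-s) s) :
    HasDerivAt (fun τ => extendCurve γ (τ / s)) (f (extendCurve γ (t / s))) t := by
  have hmem : ∀ τ ∈ Ioo (-s) s, τ / s ∈ Icc (-1 : ℝ) 1 := fun τ hτ =>
    ⟨by rw [le_div_iff₀ hs]; linarith [hτ.1], by rw [div_le_iff₀ hs]; linarith [hτ.2]⟩
  have hF : HasDerivAt (fun σ : ℝ => ∫ r in (0 : ℝ)..σ, extendCurve (f.comp γ) r)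
      (f (extendCurve γ (t / s))) (t / s) :=
    ((extendCurve (f.comp γ)).continuous.integral_hasStrictDerivAt 0 (t / s)).hasDerivAt
  have hG := ((hF.scomp t ((hasDerivAt_id t).div_const s)).const_smul s).const_add x
  rw [smul_smul, mul_one_div_cancel hs.ne', one_smul] at hG
  refine hG.congr_of_eventuallyEq ?_
  filter_upwards [Ioo_mem_nhds ht.1 ht.2] with τ hτ
  rw [extendCurve_of_mem γ (hmem τ hτ), apply_eq_of_flowDefect_eq_zero h]
  rfl

theorem exists_solution_family [CompleteSpace E] {f : C(E, E)} (hf : ContDiff ℝ ∞ f) (x₀ : E) :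
    ∃ Γ : ℝ × E → C(Icc (-1 : ℝ) 1, E), ContDiffAt ℝ ∞ Γ (0, x₀) ∧
      Γ (0, x₀) = ContinuousMap.const _ x₀ ∧
      (∀ᶠ p in 𝓝 ((0 : ℝ), x₀), flowDefect f (p, Γ p) = 0) ∧
      ∀ᶠ q in 𝓝 (((0 : ℝ), x₀), ContinuousMap.const _ x₀),
        flowDefect f q = 0 → Γ q.1 = q.2 := by
  set C := C(Icc (-1 : ℝ) 1, E)
  set γ₀ : C := ContinuousMap.const _ x₀
  set q₀ : (ℝ × E) × C := ((0, x₀), γ₀)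
  have hF : ContDiffAt ℝ ∞ (flowDefect f) q₀ := (contDiff_flowDefect hf).contDiffAt
  have hF₀ : flowDefect f q₀ = 0 := by simp [flowDefect, q₀, γ₀]
  have hslice : (flowDefect f ∘ fun γ : C => (((0 : ℝ), x₀), γ)) = fun γ => γ - γ₀ := by
    funext γ; simp [flowDefect, γ₀]
  have hpartial : fderiv ℝ (flowDefect f) q₀ ∘L .inr ℝ (ℝ × E) C = .id ℝ C := by
    have hchain := (hF.differentiableAt (by simp)).hasFDerivAt.comp γ₀
      (hasFDerivAt_prodMk_right (𝕜 := ℝ) ((0 : ℝ), x₀) γ₀)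
    rw [hslice] at hchain
    exact hchain.unique ((hasFDerivAt_id γ₀).sub_const γ₀)
  have hinv : (fderiv ℝ (flowDefect f) q₀ ∘L .inr ℝ (ℝ × E) C).IsInvertible := by
    rw [hpartial]; exact ⟨.refl ℝ C, rfl⟩
  refine ⟨hF.implicitFunction (by simp) hinv, hF.contDiffAt_implicitFunction (by simp) hinv,
    hF.implicitFunction_apply_self (by simp) hinv, ?_, ?_⟩
  · filter_upwards [hF.eventually_apply_implicitFunction (by simp) hinv] with p hp
    rw [hp, hF₀]
  · filter_upwards [hF.eventually_apply_eq_iff_implicitFunction (by simp) hinv] with q hq hq0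
    exact hq.1 (hq0.trans hF₀.symm)

/-- A smooth local flow of the vector field `f` near `x₀`, defined for times in `(-ε, ε)` and with
values in `U`. -/
structure IsLocalFlow (f : E → E) (U : Set E) (x₀ : E) (ε : ℝ) (φ : ℝ × E → E) : Prop where
  pos : 0 < ε
  contDiffAt : ContDiffAt ℝ ∞ φ (0, x₀)
  eventually_map_zero : ∀ᶠ x in 𝓝 x₀, φ (0, x) = x
  eventually_hasDerivAt : ∀ᶠ x in 𝓝 x₀, ∀ t ∈ Ioo (-ε) ε,
    φ (t, x) ∈ U ∧ HasDerivAt (fun s => φ (s, x)) (f (φ (t, x))) t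

theorem exists_uniform_solution {f : C(E, E)} {x₀ : E}
    {Γ : ℝ × E → C(Icc (-1 : ℝ) 1, E)} (hΓ : ContinuousAt Γ (0, x₀))
    (hΓ₀ : Γ (0, x₀) = ContinuousMap.const _ x₀)
    (hsol : ∀ᶠ p in 𝓝 ((0 : ℝ), x₀), flowDefect f (p, Γ p) = 0)
    (huniq : ∀ᶠ q in 𝓝 (((0 : ℝ), x₀), ContinuousMap.const _ x₀),
      flowDefect f q = 0 → Γ q.1 = q.2) {V : Set E} (hV : V ∈ 𝓝 x₀) :
    ∃ ε > 0, ∀ᶠ x in 𝓝 x₀, flowDefect f ((ε, x), Γ (ε, x)) = 0 ∧ (∀ s, Γ (ε, x) s ∈ V) ∧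
      ∀ ρ : Icc (-1 : ℝ) 1, Γ (ε * ρ, x) = (Γ (ε, x)).comp (scaleIcc ρ) := by
  have hgood : ∀ᶠ q in 𝓝 (((0 : ℝ), x₀), ContinuousMap.const (Icc (-1 : ℝ) 1) x₀),
      (flowDefect f q = 0 → Γ q.1 = q.2) ∧ ∀ s, q.2 s ∈ V := by
    obtain ⟨δ, hδ, hδV⟩ := Metric.mem_nhds_iff.1 hV
    have hnear := (continuous_snd.tendsto
      (((0 : ℝ), x₀), ContinuousMap.const (Icc (-1 : ℝ) 1) x₀)).eventually
      (Metric.ball_mem_nhds _ hδ)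
    filter_upwards [huniq, hnear] with q hq hqδ
    exact ⟨hq, fun s => hδV ((ContinuousMap.dist_apply_le_dist s).trans_lt hqδ)⟩
  obtain ⟨δ, hδ, hδgood⟩ := Metric.eventually_nhds_iff_ball.1 hgood
  have hclose : ∀ᶠ p in 𝓝 ((0 : ℝ), x₀), Γ p ∈ Metric.ball (ContinuousMap.const _ x₀) δ :=
    hΓ.eventually (by rw [hΓ₀]; exact Metric.ball_mem_nhds _ hδ)
  obtain ⟨δ', hδ', hδ'good⟩ := Metric.eventually_nhds_iff_ball.1 (hclose.and hsol)
  obtain ⟨ε, hε, hεδ⟩ := exists_between (lt_min hδ hδ')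
  rw [lt_min_iff] at hεδ
  refine ⟨ε, hε, ?_⟩
  filter_upwards [Metric.ball_mem_nhds x₀ (lt_min hδ hδ')] with x hx
  rw [Metric.mem_ball, lt_min_iff] at hx
  obtain ⟨hball, hzero⟩ := hδ'good (ε, x) (by
    rw [Metric.mem_ball, Prod.dist_eq, max_lt_iff]
    exact ⟨by simpa [abs_of_pos hε] using hεδ.2, hx.2⟩)
  have hscaled : ∀ ρ : Icc (-1 : ℝ) 1, (((ε * ρ : ℝ), x), (Γ (ε, x)).comp (scaleIcc ρ)) ∈
      Metric.ball (((0 : ℝ), x₀), ContinuousMap.const (Icc (-1 : ℝ) 1) x₀) δ := by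
    intro ρ
    simp only [Metric.mem_ball, Prod.dist_eq, max_lt_iff, dist_zero_right,
      Real.norm_eq_abs, abs_mul, abs_of_pos hε]
    refine ⟨⟨(mul_le_of_le_one_right hε.le (abs_le.2 ρ.2)).trans_lt hεδ.1, hx.1⟩, ?_⟩
    exact ((ContinuousMap.dist_le dist_nonneg).2 fun s =>
      ContinuousMap.dist_apply_le_dist (g := ContinuousMap.const _ x₀)
        (scaleIcc ρ s)).trans_lt hball
  refine ⟨hzero, (hδgood ((ε, x), Γ (ε, x)) ?_).2, fun ρ =>
    (hδgood _ (hscaled ρ)).1 (flowDefect_comp_scaleIcc hzero ρ)⟩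
  simp only [Metric.mem_ball, Prod.dist_eq, max_lt_iff, dist_zero_right,
    Real.norm_eq_abs, abs_of_pos hε]
  exact ⟨⟨hεδ.1, hx.1⟩, hball⟩

theorem exists_isLocalFlow_of_contDiff [CompleteSpace E] {f : E → E} (hf : ContDiff ℝ ∞ f)
    {x₀ : E} {V : Set E} (hV : V ∈ 𝓝 x₀) : ∃ ε φ, IsLocalFlow f V x₀ ε φ := by
  obtain ⟨Γ, hΓ, hΓ₀, hsol, huniq⟩ := exists_solution_family (f := ⟨f, hf.continuous⟩) hf x₀
  obtain ⟨ε, hε, hx⟩ := exists_uniform_solution hΓ.continuousAt hΓ₀ hsol huniq hV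
  let e : Icc (-1 : ℝ) 1 := ⟨1, by norm_num⟩
  have hφ : ∀ x, (∀ ρ : Icc (-1 : ℝ) 1, Γ (ε * ρ, x) = (Γ (ε, x)).comp (scaleIcc ρ)) →
      ∀ t ∈ Icc (-ε) ε, Γ (t, x) e = extendCurve (Γ (ε, x)) (t / ε) := by
    intro x hscale t ht
    have hρ : t / ε ∈ Icc (-1 : ℝ) 1 :=
      ⟨by rw [le_div_iff₀ hε]; linarith [ht.1], by rw [div_le_iff₀ hε]; linarith [ht.2]⟩
    have hΓt := hscale ⟨t / ε, hρ⟩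
    rw [mul_div_cancel₀ _ hε.ne'] at hΓt
    rw [hΓt, extendCurve_of_mem _ hρ, ContinuousMap.comp_apply]
    congr 1
    exact Subtype.ext (mul_one _)
  have hsmooth : ContDiffAt ℝ ∞ (fun p => Γ p e) (0, x₀) :=
    (ContinuousMap.evalCLM ℝ e : C(Icc (-1 : ℝ) 1, E) →L[ℝ] E).contDiff.contDiffAt.comp (0, x₀) hΓ
  refine ⟨ε, fun p => Γ p e, hε, hsmooth, ?_, ?_⟩
  · filter_upwards [hx] with x ⟨hzero, _, hscale⟩
    rw [hφ x hscale 0 ⟨by linarith, hε.le⟩, zero_div, extendCurve_of_mem _ (by norm_num),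
      apply_eq_of_flowDefect_eq_zero hzero]
    simp only [intervalIntegral.integral_same, smul_zero, add_zero]
  · filter_upwards [hx] with x ⟨hzero, hmem, hscale⟩ t ht
    rw [hφ x hscale t (Ioo_subset_Icc_self ht)]
    refine ⟨hmem _, (hasDerivAt_of_flowDefect_eq_zero hε hzero ht).congr_of_eventuallyEq ?_⟩
    filter_upwards [Ioo_mem_nhds ht.1 ht.2] with s hs using hφ x hscale s (Ioo_subset_Icc_self hs)

theorem exists_isLocalFlow [FiniteDimensional ℝ E] {U : Set E} (hU : IsOpen U) {f : E → E}
    (hf : ContDiffOn ℝ ∞ f U) {x₀ : E} (hx₀ : x₀ ∈ U) : ∃ ε φ, IsLocalFlow f U x₀ ε φ := by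
  have : CompleteSpace E := FiniteDimensional.complete ℝ E
  obtain ⟨d, hd, hdU⟩ := Metric.isOpen_iff.1 hU x₀ hx₀
  let χ : ContDiffBump x₀ := ⟨d / 4, d / 2, by positivity, by linarith⟩
  have hsupp : tsupport χ ⊆ U := by
    rw [χ.tsupport_eq]
    exact (Metric.closedBall_subset_ball (by simp only [χ]; linarith)).trans hdU
  have hχf : ContDiff ℝ ∞ fun x => χ x • f x := contDiff_iff_contDiffAt.2 fun x => by
    by_cases hx : x ∈ tsupport χ
    · exact χ.contDiff.contDiffAt.smul (hf.contDiffAt (hU.mem_nhds (hsupp hx)))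
    · refine contDiffAt_const (c := 0) |>.congr_of_eventuallyEq ?_
      filter_upwards [notMem_tsupport_iff_eventuallyEq.1 hx] with y hy
      rw [hy, Pi.zero_apply, zero_smul]
  obtain ⟨ε, φ, hφ⟩ := exists_isLocalFlow_of_contDiff hχf
    (inter_mem (hU.mem_nhds hx₀) (Metric.closedBall_mem_nhds x₀ (by positivity : 0 < d / 4)))
  refine ⟨ε, φ, hφ.pos, hφ.contDiffAt, hφ.eventually_map_zero, ?_⟩
  filter_upwards [hφ.eventually_hasDerivAt] with x hx t ht
  obtain ⟨⟨hmem, hball⟩, hderiv⟩ := hx t ht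
  rw [χ.one_of_mem_closedBall hball, one_smul] at hderiv
  exact ⟨hmem, hderiv⟩

end LocalFlow

/-! ### Flows of vector fields on compact manifolds -/

section Pushforward

variable {E : Type*} [NormedAddCommGroup E] [NormedSpace ℝ E]
  {E' : Type*} [NormedAddCommGroup E'] [NormedSpace ℝ E'] {H : Type*} [TopologicalSpace H]
  {I : ModelWithCorners ℝ E' H} {M : Type*} [TopologicalSpace M] [ChartedSpace H M]

/-- The vector field `X` is, on the image of `U`, the push-forward of the smooth vector field `f`
on `U` under `e`, which is a local diffeomorphism on `U` but need not be injective. -/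
structure IsPushforwardOn (e : E → M) (U : Set E) (f : E → E) (X : Π p : M, TangentSpace I p) :
    Prop where
  isOpen : IsOpen U
  smooth : ContDiffOn ℝ ∞ f U
  localDiffeo : ∀ z ∈ U, IsLocalDiffeomorphAt 𝓘(ℝ, E) I ∞ e z
  map_eq : ∀ z ∈ U, X (e z) = mfderiv 𝓘(ℝ, E) I e z (f z)

variable {X : Π p : M, TangentSpace I p} {e : E → M} {U : Set E} {f : E → E}

theorem IsPushforwardOn.hasMFDerivAt (h : IsPushforwardOn e U f X) {γ : ℝ → E} {t : ℝ}
    (hU : γ t ∈ U) (hγ : HasDerivAt γ (f (γ t)) t) :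
    HasMFDerivAt 𝓘(ℝ, ℝ) I (fun s => e (γ s)) t ((1 : ℝ →L[ℝ] ℝ).smulRight (X (e (γ t)))) := by
  have he := ((h.localDiffeo _ hU).mdifferentiableAt (by simp)).hasMFDerivAt
  have hγ' : HasMFDerivAt 𝓘(ℝ, ℝ) 𝓘(ℝ, E) γ t ((1 : ℝ →L[ℝ] ℝ).smulRight (f (γ t))) :=
    hγ.hasFDerivAt.hasMFDerivAt
  have hcomp : (mfderiv 𝓘(ℝ, E) I e (γ t)).comp ((1 : ℝ →L[ℝ] ℝ).smulRight (f (γ t))) =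
      (1 : ℝ →L[ℝ] ℝ).smulRight (X (e (γ t))) := by
    rw [h.map_eq _ hU]
    exact ContinuousLinearMap.ext fun s => map_smul (mfderiv 𝓘(ℝ, E) I e (γ t)) s (f (γ t))
  rw [← hcomp]
  exact he.comp t hγ'

theorem localInverse_apply_self {z : E} (he : IsLocalDiffeomorphAt 𝓘(ℝ, E) I ∞ e z) :
    he.localInverse (e z) = z :=
  he.localInverse_left_inv he.localInverse_mem_target

theorem tendsto_localInverse {z : E} (he : IsLocalDiffeomorphAt 𝓘(ℝ, E) I ∞ e z) :
    Tendsto he.localInverse (𝓝 (e z)) (𝓝 z) := by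
  simpa only [ContinuousAt, localInverse_apply_self] using
    he.localInverse_contMDiffAt.continuousAt

variable [IsManifold I ∞ M]

theorem contMDiffAt_mfderiv_apply {U : Set E} (hU : IsOpen U) (he : CMDiff[U] ∞ e) {v : E → E}
    {z : E} (hz : z ∈ U) (hv : ContDiffAt ℝ ∞ v z) :
    ContMDiffAt 𝓘(ℝ, E) I.tangent ∞
      (fun w => (⟨e w, mfderiv 𝓘(ℝ, E) I e w (v w)⟩ : TangentBundle I M)) z := by
  have hsection : CMDiffAt ∞ (fun w => (⟨w, v w⟩ : TangentBundle 𝓘(ℝ, E) E)) z :=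
    contMDiffAt_vectorSpace_iff_contDiffAt.2 hv
  have hTe : CMDiffAt ∞ (tangentMapWithin 𝓘(ℝ, E) I e U)
      (⟨z, v z⟩ : TangentBundle 𝓘(ℝ, E) E) :=
    (he.contMDiffOn_tangentMapWithin (m := ∞) (by simp) hU.uniqueMDiffOn).contMDiffAt
      ((hU.preimage (FiberBundle.continuous_proj E _)).mem_nhds hz)
  refine (hTe.comp z hsection).congr_of_eventuallyEq ?_
  filter_upwards [hU.mem_nhds hz] with w hw
  simp only [Function.comp_apply, tangentMapWithin, mfderivWithin_of_isOpen hU hw]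

theorem IsPushforwardOn.contMDiffAt (h : IsPushforwardOn e U f X) {z : E} (hz : z ∈ U) :
    CMDiffAt ∞ (T% X) (e z) := by
  have he := h.localDiffeo z hz
  have hσz := localInverse_apply_self he
  have hmap := contMDiffAt_mfderiv_apply (z := he.localInverse (e z)) h.isOpen
    (fun w hw => (h.localDiffeo w hw).contMDiffAt.contMDiffWithinAt) (hσz.symm ▸ hz)
    (h.smooth.contDiffAt (h.isOpen.mem_nhds (hσz.symm ▸ hz)))
  refine (hmap.comp (e z) he.localInverse_contMDiffAt).congr_of_eventuallyEq ?_
  filter_upwards [he.localInverse_eventuallyEq_right,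
    (tendsto_localInverse he).eventually (h.isOpen.mem_nhds hz)] with q hq hqU
  simp only [Function.comp_apply, id_eq] at hq
  simp only [Function.comp_apply]
  rw [← h.map_eq _ hqU, hq]

theorem isLocalDiffeomorphAt_extChartAt_symm [I.Boundaryless] (p : M) {z : E'}
    (hz : z ∈ (extChartAt I p).target) :
    IsLocalDiffeomorphAt 𝓘(ℝ, E') I ∞ (extChartAt I p).symm z :=
  ⟨{ (extChartAt I p).symm with
      open_source := isOpen_extChartAt_target p
      open_target := isOpen_extChartAt_source p
      contMDiffOn_toFun := contMDiffOn_extChartAt_symm p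
      contMDiffOn_invFun := by
        have h := contMDiffOn_extChartAt (I := I) (n := ∞) (x := p)
        rw [← extChartAt_source I p] at h
        exact h },
    hz, eqOn_refl _ _⟩

theorem isPushforwardOn_extChartAt_symm [CompleteSpace E'] [I.Boundaryless]
    (hX : CMDiff ∞ (T% X)) (p : M) :
    IsPushforwardOn (extChartAt I p).symm (extChartAt I p).target
      (VectorField.mpullback 𝓘(ℝ, E') I (extChartAt I p).symm X) X := by
  have hinv : ∀ z ∈ (extChartAt I p).target,
      (mfderiv 𝓘(ℝ, E') I (extChartAt I p).symm z).IsInvertible := fun z hz =>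
    ⟨(isLocalDiffeomorphAt_extChartAt_symm p hz).mfderivToContinuousLinearEquiv (by simp), rfl⟩
  refine ⟨isOpen_extChartAt_target p, fun z hz => ?_,
    fun z hz => isLocalDiffeomorphAt_extChartAt_symm p hz, fun z hz => ?_⟩
  · exact (contMDiffAt_vectorSpace_iff_contDiffAt.1
      (ContMDiffAt.mpullback_vectorField_preimage (hX _)
        (isLocalDiffeomorphAt_extChartAt_symm p hz).contMDiffAt (hinv z hz)
        (by simp))).contDiffWithinAt
  · rw [VectorField.mpullback_apply, (hinv z hz).self_apply_inverse]

end Pushforward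

section SmoothFlow

variable {E : Type*} [NormedAddCommGroup E] [NormedSpace ℝ E]
  {E' : Type*} [NormedAddCommGroup E'] [NormedSpace ℝ E'] {H : Type*} [TopologicalSpace H]
  {I : ModelWithCorners ℝ E' H} {M : Type*} [TopologicalSpace M] [ChartedSpace H M]

/-- `ψ` is the global flow of the smooth vector field `X`. -/
structure IsSmoothFlow [IsManifold I ∞ M] (X : Π p : M, TangentSpace I p) (ψ : ℝ → M → M) :
    Prop where
  field_smooth : CMDiff ∞ (T% X)
  map_zero : ∀ p, ψ 0 p = p
  map_add : ∀ s t p, ψ (s + t) p = ψ s (ψ t p)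
  generates : ∀ p, IsMIntegralCurve (fun t => ψ t p) X
  smooth : ContMDiff (𝓘(ℝ, ℝ).prod I) I ∞ (fun x : ℝ × M => ψ x.1 x.2)

variable {X : Π p : M, TangentSpace I p} {e : E → M} {U : Set E} {f : E → E} {ψ : ℝ → M → M}

theorem exists_uniform_of_isCompact {Y : Type*} [TopologicalSpace Y] {K : Set Y}
    (hK : IsCompact K) {P : ℝ → Y → Prop} (hP : ∀ {ε ε' y}, ε' ≤ ε → P ε y → P ε' y)
    (h : ∀ x ∈ K, ∃ ε > 0, ∀ᶠ y in 𝓝 x, P ε y) : ∃ ε > 0, ∀ y ∈ K, P ε y := by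
  refine hK.induction_on (p := fun s => ∃ ε > 0, ∀ y ∈ s, P ε y) ⟨1, one_pos, by simp⟩ ?_ ?_ ?_
  · rintro s t hst ⟨ε, hε, h⟩
    exact ⟨ε, hε, fun y hy => h y (hst hy)⟩
  · rintro s t ⟨ε, hε, h⟩ ⟨ε', hε', h'⟩
    refine ⟨min ε ε', lt_min hε hε', ?_⟩
    rintro y (hy | hy)
    · exact hP (min_le_left _ _) (h y hy)
    · exact hP (min_le_right _ _) (h' y hy)
  · intro x hx
    obtain ⟨ε, hε, h⟩ := h x hx
    exact ⟨_, mem_nhdsWithin_of_mem_nhds h, ε, hε, fun y hy => hy⟩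

theorem contMDiffAt_flow_add {n : ℕ∞ω} (hadd : ∀ s t p, ψ (s + t) p = ψ s (ψ t p)) {s t : ℝ}
    {p : M} (hs : ContMDiffAt (𝓘(ℝ, ℝ).prod I) I n (fun x : ℝ × M => ψ x.1 x.2) (s, ψ t p))
    (ht : ContMDiffAt (𝓘(ℝ, ℝ).prod I) I n (fun x : ℝ × M => ψ x.1 x.2) (t, p)) :
    ContMDiffAt (𝓘(ℝ, ℝ).prod I) I n (fun x : ℝ × M => ψ x.1 x.2) (s + t, p) := by
  have hψt : CMDiffAt n (ψ t) p := ht.comp p (contMDiffAt_const.prodMk contMDiffAt_id)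
  have htime : ContMDiffAt (𝓘(ℝ, ℝ).prod I) 𝓘(ℝ, ℝ) n (fun x : ℝ × M => x.1 - t) (s + t, p) :=
    contMDiffAt_fst.sub contMDiffAt_const
  have hshift := htime.prodMk (ContMDiffAt.comp (s + t, p) hψt contMDiffAt_snd)
  refine (ContMDiffAt.comp (s + t, p) (g := fun x : ℝ × M => ψ x.1 x.2)
    (by simpa using hs) hshift).congr_of_eventuallyEq (Eventually.of_forall fun x => ?_)
  simp only [Function.comp_apply, ← hadd, sub_add_cancel]

theorem IsPushforwardOn.eventually_exists_isMIntegralCurveOn [FiniteDimensional ℝ E]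
    (h : IsPushforwardOn e U f X) {z : E} (hz : z ∈ U) : ∃ ε > 0, ∀ᶠ q in 𝓝 (e z),
      ∃ γ : ℝ → M, γ 0 = q ∧ IsMIntegralCurveOn γ X (Ioo (-ε) ε) := by
  obtain ⟨ε, φ, hφ⟩ := exists_isLocalFlow h.isOpen h.smooth hz
  have he := h.localDiffeo z hz
  refine ⟨ε, hφ.pos, ?_⟩
  filter_upwards [he.localInverse_eventuallyEq_right,
    (tendsto_localInverse he).eventually hφ.eventually_map_zero,
    (tendsto_localInverse he).eventually hφ.eventually_hasDerivAt] with q hq hq0 hqd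
  refine ⟨fun t => e (φ (t, he.localInverse q)), ?_, fun s hs => ?_⟩
  · exact (congrArg e hq0).trans hq
  · exact (h.hasMFDerivAt (γ := fun t => φ (t, he.localInverse q))
      (hqd s hs).1 (hqd s hs).2).hasMFDerivWithinAt

variable [I.Boundaryless] [IsManifold I ∞ M] [T2Space M]

theorem IsPushforwardOn.flow_apply (h : IsPushforwardOn e U f X) (hX : CMDiff 1 (T% X))
    (h0 : ∀ p, ψ 0 p = p) (hψ : ∀ p, IsMIntegralCurve (fun t => ψ t p) X) {γ : ℝ → E} {ε : ℝ}
    (hγ : ∀ t ∈ Ioo (-ε) ε, γ t ∈ U ∧ HasDerivAt γ (f (γ t)) t) {t : ℝ} (ht : t ∈ Ioo (-ε) ε) :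
    ψ t (e (γ 0)) = e (γ t) :=
  isMIntegralCurveOn_Ioo_eqOn_of_contMDiff_boundaryless (γ := fun t => ψ t (e (γ 0)))
    (γ' := fun t => e (γ t)) ⟨by linarith [ht.1, ht.2], by linarith [ht.1, ht.2]⟩ hX
    ((hψ (e (γ 0))).isMIntegralCurveOn _)
    (fun s hs => (h.hasMFDerivAt (hγ s hs).1 (hγ s hs).2).hasMFDerivWithinAt) (h0 _) ht

theorem IsLocalFlow.eventually_flow_apply {φ : ℝ × E → E} {z₀ : E} {ε : ℝ}
    (hφ : IsLocalFlow f U z₀ ε φ) (h : IsPushforwardOn e U f X) (hX : CMDiff 1 (T% X))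
    (h0 : ∀ p, ψ 0 p = p) (hψ : ∀ p, IsMIntegralCurve (fun t => ψ t p) X) :
    ∀ᶠ z in 𝓝 z₀, ∀ t ∈ Ioo (-ε) ε, ψ t (e z) = e (φ (t, z)) := by
  filter_upwards [hφ.eventually_map_zero, hφ.eventually_hasDerivAt] with z hz0 hz t ht
  rw [← h.flow_apply hX h0 hψ (γ := fun t => φ (t, z)) hz ht, hz0]

theorem flow_add (hX : CMDiff 1 (T% X)) (h0 : ∀ p, ψ 0 p = p)
    (hψ : ∀ p, IsMIntegralCurve (fun t => ψ t p) X) (s t : ℝ) (p : M) :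
    ψ (s + t) p = ψ s (ψ t p) :=
  congrFun (isMIntegralCurve_Ioo_eq_of_contMDiff_boundaryless (t₀ := 0) hX ((hψ p).comp_add t)
    (hψ (ψ t p)) (by simp only [Function.comp_apply, zero_add, h0])) s

variable [FiniteDimensional ℝ E']

theorem exists_isMIntegralCurve [CompactSpace M] (hX : CMDiff ∞ (T% X)) (p : M) :
    ∃ γ : ℝ → M, γ 0 = p ∧ IsMIntegralCurve γ X := by
  have : CompleteSpace E' := FiniteDimensional.complete ℝ E'
  obtain ⟨ε, hε, h⟩ := exists_uniform_of_isCompact (isCompact_univ (X := M))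
    (P := fun ε q => ∃ γ : ℝ → M, γ 0 = q ∧ IsMIntegralCurveOn γ X (Ioo (-ε) ε))
    (fun hle ⟨γ, hγ0, hγ⟩ => ⟨γ, hγ0, hγ.mono (Ioo_subset_Ioo (neg_le_neg hle) hle)⟩)
    fun p _ => by
      simpa only [extChartAt_to_inv] using (isPushforwardOn_extChartAt_symm hX p
        ).eventually_exists_isMIntegralCurveOn (mem_extChartAt_target p)
  exact exists_isMIntegralCurve_of_isMIntegralCurveOn (hX.of_le (by simp)) hε
    (fun q => h q (mem_univ q)) p

theorem contMDiffAt_flow_zero (hX : CMDiff ∞ (T% X)) (h0 : ∀ p, ψ 0 p = p)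
    (hψ : ∀ p, IsMIntegralCurve (fun t => ψ t p) X) (p : M) :
    ContMDiffAt (𝓘(ℝ, ℝ).prod I) I ∞ (fun x : ℝ × M => ψ x.1 x.2) (0, p) := by
  have : CompleteSpace E' := FiniteDimensional.complete ℝ E'
  have h := isPushforwardOn_extChartAt_symm hX p
  obtain ⟨ε, φ, hφ⟩ := exists_isLocalFlow h.isOpen h.smooth (mem_extChartAt_target p)
  have hφ0 : φ (0, extChartAt I p p) = extChartAt I p p := hφ.eventually_map_zero.self_of_nhds
  have hchart : ContMDiffAt (𝓘(ℝ, ℝ).prod I) 𝓘(ℝ, ℝ × E') ∞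
      (fun x : ℝ × M => (x.1, extChartAt I p x.2)) (0, p) := by
    rw [modelWithCornersSelf_prod, ← chartedSpaceSelf_prod]
    have hsnd : ContMDiffAt (𝓘(ℝ, ℝ).prod I) I ∞ (Prod.snd : ℝ × M → M) (0, p) := contMDiffAt_snd
    exact contMDiffAt_fst.prodMk (contMDiffAt_extChartAt.comp (0, p) hsnd)
  have hparam : CMDiffAt ∞ (extChartAt I p).symm (φ (0, extChartAt I p p)) := by
    rw [hφ0]
    exact (h.localDiffeo _ (mem_extChartAt_target p)).contMDiffAt
  refine (ContMDiffAt.comp (0, p) hparam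
    (ContMDiffAt.comp (0, p) hφ.contDiffAt.contMDiffAt hchart)).congr_of_eventuallyEq ?_
  have hchart₀ := (continuousAt_extChartAt (I := I) p).eventually
    (hφ.eventually_flow_apply h (hX.of_le (by simp)) h0 hψ)
  rw [nhds_prod_eq]
  have htime : ∀ᶠ t in 𝓝 (0 : ℝ), t ∈ Ioo (-ε) ε := Ioo_mem_nhds (neg_lt_zero.2 hφ.pos) hφ.pos
  filter_upwards [htime.prod_mk
    (hchart₀.and (extChartAt_source_mem_nhds (I := I) p))] with x hx
  simpa only [Function.comp_apply, (extChartAt I p).left_inv hx.2.2] using hx.2.1 x.1 hx.1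

theorem exists_contMDiffAt_flow_of_abs_lt [CompactSpace M] (hX : CMDiff ∞ (T% X))
    (h0 : ∀ p, ψ 0 p = p) (hψ : ∀ p, IsMIntegralCurve (fun t => ψ t p) X) (n : ℕ) :
    ∃ ε > 0, ∀ p t, |t| < ε →
      ContMDiffAt (𝓘(ℝ, ℝ).prod I) I n (fun x : ℝ × M => ψ x.1 x.2) (t, p) := by
  obtain ⟨ε, hε, h⟩ := exists_uniform_of_isCompact (isCompact_univ (X := M))
    (P := fun ε q => ∀ t, |t| < ε → ContMDiffAt (𝓘(ℝ, ℝ).prod I) I n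
      (fun x : ℝ × M => ψ x.1 x.2) (t, q)) (fun hle h t ht => h t (ht.trans_le hle)) fun p _ => by
    have hnhds := (contMDiffAt_iff_contMDiffAt_nhds (by simp)).1
      (contMDiffAt_infty.1 (contMDiffAt_flow_zero hX h0 hψ p) n)
    rw [nhds_prod_eq, eventually_prod_iff] at hnhds
    obtain ⟨P, hP, Q, hQ, hPQ⟩ := hnhds
    obtain ⟨ε, hε, hball⟩ := Metric.eventually_nhds_iff.1 hP
    refine ⟨ε, hε, ?_⟩
    filter_upwards [hQ] with q hq t ht
    exact hPQ (hball (by simpa using ht)) hq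
  exact ⟨ε, hε, fun p => h p (mem_univ p)⟩

theorem contMDiff_flow [CompactSpace M] (hX : CMDiff ∞ (T% X)) (h0 : ∀ p, ψ 0 p = p)
    (hψ : ∀ p, IsMIntegralCurve (fun t => ψ t p) X) :
    ContMDiff (𝓘(ℝ, ℝ).prod I) I ∞ (fun x : ℝ × M => ψ x.1 x.2) := by
  rw [contMDiff_infty]
  rintro n ⟨t, p⟩
  obtain ⟨ε, hε, hsmall⟩ := exists_contMDiffAt_flow_of_abs_lt hX h0 hψ n
  obtain ⟨k, hk⟩ := exists_nat_gt (|t| / ε)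
  have hk0 : (0 : ℝ) < k := lt_of_le_of_lt (by positivity) hk
  have hstep : |t / k| < ε := by
    rw [abs_div, abs_of_pos hk0, div_lt_iff₀ hk0]
    rwa [div_lt_iff₀ hε, mul_comm] at hk
  have hmul : ∀ (j : ℕ) (q : M), ContMDiffAt (𝓘(ℝ, ℝ).prod I) I n
      (fun x : ℝ × M => ψ x.1 x.2) (j * (t / k), q) := by
    intro j
    induction j with
    | zero => intro q; simpa using hsmall q 0 (by simpa using hε)
    | succ j ih =>
      intro q
      rw [Nat.cast_succ, add_one_mul, add_comm]
      exact contMDiffAt_flow_add (flow_add (hX.of_le (by simp)) h0 hψ) (hsmall _ _ hstep) (ih q)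
  simpa only [mul_div_cancel₀ _ hk0.ne'] using hmul k p

theorem exists_isSmoothFlow [CompactSpace M] (hX : CMDiff ∞ (T% X)) :
    ∃ ψ : ℝ → M → M, IsSmoothFlow X ψ := by
  choose γ hγ0 hγ using exists_isMIntegralCurve hX
  exact ⟨fun t p => γ p t, hX, hγ0, flow_add (hX.of_le (by simp)) (ψ := fun t p => γ p t) hγ0 hγ,
    hγ, contMDiff_flow (ψ := fun t p => γ p t) hX hγ0 hγ⟩

end SmoothFlow

/-! ### The linearized flow -/

section Variation

variable {E F : Type*} [NormedAddCommGroup E] [NormedSpace ℝ E] [NormedAddCommGroup F]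
  [NormedSpace ℝ F] {φ : ℝ × E → F} {f : E → F} {x₀ : E}

theorem eventually_hasFDerivAt_slice (hφ : ContDiffAt ℝ 1 φ (0, x₀)) : ∀ᶠ t in 𝓝 (0 : ℝ),
    HasFDerivAt (fun x => φ (t, x)) ((fderiv ℝ φ (t, x₀)).comp (.inr ℝ ℝ E)) x₀ := by
  have hslice : Tendsto (fun t : ℝ => (t, x₀)) (𝓝 0) (𝓝 (0, x₀)) :=
    (Continuous.prodMk_left x₀).tendsto 0
  filter_upwards [hslice.eventually (hφ.eventually (by simp))] with t ht
  exact (ht.differentiableAt (by simp)).hasFDerivAt.comp x₀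
    (hasFDerivAt_prodMk_right (𝕜 := ℝ) t x₀)

theorem hasDerivAt_fderiv_slice (hφ : ContDiffAt ℝ 2 φ (0, x₀)) (v : E) :
    HasDerivAt (fun t => fderiv ℝ (fun x => φ (t, x)) x₀ v)
      (fderiv ℝ (fderiv ℝ φ) (0, x₀) (1, 0) (0, v)) 0 := by
  have hD : HasFDerivAt (fderiv ℝ φ) (fderiv ℝ (fderiv ℝ φ) (0, x₀)) (0, x₀) :=
    ((hφ.fderiv_right (m := 1) (by norm_num)).differentiableAt (by simp)).hasFDerivAt
  have hline : HasDerivAt (fun t : ℝ => (t, x₀)) ((1 : ℝ), (0 : E)) 0 :=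
    (hasDerivAt_id (0 : ℝ)).prodMk (hasDerivAt_const 0 x₀)
  have hfull : HasDerivAt (fun t : ℝ => fderiv ℝ φ (t, x₀) (0, v))
      (fderiv ℝ (fderiv ℝ φ) (0, x₀) (1, 0) (0, v)) 0 := by
    have hcomp : HasDerivAt (fun t : ℝ => fderiv ℝ φ (t, x₀))
        (fderiv ℝ (fderiv ℝ φ) (0, x₀) (1, 0)) 0 := hD.comp_hasDerivAt (0 : ℝ) hline
    exact (hcomp.clm_apply (hasDerivAt_const (0 : ℝ) ((0 : ℝ), v))).congr_deriv (by simp)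
  refine hfull.congr_of_eventuallyEq ?_
  filter_upwards [eventually_hasFDerivAt_slice (hφ.of_le (by norm_num))] with t ht
  simp [ht.fderiv]

theorem fderiv_initial_velocity (hφ : ContDiffAt ℝ 2 φ (0, x₀))
    (hf : ∀ᶠ x in 𝓝 x₀, HasDerivAt (fun s => φ (s, x)) (f x) 0) (v : E) :
    fderiv ℝ f x₀ v = fderiv ℝ (fderiv ℝ φ) (0, x₀) (0, v) (1, 0) := by
  have hD : HasFDerivAt (fderiv ℝ φ) (fderiv ℝ (fderiv ℝ φ) (0, x₀)) (0, x₀) :=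
    ((hφ.fderiv_right (m := 1) (by norm_num)).differentiableAt (by simp)).hasFDerivAt
  have hslice : HasFDerivAt (fun x => fderiv ℝ φ (0, x) ((1 : ℝ), (0 : E)))
      (((ContinuousLinearMap.apply ℝ F ((1 : ℝ), (0 : E))).comp
        (fderiv ℝ (fderiv ℝ φ) (0, x₀))).comp (.inr ℝ ℝ E)) x₀ :=
    ((ContinuousLinearMap.apply ℝ F ((1 : ℝ), (0 : E))).hasFDerivAt.comp ((0 : ℝ), x₀) hD).comp x₀
      (hasFDerivAt_prodMk_right (𝕜 := ℝ) (0 : ℝ) x₀)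
  have hinit : Tendsto (fun x : E => ((0 : ℝ), x)) (𝓝 x₀) (𝓝 (0, x₀)) :=
    (Continuous.prodMk_right 0).tendsto x₀
  have heq : f =ᶠ[𝓝 x₀] fun x => fderiv ℝ φ (0, x) ((1 : ℝ), (0 : E)) := by
    filter_upwards [hf, hinit.eventually (hφ.eventually (by simp))] with x hx hφx
    exact hx.unique ((hφx.differentiableAt (by simp)).hasFDerivAt.comp_hasDerivAt (0 : ℝ)
      ((hasDerivAt_id (0 : ℝ)).prodMk (hasDerivAt_const 0 x)))
  simp [(hslice.congr_of_eventuallyEq heq).fderiv]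

end Variation

section LocalFlow

variable {E : Type*} [NormedAddCommGroup E] [NormedSpace ℝ E] {f : E → E} {U : Set E} {x₀ : E}
  {ε : ℝ} {φ : ℝ × E → E}

theorem IsLocalFlow.hasDerivAt_zero (hφ : IsLocalFlow f U x₀ ε φ) :
    HasDerivAt (fun s => φ (s, x₀)) (f x₀) 0 := by
  have h := (hφ.eventually_hasDerivAt.self_of_nhds 0 ⟨neg_lt_zero.2 hφ.pos, hφ.pos⟩).2
  rwa [hφ.eventually_map_zero.self_of_nhds] at h

theorem IsLocalFlow.fderiv_zero (hφ : IsLocalFlow f U x₀ ε φ) (v : E) :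
    fderiv ℝ (fun x => φ (0, x)) x₀ v = v := by
  have hid : (fun x => φ (0, x)) =ᶠ[𝓝 x₀] id := hφ.eventually_map_zero
  rw [hid.fderiv_eq, fderiv_id, ContinuousLinearMap.id_apply]

theorem IsLocalFlow.hasDerivAt_fderiv (hφ : IsLocalFlow f U x₀ ε φ) (v : E) :
    HasDerivAt (fun t => fderiv ℝ (fun x => φ (t, x)) x₀ v) (fderiv ℝ f x₀ v) 0 := by
  have hφ₂ : ContDiffAt ℝ 2 φ (0, x₀) := contDiffAt_infty.1 hφ.contDiffAt 2
  have hf : ∀ᶠ x in 𝓝 x₀, HasDerivAt (fun s => φ (s, x)) (f x) 0 := by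
    filter_upwards [hφ.eventually_map_zero, hφ.eventually_hasDerivAt] with x hx0 hx
    have h := (hx 0 ⟨neg_lt_zero.2 hφ.pos, hφ.pos⟩).2
    rwa [hx0] at h
  have hsymm : IsSymmSndFDerivAt ℝ φ (0, x₀) := hφ₂.isSymmSndFDerivAt (by simp)
  rw [fderiv_initial_velocity hφ₂ hf, hsymm.eq]
  exact hasDerivAt_fderiv_slice hφ₂ v

end LocalFlow

section LinearizedFlow

variable {S : Type*} [TopologicalSpace S] [ChartedSpace (EuclideanSpace ℝ (Fin 2)) S]
  {X : VField S} {e : ℂ → S} {U : Set ℂ} {f : ℂ → ℂ} {ψ : ℝ → S → S} {Ω : BilinForm S}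
  {ρ H : ℂ → ℝ}

/-- The differential of a parametrization, with its target tangent space read as the model
space. -/
def diffParam (e : ℂ → S) (z : ℂ) : ℂ →L[ℝ] EuclideanSpace ℝ (Fin 2) :=
  mfderiv 𝓘(ℝ, ℂ) (𝓡 2) e z

/-- The differential of a self-map, read as an endomorphism of the model space, so that
differentials at different base points can be compared. -/
def diffMap (F : S → S) (p : S) : EuclideanSpace ℝ (Fin 2) →L[ℝ] EuclideanSpace ℝ (Fin 2) :=
  mfderiv (𝓡 2) (𝓡 2) F p

/-- A bilinear form at a point, read as a form on the model space. -/
def formAt (Ω : BilinForm S) (p : S) :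
    EuclideanSpace ℝ (Fin 2) →L[ℝ] EuclideanSpace ℝ (Fin 2) →L[ℝ] ℝ := Ω p

/-- The planar vector field `f` on `U` is Hamiltonian with Hamiltonian `H` for the area form with
density `ρ`, and this area form is the pull-back of `Ω` under `e`. The standard area form is
written as `(v, w) ↦ Im (conj v * w)`. -/
structure IsHamiltonianOn (Ω : BilinForm S) (e : ℂ → S) (U : Set ℂ) (f : ℂ → ℂ)
    (ρ H : ℂ → ℝ) : Prop where
  form_eq : ∀ z ∈ U, ∀ v w : ℂ, formAt Ω (e z) (diffParam e z v) (diffParam e z w) =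
    ρ z * (starRingEnd ℂ v * w).im
  smooth_density : ContDiffOn ℝ ∞ ρ U
  smooth_hamiltonian : ContDiffOn ℝ ∞ H U
  fderiv_eq : ∀ z ∈ U, ∀ w : ℂ, ρ z * (starRingEnd ℂ (f z) * w).im = fderiv ℝ H z w

theorem IsHamiltonianOn.fderiv_fderiv_eq (hH : IsHamiltonianOn Ω e U f ρ H) (hU : IsOpen U)
    (hf : ContDiffOn ℝ ∞ f U) {z : ℂ} (hz : z ∈ U) (v w : ℂ) :
    fderiv ℝ (fderiv ℝ H) z v w = fderiv ℝ ρ z v * (starRingEnd ℂ (f z) * w).im +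
      ρ z * (starRingEnd ℂ (fderiv ℝ f z v) * w).im := by
  have hn := hU.mem_nhds hz
  have hρ := ((hH.smooth_density.contDiffAt hn).differentiableAt (by simp)).hasFDerivAt
  have hf' := ((hf.contDiffAt hn).differentiableAt (by simp)).hasFDerivAt
  have hdH : HasFDerivAt (fderiv ℝ H) (fderiv ℝ (fderiv ℝ H) z) z :=
    (((hH.smooth_hamiltonian.contDiffAt hn).fderiv_right (m := 1)
      (by norm_cast)).differentiableAt (by simp)).hasFDerivAt
  have hright := hρ.mul (Complex.imCLM.hasFDerivAt.comp z
    ((Complex.conjCLE.toContinuousLinearMap.hasFDerivAt.comp z hf').mul_const w))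
  have hleft := (ContinuousLinearMap.apply ℝ ℝ w).hasFDerivAt.comp z hdH
  have heq : (fun z => fderiv ℝ H z w) =ᶠ[𝓝 z] fun z => ρ z * (starRingEnd ℂ (f z) * w).im := by
    filter_upwards [hn] with y hy using (hH.fderiv_eq y hy w).symm
  have h := DFunLike.congr_fun (hleft.unique (hright.congr_of_eventuallyEq heq)) v
  simp at h ⊢
  linear_combination h

/-- This is the symmetry of the second derivative of `H`; it says that the Lie derivative of the
area form along `f` vanishes. -/
theorem IsHamiltonianOn.divergence_eq (hH : IsHamiltonianOn Ω e U f ρ H) (hU : IsOpen U)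
    (hf : ContDiffOn ℝ ∞ f U) {z : ℂ} (hz : z ∈ U) (v w : ℂ) :
    fderiv ℝ ρ z (f z) * (starRingEnd ℂ v * w).im + ρ z *
      ((starRingEnd ℂ (fderiv ℝ f z v) * w).im + (starRingEnd ℂ v * fderiv ℝ f z w).im) = 0 := by
  have hsymm : IsSymmSndFDerivAt ℝ H z :=
    (contDiffAt_infty.1 (hH.smooth_hamiltonian.contDiffAt (hU.mem_nhds hz)) 2).isSymmSndFDerivAt
      (by simp)
  have hmixed := hsymm.eq v w
  rw [hH.fderiv_fderiv_eq hU hf hz, hH.fderiv_fderiv_eq hU hf hz] at hmixed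
  have hplane : (starRingEnd ℂ v * w).im • f z =
      (starRingEnd ℂ (f z) * w).im • v - (starRingEnd ℂ (f z) * v).im • w := by
    apply Complex.ext <;> simp <;> ring
  have hρ := congrArg (fderiv ℝ ρ z) hplane
  simp only [map_sub, map_smul, smul_eq_mul] at hρ
  have hanti : (starRingEnd ℂ v * fderiv ℝ f z w).im =
      -(starRingEnd ℂ (fderiv ℝ f z w) * v).im := by
    simp only [Complex.mul_im, Complex.conj_re, Complex.conj_im]; ring
  rw [hanti]
  linear_combination hρ + hmixed

variable [IsManifold (𝓡 2) ∞ S]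

theorem IsSmoothFlow.mdifferentiableAt (hψ : IsSmoothFlow X ψ) (t : ℝ) (p : S) :
    MDifferentiableAt (𝓡 2) (𝓡 2) (ψ t) p :=
  (hψ.smooth.comp (contMDiff_const.prodMk contMDiff_id)).mdifferentiable (by simp) p

theorem IsSmoothFlow.diffMap_zero (hψ : IsSmoothFlow X ψ) (p : S)
    (v : EuclideanSpace ℝ (Fin 2)) : diffMap (ψ 0) p v = v := by
  have hid : ψ 0 = id := funext hψ.map_zero
  rw [hid, diffMap, mfderiv_id]
  rfl

theorem IsSmoothFlow.diffMap_add (hψ : IsSmoothFlow X ψ) (s t : ℝ) (p : S)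
    (v : EuclideanSpace ℝ (Fin 2)) :
    diffMap (ψ (s + t)) p v = diffMap (ψ s) (ψ t p) (diffMap (ψ t) p v) := by
  have hcomp : ψ (s + t) = ψ s ∘ ψ t := funext (hψ.map_add s t)
  rw [hcomp, diffMap, mfderiv_comp p (hψ.mdifferentiableAt s _) (hψ.mdifferentiableAt t p)]
  rfl

theorem IsSmoothFlow.map_eq_self_iff [T2Space S] (hψ : IsSmoothFlow X ψ) (p : S) :
    (∀ t, ψ t p = p) ↔ X p = 0 := by
  refine ⟨fun h => ?_, fun h t => ?_⟩
  · have hconst : HasMFDerivAt 𝓘(ℝ, ℝ) (𝓡 2) (fun t => ψ t p) 0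
        (0 : ℝ →L[ℝ] EuclideanSpace ℝ (Fin 2)) := by
      rw [funext h]; exact hasMFDerivAt_const p 0
    have hone : (1 : ℝ) • X (ψ 0 p) = 0 :=
      DFunLike.congr_fun (hasMFDerivAt_unique (hψ.generates p 0) hconst) (1 : ℝ)
    rwa [one_smul, h] at hone
  · exact congrFun (isMIntegralCurve_Ioo_eq_of_contMDiff_boundaryless (t₀ := 0)
      (hψ.field_smooth.of_le (by simp)) (hψ.generates p) (isMIntegralCurve_const h)
      (hψ.map_zero p)) t

theorem hasDerivAt_of_hasDerivAt_add {F : Type*} [NormedAddCommGroup F] [NormedSpace ℝ F]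
    {Q : ℝ → F} {q : F} {t : ℝ} (h : HasDerivAt (fun s => Q (s + t)) q 0) : HasDerivAt Q q t := by
  have hshift : HasDerivAt (fun s => Q (s + t)) q (t - t) := by rwa [sub_self]
  simpa only [sub_add_cancel] using hshift.comp_sub_const t t

theorem IsSmoothFlow.form_eq (hψ : IsSmoothFlow X ψ)
    (h : ∀ p v w, HasDerivAt (fun t => formAt Ω (ψ t p) (diffMap (ψ t) p v) (diffMap (ψ t) p w))
      0 0) (t : ℝ) (p : S) (v w : EuclideanSpace ℝ (Fin 2)) :
    formAt Ω (ψ t p) (diffMap (ψ t) p v) (diffMap (ψ t) p w) = formAt Ω p v w := by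
  have hd : ∀ t, HasDerivAt
      (fun t => formAt Ω (ψ t p) (diffMap (ψ t) p v) (diffMap (ψ t) p w)) 0 t := fun t => by
    apply hasDerivAt_of_hasDerivAt_add
    simpa only [← hψ.diffMap_add, ← hψ.map_add] using
      h (ψ t p) (diffMap (ψ t) p v) (diffMap (ψ t) p w)
  have hconst := is_const_of_deriv_eq_zero (fun t => (hd t).differentiableAt)
    (fun t => (hd t).deriv) t 0
  simpa only [hψ.diffMap_zero, hψ.map_zero] using hconst

theorem eq_exp_smul_of_hasDerivAt {F : Type*} [NormedAddCommGroup F] [NormedSpace ℝ F]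
    {a : ℝ → F} {κ : ℝ} (h : ∀ t, HasDerivAt a (κ • a t) t) (t : ℝ) :
    a t = Real.exp (κ * t) • a 0 := by
  have hd : ∀ t, HasDerivAt (fun t => Real.exp (-(κ * t)) • a t) 0 t := fun t => by
    have hexp : HasDerivAt (fun t => Real.exp (-(κ * t))) (Real.exp (-(κ * t)) * -κ) t :=
      (hasDerivAt_const_mul κ).fun_neg.exp
    refine (hexp.smul (h t)).congr_deriv ?_
    rw [smul_smul, ← add_smul, mul_neg, add_neg_cancel, zero_smul]
  have hconst := is_const_of_deriv_eq_zero (fun t => (hd t).differentiableAt)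
    (fun t => (hd t).deriv) t 0
  simp only [mul_zero, neg_zero, Real.exp_zero, one_smul] at hconst
  rw [← hconst, smul_smul, ← Real.exp_add, add_neg_cancel, Real.exp_zero, one_smul]

theorem IsSmoothFlow.diffMap_eq_exp_smul (hψ : IsSmoothFlow X ψ) {p : S} (hp : ∀ t, ψ t p = p)
    {v : EuclideanSpace ℝ (Fin 2)} {c : ℝ}
    (h : HasDerivAt (fun t => diffMap (ψ t) p v) (c • v) 0) (t : ℝ) :
    diffMap (ψ t) p v = Real.exp (c * t) • v := by
  have hd : ∀ t, HasDerivAt (fun t => diffMap (ψ t) p v) (c • diffMap (ψ t) p v) t := fun t => by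
    have hcomp := (diffMap (ψ t) p).hasFDerivAt.comp_hasDerivAt (0 : ℝ) h
    rw [map_smul] at hcomp
    apply hasDerivAt_of_hasDerivAt_add
    refine hcomp.congr_of_eventuallyEq (Eventually.of_forall fun s => ?_)
    simp only [Function.comp_apply, add_comm s t, hψ.diffMap_add, hp]
  rw [eq_exp_smul_of_hasDerivAt hd t, hψ.diffMap_zero]

variable [T2Space S] {z₀ : ℂ} {ε : ℝ} {φ : ℝ × ℂ → ℂ}

theorem IsLocalFlow.eventually_diffMap (hφ : IsLocalFlow f U z₀ ε φ)
    (h : IsPushforwardOn e U f X) (hψ : IsSmoothFlow X ψ) (hz₀ : z₀ ∈ U) :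
    ∀ᶠ t in 𝓝 (0 : ℝ), ∀ v : ℂ, diffMap (ψ t) (e z₀) (diffParam e z₀ v) =
      diffParam e (φ (t, z₀)) (fderiv ℝ (fun z => φ (t, z)) z₀ v) := by
  filter_upwards [eventually_hasFDerivAt_slice (contDiffAt_infty.1 hφ.contDiffAt 1),
    Ioo_mem_nhds (neg_lt_zero.2 hφ.pos) hφ.pos] with t ht htε v
  have he : ∀ z ∈ U, MDifferentiableAt 𝓘(ℝ, ℂ) (𝓡 2) e z := fun z hz =>
    (h.localDiffeo z hz).mdifferentiableAt (by simp)
  have heq : ψ t ∘ e =ᶠ[𝓝 z₀] e ∘ fun z => φ (t, z) := by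
    filter_upwards [hφ.eventually_flow_apply h (hψ.field_smooth.of_le (by simp)) hψ.map_zero
      hψ.generates] with z hz using hz t htε
  have hleft := mfderiv_comp z₀ (hψ.mdifferentiableAt t (e z₀)) (he z₀ hz₀)
  have hright := mfderiv_comp z₀ (f := fun z => φ (t, z))
    (he _ (hφ.eventually_hasDerivAt.self_of_nhds t htε).1)
    ht.differentiableAt.mdifferentiableAt
  rw [mfderiv_eq_fderiv] at hright
  exact DFunLike.congr_fun
    (hleft.symm.trans ((heq.mfderiv_eq (I := 𝓘(ℝ, ℂ)) (I' := 𝓡 2)).trans hright)) v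

theorem IsHamiltonianOn.hasDerivAt_form (hH : IsHamiltonianOn Ω e U f ρ H)
    (h : IsPushforwardOn e U f X) (hψ : IsSmoothFlow X ψ) (hz₀ : z₀ ∈ U) (v w : ℂ) :
    HasDerivAt (fun t => formAt Ω (ψ t (e z₀)) (diffMap (ψ t) (e z₀) (diffParam e z₀ v))
      (diffMap (ψ t) (e z₀) (diffParam e z₀ w))) 0 0 := by
  obtain ⟨ε, φ, hφ⟩ := exists_isLocalFlow h.isOpen h.smooth hz₀
  have hφ0 : φ (0, z₀) = z₀ := hφ.eventually_map_zero.self_of_nhds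
  have hρ : HasDerivAt (fun t => ρ (φ (t, z₀))) (fderiv ℝ ρ z₀ (f z₀)) 0 := by
    refine HasFDerivAt.comp_hasDerivAt (0 : ℝ) ?_ hφ.hasDerivAt_zero
    rw [hφ0]
    exact ((hH.smooth_density.contDiffAt (h.isOpen.mem_nhds hz₀)).differentiableAt
      (by simp)).hasFDerivAt
  have harea := Complex.imCLM.hasFDerivAt.comp_hasDerivAt (0 : ℝ)
    ((Complex.conjCLE.toContinuousLinearMap.hasFDerivAt.comp_hasDerivAt (0 : ℝ)
      (hφ.hasDerivAt_fderiv v)).mul (hφ.hasDerivAt_fderiv w))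
  refine ((hρ.mul harea).congr_deriv ?_).congr_of_eventuallyEq ?_
  · simpa [hφ0, hφ.fderiv_zero] using hH.divergence_eq h.isOpen h.smooth hz₀ v w
  · filter_upwards [hφ.eventually_diffMap h hψ hz₀,
      Ioo_mem_nhds (neg_lt_zero.2 hφ.pos) hφ.pos] with t ht htε
    rw [(hφ.eventually_flow_apply h (hψ.field_smooth.of_le (by simp)) hψ.map_zero
      hψ.generates).self_of_nhds t htε, ht v, ht w,
      hH.form_eq _ (hφ.eventually_hasDerivAt.self_of_nhds t htε).1]
    rfl

theorem IsLocalFlow.eventually_eq_self (hφ : IsLocalFlow f U z₀ ε φ)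
    (h : IsPushforwardOn e U f X) (hψ : IsSmoothFlow X ψ) (hz₀ : z₀ ∈ U)
    (hfix : ∀ t, ψ t (e z₀) = e z₀) : ∀ᶠ t in 𝓝 (0 : ℝ), φ (t, z₀) = z₀ := by
  have he := h.localDiffeo z₀ hz₀
  have hφ0 : φ (0, z₀) = z₀ := hφ.eventually_map_zero.self_of_nhds
  have htarget : ∀ᶠ t in 𝓝 (0 : ℝ), φ (t, z₀) ∈ he.localInverse.target := by
    refine hφ.hasDerivAt_zero.continuousAt.eventually ?_
    simp only [hφ0]
    exact he.localInverse.open_target.mem_nhds he.localInverse_mem_target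
  filter_upwards [htarget, Ioo_mem_nhds (neg_lt_zero.2 hφ.pos) hφ.pos] with t ht htε
  have hflow := (hφ.eventually_flow_apply h (hψ.field_smooth.of_le (by simp)) hψ.map_zero
    hψ.generates).self_of_nhds t htε
  rw [← he.localInverse_left_inv ht, ← hflow, hfix, localInverse_apply_self]

theorem IsPushforwardOn.hasDerivAt_diffMap (h : IsPushforwardOn e U f X) (hψ : IsSmoothFlow X ψ)
    (hz₀ : z₀ ∈ U) (hfix : ∀ t, ψ t (e z₀) = e z₀) (v : ℂ) :
    HasDerivAt (fun t => diffMap (ψ t) (e z₀) (diffParam e z₀ v))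
      (diffParam e z₀ (fderiv ℝ f z₀ v)) 0 := by
  obtain ⟨ε, φ, hφ⟩ := exists_isLocalFlow h.isOpen h.smooth hz₀
  refine ((diffParam e z₀).hasFDerivAt.comp_hasDerivAt (0 : ℝ)
    (hφ.hasDerivAt_fderiv v)).congr_of_eventuallyEq ?_
  filter_upwards [hφ.eventually_diffMap h hψ hz₀, hφ.eventually_eq_self h hψ hz₀ hfix]
    with t ht ht₀
  rw [ht v, ht₀, Function.comp_apply]

end LinearizedFlow

section Hyperbolic

theorem charpoly_of_eigenbasis {A : EuclideanSpace ℝ (Fin 2) →L[ℝ] EuclideanSpace ℝ (Fin 2)}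
    (P : ℂ ≃L[ℝ] EuclideanSpace ℝ (Fin 2)) {α β : ℝ} (h1 : A (P 1) = α • P 1)
    (hI : A (P Complex.I) = β • P Complex.I) :
    A.toLinearMap.charpoly =
      (Polynomial.X - Polynomial.C α) * (Polynomial.X - Polynomial.C β) := by
  let b : Module.Basis (Fin 2) ℝ (EuclideanSpace ℝ (Fin 2)) :=
    Complex.basisOneI.map P.toLinearEquiv
  have hA : ∀ j, A.toLinearMap (b j) = (![α, β] j) • b j := by
    intro j
    fin_cases j
    · simpa [b] using h1
    · simpa [b] using hI
  have hM : LinearMap.toMatrix b b A.toLinearMap = Matrix.diagonal ![α, β] := by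
    ext i j
    rw [LinearMap.toMatrix_apply, hA, map_smul, Module.Basis.repr_self]
    by_cases hij : i = j
    · subst hij; simp
    · simp [hij]
  rw [← LinearMap.charpoly_toMatrix A.toLinearMap b, hM, Matrix.charpoly_diagonal]
  simp

theorem isHyperbolicMap_of_eigenbasis
    {A : EuclideanSpace ℝ (Fin 2) →L[ℝ] EuclideanSpace ℝ (Fin 2)}
    (P : ℂ ≃L[ℝ] EuclideanSpace ℝ (Fin 2)) {κ : ℝ} (hκ : κ ≠ 0)
    (h1 : A (P 1) = Real.exp κ • P 1) (hI : A (P Complex.I) = Real.exp (-κ) • P Complex.I) :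
    IsHyperbolicMap A := by
  have hreal : ∀ c : ℝ, c ≠ 0 → ∀ z : ℂ, z = (Real.exp c : ℂ) → z.im = 0 ∧ z ≠ 1 ∧ z ≠ -1 := by
    rintro c hc z rfl
    refine ⟨Complex.ofReal_im _, fun h => ?_, fun h => ?_⟩
    · exact hc ((Real.exp_eq_one_iff c).1 (by exact_mod_cast h))
    · have : Real.exp c = -1 := by exact_mod_cast h
      linarith [Real.exp_pos c]
  intro z hz
  rw [charpoly_of_eigenbasis P h1 hI] at hz
  simp only [Polynomial.map_mul, Polynomial.map_sub, Polynomial.map_X, Polynomial.map_C,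
    Polynomial.IsRoot.def, Polynomial.eval_mul, Polynomial.eval_sub, Polynomial.eval_X,
    Polynomial.eval_C, mul_eq_zero, sub_eq_zero, Complex.coe_algebraMap] at hz
  exact hz.elim (hreal κ hκ z) (hreal (-κ) (neg_ne_zero.2 hκ) z)

variable {S : Type*} [TopologicalSpace S] [ChartedSpace (EuclideanSpace ℝ (Fin 2)) S]
  {X : VField S} {e : ℂ → S} {U : Set ℂ} {f : ℂ → ℂ} {ψ : ℝ → S → S}

theorem derivAtFixed_eq_diffMap {F : S → S} {p : S} (hp : F p = p) :
    (derivAtFixed F p hp : EuclideanSpace ℝ (Fin 2) →L[ℝ] EuclideanSpace ℝ (Fin 2)) =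
      diffMap F p := by
  have hcast : ∀ (q : S) (hq : F p = q),
      (Eq.rec (motive := fun q _ => TangentSpace (𝓡 2) p →L[ℝ] TangentSpace (𝓡 2) q)
        (mfderiv (𝓡 2) (𝓡 2) F p) hq :
        EuclideanSpace ℝ (Fin 2) →L[ℝ] EuclideanSpace ℝ (Fin 2)) = diffMap F p := by
    rintro q rfl
    rfl
  exact hcast p hp

theorem IsPushforwardOn.isHyperbolicFixedPoint [T2Space S] [IsManifold (𝓡 2) ∞ S]
    (h : IsPushforwardOn e U f X) (hψ : IsSmoothFlow X ψ) {z₀ : ℂ} (hz₀ : z₀ ∈ U)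
    (hfix : ∀ t, ψ t (e z₀) = e z₀) {κ : ℝ} (hκ : κ ≠ 0)
    (hf : ∀ v, fderiv ℝ f z₀ v = κ • starRingEnd ℂ v) :
    IsHyperbolicFixedPoint (ψ 1) (e z₀) := by
  let P : ℂ ≃L[ℝ] EuclideanSpace ℝ (Fin 2) :=
    (h.localDiffeo z₀ hz₀).mfderivToContinuousLinearEquiv (by simp)
  have heigen : ∀ (v : ℂ) (c : ℝ), κ • starRingEnd ℂ v = c • v →
      diffMap (ψ 1) (e z₀) (P v) = Real.exp c • P v := by
    intro v c hc
    have hd := h.hasDerivAt_diffMap hψ hz₀ hfix v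
    rw [hf, hc, map_smul] at hd
    exact (hψ.diffMap_eq_exp_smul hfix hd 1).trans (by rw [mul_one]; rfl)
  refine ⟨hfix 1, ?_⟩
  have hhyp : IsHyperbolicMap (diffMap (ψ 1) (e z₀)) :=
    isHyperbolicMap_of_eigenbasis P hκ (heigen 1 κ (by simp)) (heigen Complex.I (-κ) (by simp))
  exact derivAtFixed_eq_diffMap (hfix 1) ▸ hhyp

end Hyperbolic

/-! ### The local model of the potential near a hole -/

section LocalModel

/-- A smooth monotone function that is `0` up to `9/256` and `1` from `13/256` on. It is applied to
`|ζ|²`, so that the local model changes inside the annulus `3/16 ≤ |ζ| ≤ 1/4`. -/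
def cutoff (q : ℝ) : ℝ := Real.smoothTransition (64 * q - 9 / 4)

theorem cutoff_of_le {q : ℝ} (h : q ≤ 9 / 256) : cutoff q = 0 :=
  Real.smoothTransition.zero_of_nonpos (by linarith)

theorem cutoff_of_ge {q : ℝ} (h : 13 / 256 ≤ q) : cutoff q = 1 :=
  Real.smoothTransition.one_of_one_le (by linarith)

theorem contDiff_cutoff : ContDiff ℝ ∞ cutoff :=
  Real.smoothTransition.contDiff.comp (by fun_prop)

theorem hasDerivAt_cutoff (q : ℝ) : HasDerivAt cutoff (deriv cutoff q) q :=
  (contDiff_cutoff.differentiable (by simp) q).hasDerivAt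

theorem deriv_cutoff_nonneg (q : ℝ) : 0 ≤ deriv cutoff q :=
  Monotone.deriv_nonneg fun _ _ h => Real.smoothTransition.monotone (by linarith)

/-- The rotation and dilation which interpolates between the identity, for small `|ζ|`, and the
multiplication by `exp L`, for large `|ζ|`. -/
def twist (L ζ : ℂ) : ℂ := Complex.exp (cutoff (Complex.normSq ζ) * L) * ζ

/-- The weight of the antiholomorphic part of the model. -/
def damping (q : ℝ) : ℝ := (1 - cutoff q) / (64 * q)

/-- The model of the potential: the Joukowski map `ε (ζ + 1 / (64 ζ))` for `|ζ|` close to `1/8`, the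
linear map `ε exp L ζ` for larger `|ζ|`. -/
def model (ε : ℝ) (L ζ : ℂ) : ℂ :=
  ε * (twist L ζ + damping (Complex.normSq ζ) * starRingEnd ℂ (twist L ζ))

theorem model_inner (ε : ℝ) (L : ℂ) {ζ : ℂ} (h : Complex.normSq ζ ≤ 9 / 256) :
    model ε L ζ = ε * (ζ + 1 / (64 * ζ)) := by
  rcases eq_or_ne ζ 0 with rfl | h0
  · simp [model, twist]
  have hconj : starRingEnd ℂ ζ ≠ 0 := (map_ne_zero _).2 h0
  rw [model, twist, damping, cutoff_of_le h]
  simp only [Complex.ofReal_zero, zero_mul, Complex.exp_zero, one_mul, sub_zero]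
  push_cast
  rw [← Complex.mul_conj]
  field_simp

theorem model_outer (ε : ℝ) (L : ℂ) {ζ : ℂ} (h : 13 / 256 ≤ Complex.normSq ζ) :
    model ε L ζ = ε * Complex.exp L * ζ := by
  rw [model, twist, damping, cutoff_of_ge h]
  simp only [Complex.ofReal_one, one_mul, sub_self, zero_div, Complex.ofReal_zero, zero_mul,
    add_zero, mul_assoc]

theorem contDiff_normSq : ContDiff ℝ ∞ Complex.normSq := by
  simp only [funext Complex.normSq_apply]
  exact (Complex.reCLM.contDiff.mul Complex.reCLM.contDiff).add
    (Complex.imCLM.contDiff.mul Complex.imCLM.contDiff)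

theorem contDiffAt_model (ε : ℝ) (L : ℂ) {ζ : ℂ} (h : ζ ≠ 0) :
    ContDiffAt ℝ ∞ (model ε L) ζ := by
  have hcutoff : ContDiff ℝ ∞ fun z => cutoff (Complex.normSq z) :=
    contDiff_cutoff.comp contDiff_normSq
  have htwist : ContDiff ℝ ∞ (twist L) :=
    (Complex.contDiff_exp.comp
      ((Complex.ofRealCLM.contDiff.comp hcutoff).mul contDiff_const)).mul contDiff_id
  have hdamping : ContDiffAt ℝ ∞ (fun z => damping (Complex.normSq z)) ζ :=
    (contDiffAt_const.sub hcutoff.contDiffAt).div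
      (contDiffAt_const.mul contDiff_normSq.contDiffAt) (by simpa using h)
  exact contDiffAt_const.mul (htwist.contDiffAt.add
    ((Complex.ofRealCLM.contDiff.contDiffAt.comp ζ hdamping).mul
      (Complex.conjCLE.toContinuousLinearMap.contDiff.contDiffAt.comp ζ htwist.contDiffAt)))

theorem hasDerivAt_joukowski (c : ℂ) {ζ : ℂ} (h0 : ζ ≠ 0) :
    HasDerivAt (fun z : ℂ => c * (z + 1 / (64 * z))) (c * (1 - 1 / (64 * ζ ^ 2))) ζ := by
  have hinv : HasDerivAt (fun z : ℂ => 1 / (64 * z)) (-(64) / (64 * ζ) ^ 2) ζ := by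
    simpa only [one_div] using
      (hasDerivAt_const_mul (64 : ℂ)).fun_inv (mul_ne_zero (by norm_num) h0)
  refine (((hasDerivAt_id ζ).add hinv).const_mul c).congr_deriv ?_
  field_simp
  ring

theorem hasDerivAt_model_inner (ε : ℝ) (L : ℂ) {ζ : ℂ} (h0 : ζ ≠ 0)
    (h : Complex.normSq ζ < 9 / 256) :
    HasDerivAt (model ε L) (ε * (1 - 1 / (64 * ζ ^ 2))) ζ := by
  refine (hasDerivAt_joukowski (ε : ℂ) h0).congr_of_eventuallyEq ?_
  filter_upwards [Complex.continuous_normSq.continuousAt.eventually_lt continuousAt_const h]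
    with z hz using model_inner ε L hz.le

theorem hasDerivAt_line (ζ v : ℂ) : HasDerivAt (fun t : ℝ => ζ + t * v) v 0 := by
  simpa using (Complex.ofRealCLM.hasDerivAt.mul_const v).const_add ζ

theorem hasDerivAt_normSq_line (ζ s : ℂ) :
    HasDerivAt (fun t : ℝ => Complex.normSq (ζ + t * (s * ζ)))
      (2 * Complex.normSq ζ * s.re) 0 := by
  have hfactor : (fun t : ℝ => Complex.normSq (ζ + t * (s * ζ))) =
      fun t : ℝ => Complex.normSq ζ * ((1 + t * s.re) ^ 2 + (t * s.im) ^ 2) := by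
    funext t
    rw [show ζ + t * (s * ζ) = ζ * (1 + t * s) by ring, Complex.normSq_mul,
      Complex.normSq_apply (1 + t * s)]
    simp only [Complex.add_re, Complex.one_re, Complex.re_ofReal_mul, Complex.add_im,
      Complex.one_im, Complex.im_ofReal_mul]
    ring
  have hre : HasDerivAt (fun t : ℝ => 1 + t * s.re) s.re 0 :=
    (hasDerivAt_mul_const s.re).const_add 1
  have him : HasDerivAt (fun t : ℝ => t * s.im) s.im 0 := hasDerivAt_mul_const s.im
  rw [hfactor]
  refine (((hre.pow 2).add (him.pow 2)).const_mul (Complex.normSq ζ)).congr_deriv ?_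
  simp
  ring

theorem hasDerivAt_cutoff_line (ζ s : ℂ) :
    HasDerivAt (fun t : ℝ => cutoff (Complex.normSq (ζ + t * (s * ζ))))
      (deriv cutoff (Complex.normSq ζ) * (2 * Complex.normSq ζ * s.re)) 0 :=
  HasDerivAt.comp (0 : ℝ) (h₂ := cutoff) (by simpa using hasDerivAt_cutoff (Complex.normSq ζ))
    (hasDerivAt_normSq_line ζ s)

theorem hasDerivAt_damping_line {ζ : ℂ} (h0 : ζ ≠ 0) (s : ℂ) :
    HasDerivAt (fun t : ℝ => damping (Complex.normSq (ζ + t * (s * ζ))))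
      (-s.re * (deriv cutoff (Complex.normSq ζ) / 32 + 2 * damping (Complex.normSq ζ))) 0 := by
  have hq : Complex.normSq ζ ≠ 0 := (Complex.normSq_pos.2 h0).ne'
  have hquot := ((hasDerivAt_cutoff_line ζ s).const_sub 1).div
    ((hasDerivAt_normSq_line ζ s).const_mul 64) (by simpa using h0)
  simp only [Complex.ofReal_zero, zero_mul, add_zero] at hquot
  refine hquot.congr_deriv ?_
  rw [damping]
  field_simp
  ring

theorem hasDerivAt_twist_line (L ζ s : ℂ) :
    HasDerivAt (fun t : ℝ => twist L (ζ + t * (s * ζ)))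
      ((s + (deriv cutoff (Complex.normSq ζ) * (2 * Complex.normSq ζ * s.re) : ℝ) * L) *
        twist L ζ) 0 := by
  have hmul := (((hasDerivAt_cutoff_line ζ s).ofReal_comp.mul_const L).cexp).mul
    (hasDerivAt_line ζ (s * ζ))
  simp only [Complex.ofReal_zero, zero_mul, add_zero] at hmul
  refine hmul.congr_deriv ?_
  rw [twist]
  ring

theorem fderiv_model_mul (ε : ℝ) (L : ℂ) {ζ : ℂ} (h0 : ζ ≠ 0) (s : ℂ) {τ : ℂ}
    (hτ : τ = s +
      (deriv cutoff (Complex.normSq ζ) * (2 * Complex.normSq ζ * s.re) : ℝ) * L) :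
    fderiv ℝ (model ε L) ζ (s * ζ) = ε * (τ * twist L ζ +
      (((-s.re * (deriv cutoff (Complex.normSq ζ) / 32 + 2 * damping (Complex.normSq ζ)) : ℝ) :
        ℂ) * starRingEnd ℂ (twist L ζ) +
        damping (Complex.normSq ζ) * starRingEnd ℂ (τ * twist L ζ))) := by
  have htwist := hasDerivAt_twist_line L ζ s
  rw [← hτ] at htwist
  have hconj : HasDerivAt (fun t : ℝ => starRingEnd ℂ (twist L (ζ + t * (s * ζ))))
      (starRingEnd ℂ (τ * twist L ζ)) 0 :=
    Complex.conjCLE.toContinuousLinearMap.hasFDerivAt.comp_hasDerivAt (0 : ℝ) htwist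
  have hmodel := (htwist.add
    ((hasDerivAt_damping_line h0 s).ofReal_comp.mul hconj)).const_mul (ε : ℂ)
  simp only [Complex.ofReal_zero, zero_mul, add_zero] at hmodel
  have hchain : HasDerivAt (fun t : ℝ => model ε L (ζ + t * (s * ζ)))
      (fderiv ℝ (model ε L) ζ (s * ζ)) 0 := by
    refine HasFDerivAt.comp_hasDerivAt (0 : ℝ) (l := model ε L) ?_ (hasDerivAt_line ζ (s * ζ))
    simpa only [Complex.ofReal_zero, zero_mul, add_zero] using
      ((contDiffAt_model ε L h0).differentiableAt (by simp)).hasFDerivAt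
  exact hchain.unique hmodel

theorem damping_mem_Icc {q : ℝ} (hq : 9 / 256 ≤ q) : damping q ∈ Icc 0 (4 / 9) := by
  have hle : cutoff q ≤ 1 := Real.smoothTransition.le_one _
  have hnonneg : 0 ≤ cutoff q := Real.smoothTransition.nonneg _
  refine ⟨div_nonneg (by linarith) (by linarith), ?_⟩
  rw [damping, div_le_iff₀ (by linarith)]
  linarith

/-- These are the real and imaginary parts of the equation `τ η - x d conj η + B conj (τ η) = 0`,
with `η = p₁ + i p₂`, `τ = x (1 + m) + i y`, `d = c / 32 + 2 B`. Eliminating `y` leaves a definite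
quadratic form in `(p₁, p₂)` times `x`. -/
theorem real_system_trivial {x y p₁ p₂ B c m : ℝ} (hB : B ∈ Icc 0 (4 / 9)) (hc : 0 ≤ c)
    (hm : c / 32 ≤ m) (hp : p₁ ≠ 0 ∨ p₂ ≠ 0)
    (h1 : (1 + B) * (x * (1 + m) * p₁ - y * p₂) - x * (c / 32 + 2 * B) * p₁ = 0)
    (h2 : (1 - B) * (x * (1 + m) * p₂ + y * p₁) + x * (c / 32 + 2 * B) * p₂ = 0) :
    x = 0 ∧ y = 0 := by
  obtain ⟨hB0, hB1⟩ := hB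
  have hpos : ∀ a b : ℝ, 0 < a → 0 < b → 0 < a * p₁ ^ 2 + b * p₂ ^ 2 := fun a b ha hb => by
    rcases hp with hp | hp <;> positivity
  have hdet₁ : 0 < ((1 + B) * (1 + m) - 2 * B - c / 32) * (1 - B) :=
    mul_pos (by nlinarith) (by linarith)
  have hdet₂ : 0 < ((1 - B) * (1 + m) + 2 * B + c / 32) * (1 + B) :=
    mul_pos (by nlinarith) (by linarith)
  have hx : x = 0 := by
    refine (mul_eq_zero.1 ?_).resolve_right (hpos _ _ hdet₁ hdet₂).ne'
    linear_combination (1 - B) * p₁ * h1 + (1 + B) * p₂ * h2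
  subst hx
  refine ⟨rfl, (mul_eq_zero.1 ?_).resolve_right
    (hpos (1 - B) (1 + B) (by linarith) (by linarith)).ne'⟩
  linear_combination p₁ * h2 - p₂ * h1

theorem fderiv_model_injective {ε : ℝ} (hε : ε ≠ 0) {L : ℂ} (hL : 1 ≤ L.re) {ζ : ℂ}
    (hq : 9 / 256 ≤ Complex.normSq ζ) {v : ℂ} (hv : fderiv ℝ (model ε L) ζ v = 0) : v = 0 := by
  have h0 : ζ ≠ 0 := by rintro rfl; norm_num at hq
  obtain ⟨s, rfl⟩ : ∃ s, v = s * ζ := ⟨v / ζ, by field_simp⟩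
  obtain ⟨τ, hτ⟩ : ∃ τ : ℂ, τ = s +
      (deriv cutoff (Complex.normSq ζ) * (2 * Complex.normSq ζ * s.re) : ℝ) * L := ⟨_, rfl⟩
  rw [fderiv_model_mul ε L h0 s hτ, mul_eq_zero, or_iff_right (by exact_mod_cast hε)] at hv
  set q := Complex.normSq ζ
  set c := deriv cutoff q
  have hc : 0 ≤ c := deriv_cutoff_nonneg q
  have hτre : τ.re = s.re * (1 + 2 * q * c * L.re) := by
    rw [hτ, Complex.add_re, Complex.re_ofReal_mul]; ring
  have hη : (twist L ζ).re ≠ 0 ∨ (twist L ζ).im ≠ 0 := by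
    by_contra! h
    exact mul_ne_zero (Complex.exp_ne_zero _) h0 (Complex.ext h.1 h.2)
  have hm : c / 32 ≤ 2 * q * c * L.re := by
    have hqc : 9 / 256 * c ≤ q * c := mul_le_mul_of_nonneg_right hq hc
    have hL' : q * c ≤ q * c * L.re :=
      le_mul_of_one_le_right (mul_nonneg (by linarith) hc) hL
    linarith
  have hre := congrArg Complex.re hv
  have him := congrArg Complex.im hv
  simp only [Complex.add_re, Complex.mul_re, Complex.add_im, Complex.mul_im, Complex.conj_re,
    Complex.conj_im, Complex.ofReal_re, Complex.ofReal_im, Complex.zero_re, Complex.zero_im,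
    hτre] at hre him
  obtain ⟨hsre, hτim⟩ := real_system_trivial (damping_mem_Icc hq) hc hm hη
    (x := s.re) (y := τ.im) (by linear_combination hre) (by linear_combination him)
  have hsim : s.im = 0 := by rw [← hτim, hτ, Complex.add_im, Complex.im_ofReal_mul, hsre]; ring
  have hs : s = 0 := Complex.ext hsre hsim
  rw [hs, zero_mul]

end LocalModel

/-! ### The potential -/

section Potential

/-- The points at distance more than `1/12` from the centres of the holes. The gluing
`ζ ↦ 1 / (64 ζ)` exchanges the circles `|ζ| = 1/12` and `|ζ| = 3/16`, so that glued points of these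
sets lie where the local model is the Joukowski map. -/
def farSet (g : ℕ) (i : Fin g) : Set ℂ := {z | ∀ c, IsHoleCentre g i c → 1 / 12 < ‖z - c‖}

/-- The points at distance at least `1/8` from the centres of the holes. The circles `|ζ| = 1/8` are
glued to each other, so these sets still cover the surface. -/
def coreSet (g : ℕ) (i : Fin g) : Set ℂ := {z | ∀ c, IsHoleCentre g i c → 1 / 8 ≤ ‖z - c‖}

theorem farSet_subset_holedPlane (g : ℕ) (i : Fin g) : farSet g i ⊆ holedPlane g i :=
  fun _ hz c hc => lt_trans (by norm_num) (hz c hc)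

theorem coreSet_subset_farSet (g : ℕ) (i : Fin g) : coreSet g i ⊆ farSet g i :=
  fun _ hz c hc => lt_of_lt_of_le (by norm_num) (hz c hc)

variable {g : ℕ} {i : Fin g}

theorem sub_ne_zero_of_mem_farSet {z c : ℂ} (hz : z ∈ farSet g i) (hc : IsHoleCentre g i c) :
    z - c ≠ 0 :=
  norm_pos_iff.1 (lt_trans (by norm_num) (hz c hc))

theorem quarter_lt_norm_sub {z c d : ℂ} (hc : IsHoleCentre g i c) (hzc : ‖z - c‖ < 1 / 4)
    (hd : IsHoleCentre g i d) (hne : c ≠ d) : 1 / 4 < ‖z - d‖ := by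
  have hcd : 1 / 2 ≤ ‖c - d‖ := le_of_not_gt fun h => hne (holes_apart hc hd h)
  have htri := norm_sub_le_norm_sub_add_norm_sub c z d
  rw [norm_sub_rev c z] at htri
  linarith

theorem centre_unique {z c d : ℂ} (hc : IsHoleCentre g i c) (hzc : ‖z - c‖ < 1 / 4)
    (hd : IsHoleCentre g i d) (hzd : ‖z - d‖ < 1 / 4) : c = d :=
  of_not_not fun hne => (quarter_lt_norm_sub hc hzc hd hne).not_gt hzd

theorem isOpen_setOf_lt_norm_sub (g : ℕ) (i : Fin g) {r : ℝ} (hr : r ≤ 1 / 8) :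
    IsOpen {z : ℂ | ∀ c, IsHoleCentre g i c → r < ‖z - c‖} := by
  refine isOpen_iff_mem_nhds.2 fun z hz => ?_
  have hfar : ∀ {z' d : ℂ}, ‖z' - z‖ < 1 / 8 → 1 / 4 ≤ ‖z - d‖ → r < ‖z' - d‖ :=
    fun {z' d} hz' hd => by
      have htri := norm_sub_le_norm_sub_add_norm_sub z z' d
      rw [norm_sub_rev z z'] at htri
      linarith
  have hnear := eventually_norm_sub_lt z (show (0 : ℝ) < 1 / 8 by norm_num)
  by_cases h : ∃ c, IsHoleCentre g i c ∧ ‖z - c‖ < 1 / 4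
  · obtain ⟨c, hc, hzc⟩ := h
    have hcont : ContinuousAt (fun z' : ℂ => ‖z' - c‖) z := by fun_prop
    filter_upwards [hnear, continuousAt_const.eventually_lt hcont (hz c hc)] with z' hz' hz'c d hd
    rcases eq_or_ne c d with rfl | hne
    · exact hz'c
    · exact hfar hz' (quarter_lt_norm_sub hc hzc hd hne).le
  · push Not at h
    filter_upwards [hnear] with z' hz' d hd using hfar hz' (h d hd)

theorem isOpen_farSet (g : ℕ) (i : Fin g) : IsOpen (farSet g i) :=
  isOpen_setOf_lt_norm_sub g i (by norm_num)

theorem farSet_mem_nhds {z : ℂ} (hz : z ∈ farSet g i) : farSet g i ∈ 𝓝 z :=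
  (isOpen_farSet g i).mem_nhds hz

theorem isClosed_coreSet (g : ℕ) (i : Fin g) : IsClosed (coreSet g i) := by
  simp only [coreSet, Set.ofPred_forall]
  exact isClosed_iInter fun c => isClosed_iInter fun _ =>
    isClosed_le continuous_const (by fun_prop)

theorem add_mem_coreSet {z l : ℂ} (hz : z ∈ coreSet g i) (hl : IsLattice l) :
    z + l ∈ coreSet g i := by
  intro c hc
  have := hz _ (hc.add hl.neg)
  rwa [show z - (c + -l) = z + l - c by ring] at this

theorem add_mem_farSet {z l : ℂ} (hz : z ∈ farSet g i) (hl : IsLattice l) :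
    z + l ∈ farSet g i := by
  intro c hc
  have := hz _ (hc.add hl.neg)
  rwa [show z - (c + -l) = z + l - c by ring] at this

theorem mem_coreSet_of_near {z c : ℂ} (hc : IsHoleCentre g i c) (hlt : ‖z - c‖ < 1 / 4)
    (hle : 1 / 8 ≤ ‖z - c‖) : z ∈ coreSet g i := by
  intro d hd
  rcases eq_or_ne c d with rfl | hne
  · exact hle
  · linarith [quarter_lt_norm_sub hc hlt hd hne]

theorem isHoleCentre_right (hi : (i : ℕ) + 1 < g) {l : ℂ} (hl : IsLattice l) :
    IsHoleCentre g i (rightCentre + l) := Or.inr ⟨hi, by simpa using hl⟩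

theorem isHoleCentre_left (hi : 0 < (i : ℕ)) {l : ℂ} (hl : IsLattice l) :
    IsHoleCentre g i (leftCentre + l) := Or.inl ⟨hi, by simpa using hl⟩

/-- The lifts of the saddle points of the flow: the points `c ± 1/8`, for `c` the centre of a
hole. -/
def IsSaddle (g : ℕ) (i : Fin g) (z : ℂ) : Prop := ∃ c, IsHoleCentre g i c ∧ (z - c) ^ 2 = 1 / 64

theorem norm_eq_of_sq_eq {ζ : ℂ} (h : ζ ^ 2 = 1 / 64) : ‖ζ‖ = 1 / 8 := by
  have hsq : ‖ζ‖ ^ 2 = (1 / 8) ^ 2 := by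
    rw [← norm_pow, h]
    norm_num
  exact (sq_eq_sq₀ (norm_nonneg ζ) (by norm_num)).1 hsq

/-- The parameters of the construction: the slope `μ i` of the potential on the `i`-th torus far
from the holes, a common slope `ε` close to the holes, and logarithms `L i` of the quotients. -/
structure Slopes (g : ℕ) where
  ε : ℝ
  μ : Fin g → ℂ
  L : Fin g → ℂ
  pos : 0 < ε
  exp_eq : ∀ i, ε * Complex.exp (L i) = μ i
  one_le_re : ∀ i, 1 ≤ (L i).re

theorem Slopes.exists_of_ne_zero (μ : Fin g → ℂ) (hμ : ∀ i, μ i ≠ 0) :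
    ∃ a : Slopes g, a.μ = μ := by
  have hsmall : ∀ᶠ ε in 𝓝[>] (0 : ℝ), ∀ i, Real.exp 1 * ε < ‖μ i‖ := by
    refine eventually_nhdsWithin_of_eventually_nhds (eventually_all.2 fun i => ?_)
    have hcont : ContinuousAt (fun ε : ℝ => Real.exp 1 * ε) 0 := by fun_prop
    exact hcont.eventually_lt continuousAt_const (by simpa using hμ i)
  obtain ⟨ε, hsmall, hε⟩ := (hsmall.and eventually_mem_nhdsWithin).exists
  have hε0 : (ε : ℂ) ≠ 0 := by exact_mod_cast (mem_Ioi.1 hε).ne'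
  refine ⟨⟨ε, μ, fun i => Complex.log (μ i / ε), hε, fun i => ?_, fun i => ?_⟩, rfl⟩
  · rw [Complex.exp_log (div_ne_zero (hμ i) hε0), mul_div_cancel₀ _ hε0]
  · rw [Complex.log_re, norm_div, Complex.norm_of_nonneg (mem_Ioi.1 hε).le,
      Real.le_log_iff_exp_le (div_pos (norm_pos_iff.2 (hμ i)) hε), le_div_iff₀ hε]
    exact (hsmall i).le

variable (a : Slopes g)

theorem Slopes.ε_ne_zero : (a.ε : ℂ) ≠ 0 := by exact_mod_cast a.pos.ne'

theorem Slopes.μ_ne_zero (i : Fin g) : a.μ i ≠ 0 := by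
  rw [← a.exp_eq]
  exact mul_ne_zero a.ε_ne_zero (Complex.exp_ne_zero _)

open Classical in
/-- The lift to the `i`-th holed plane of the multivalued complex potential on the surface: the
local model close to the holes, a linear map far from them. -/
def potential (a : Slopes g) (i : Fin g) (z : ℂ) : ℂ :=
  if h : ∃ c, IsHoleCentre g i c ∧ ‖z - c‖ < 1 / 4 then
    a.μ i * h.choose + model a.ε (a.L i) (z - h.choose) else a.μ i * z

theorem potential_eq_model {z c : ℂ} (hc : IsHoleCentre g i c) (hzc : ‖z - c‖ < 1 / 4) :
    potential a i z = a.μ i * c + model a.ε (a.L i) (z - c) := by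
  have h : ∃ c, IsHoleCentre g i c ∧ ‖z - c‖ < 1 / 4 := ⟨c, hc, hzc⟩
  rw [potential, dif_pos h, centre_unique h.choose_spec.1 h.choose_spec.2 hc hzc]

theorem potential_eq_linear {z : ℂ}
    (h : ∀ c, IsHoleCentre g i c → 13 / 256 ≤ Complex.normSq (z - c)) :
    potential a i z = a.μ i * z := by
  by_cases hnear : ∃ c, IsHoleCentre g i c ∧ ‖z - c‖ < 1 / 4
  · obtain ⟨c, hc, hzc⟩ := hnear
    rw [potential_eq_model a hc hzc, model_outer _ _ (h c hc), a.exp_eq]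
    ring
  · rw [potential, dif_neg hnear]

theorem potential_eventuallyEq_model {z c : ℂ} (hc : IsHoleCentre g i c)
    (hzc : ‖z - c‖ < 1 / 4) :
    potential a i =ᶠ[𝓝 z] fun z' => a.μ i * c + model a.ε (a.L i) (z' - c) := by
  have hcont : ContinuousAt (fun z' : ℂ => ‖z' - c‖) z := by fun_prop
  filter_upwards [hcont.eventually_lt continuousAt_const hzc] with z' hz'
  exact potential_eq_model a hc hz'

theorem potential_eventuallyEq_linear {z : ℂ} (h : ∀ c, IsHoleCentre g i c → 1 / 4 ≤ ‖z - c‖) :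
    potential a i =ᶠ[𝓝 z] fun z' => a.μ i * z' := by
  filter_upwards [eventually_norm_sub_lt z (show (0 : ℝ) < 1 / 64 by norm_num)] with z' hz'
  refine potential_eq_linear a fun c hc => ?_
  have htri := norm_sub_le_norm_sub_add_norm_sub z z' c
  rw [norm_sub_rev z z'] at htri
  rw [Complex.normSq_eq_norm_sq]
  nlinarith [h c hc]

theorem potential_eventuallyEq_cases (z : ℂ) :
    (∃ c, IsHoleCentre g i c ∧
      potential a i =ᶠ[𝓝 z] fun z' => a.μ i * c + model a.ε (a.L i) (z' - c)) ∨
    potential a i =ᶠ[𝓝 z] fun z' => a.μ i * z' := by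
  by_cases h : ∃ c, IsHoleCentre g i c ∧ ‖z - c‖ < 1 / 4
  · obtain ⟨c, hc, hzc⟩ := h
    exact Or.inl ⟨c, hc, potential_eventuallyEq_model a hc hzc⟩
  · push Not at h
    exact Or.inr (potential_eventuallyEq_linear a h)

theorem contDiffAt_potential {z : ℂ} (hz : z ∈ farSet g i) : ContDiffAt ℝ ∞ (potential a i) z := by
  rcases potential_eventuallyEq_cases a z with ⟨c, hc, h⟩ | h
  · refine (contDiffAt_const.add ?_).congr_of_eventuallyEq h
    exact (contDiffAt_model a.ε (a.L i) (sub_ne_zero_of_mem_farSet hz hc)).comp z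
      (f := fun z' : ℂ => z' - c) (by fun_prop)
  · exact ContDiffAt.congr_of_eventuallyEq (by fun_prop) h

theorem potential_add_lattice {z l : ℂ} (hl : IsLattice l) :
    potential a i (z + l) = potential a i z + a.μ i * l := by
  by_cases h : ∃ c, IsHoleCentre g i c ∧ ‖z - c‖ < 1 / 4
  · obtain ⟨c, hc, hzc⟩ := h
    have hshift : z + l - (c + l) = z - c := by ring
    rw [potential_eq_model a hc hzc, potential_eq_model a (hc.add hl) (by rwa [hshift]), hshift]
    ring
  · have h' : ¬ ∃ c, IsHoleCentre g i c ∧ ‖z + l - c‖ < 1 / 4 := by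
      rintro ⟨c, hc, hzc⟩
      exact h ⟨c + -l, hc.add hl.neg, by rwa [show z - (c + -l) = z + l - c by ring]⟩
    rw [potential, potential, dif_neg h, dif_neg h', mul_add]

theorem normSq_lt_of_norm_lt {ζ : ℂ} (h : ‖ζ‖ < 3 / 16) : Complex.normSq ζ < 9 / 256 := by
  rw [Complex.normSq_eq_norm_sq]
  nlinarith [norm_nonneg ζ]

theorem potential_eq_joukowski {z c : ℂ} (hc : IsHoleCentre g i c) (hzc : ‖z - c‖ < 3 / 16) :
    potential a i z = a.μ i * c + a.ε * ((z - c) + 1 / (64 * (z - c))) := by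
  rw [potential_eq_model a hc (hzc.trans (by norm_num)),
    model_inner _ _ (normSq_lt_of_norm_lt hzc).le]

theorem hasDerivAt_potential {z c : ℂ} (hc : IsHoleCentre g i c) (h0 : z - c ≠ 0)
    (hzc : ‖z - c‖ < 3 / 16) :
    HasDerivAt (potential a i) (a.ε * (1 - 1 / (64 * (z - c) ^ 2))) z := by
  have hmodel := hasDerivAt_model_inner a.ε (a.L i) h0 (normSq_lt_of_norm_lt hzc)
  exact ((hmodel.comp_sub_const z c).const_add _).congr_of_eventuallyEq
    (potential_eventuallyEq_model a hc (hzc.trans (by norm_num)))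

theorem fderiv_eq_mul_of_hasDerivAt {f : ℂ → ℂ} {f' z : ℂ} (h : HasDerivAt f f' z) (v : ℂ) :
    fderiv ℝ f z v = f' * v := by
  rw [h.complexToReal_fderiv.fderiv]
  rfl

theorem fderiv_potential_injective {z : ℂ} (hz : z ∈ farSet g i) (hsaddle : ¬ IsSaddle g i z) :
    Function.Injective (fderiv ℝ (potential a i) z) := by
  refine (injective_iff_map_eq_zero _).2 fun v hv => ?_
  rcases potential_eventuallyEq_cases a z with ⟨c, hc, h⟩ | h
  · have h0 := sub_ne_zero_of_mem_farSet hz hc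
    rcases le_or_gt (3 / 16) ‖z - c‖ with hzc | hzc
    · rw [h.fderiv_eq, fderiv_const_add, fderiv_comp_sub] at hv
      refine fderiv_model_injective a.pos.ne' (a.one_le_re i) ?_ hv
      rw [Complex.normSq_eq_norm_sq]
      nlinarith
    · rw [fderiv_eq_mul_of_hasDerivAt (hasDerivAt_potential a hc h0 hzc)] at hv
      refine (mul_eq_zero.1 hv).resolve_left (mul_ne_zero a.ε_ne_zero fun hcrit => ?_)
      refine hsaddle ⟨c, hc, ?_⟩
      field_simp at hcrit
      linear_combination hcrit / 64
  · have hlinear : HasDerivAt (fun z' : ℂ => a.μ i * z') (a.μ i) z := by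
      simpa using (hasDerivAt_id z).const_mul (a.μ i)
    rw [h.fderiv_eq, fderiv_eq_mul_of_hasDerivAt hlinear] at hv
    exact (mul_eq_zero.1 hv).resolve_left (a.μ_ne_zero i)

/-- The lift of the multivalued Hamiltonian to the `i`-th holed plane. -/
def hamiltonian (a : Slopes g) (i : Fin g) (z : ℂ) : ℝ := (potential a i z).im

theorem contDiffAt_hamiltonian {z : ℂ} (hz : z ∈ farSet g i) :
    ContDiffAt ℝ ∞ (hamiltonian a i) z :=
  Complex.imCLM.contDiff.contDiffAt.comp z (contDiffAt_potential a hz)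

theorem fderiv_hamiltonian {z : ℂ} (hz : z ∈ farSet g i) :
    fderiv ℝ (hamiltonian a i) z = Complex.imCLM.comp (fderiv ℝ (potential a i) z) :=
  (Complex.imCLM.hasFDerivAt.comp z
    ((contDiffAt_potential a hz).differentiableAt (by simp)).hasFDerivAt).fderiv

theorem imCLM_comp_ne_zero {D : ℂ →L[ℝ] ℂ} (hD : Function.Injective D) :
    Complex.imCLM.comp D ≠ 0 := by
  intro h
  obtain ⟨v, hv⟩ := LinearMap.surjective_of_injective (f := D.toLinearMap) hD Complex.I
  have him : (D v).im = 0 := DFunLike.congr_fun h v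
  rw [show D v = Complex.I from hv] at him
  exact one_ne_zero him

theorem fderiv_hamiltonian_near {z c : ℂ} (hz : z ∈ farSet g i) (hc : IsHoleCentre g i c)
    (hzc : ‖z - c‖ < 3 / 16) (v : ℂ) :
    fderiv ℝ (hamiltonian a i) z v = (a.ε * (1 - 1 / (64 * (z - c) ^ 2)) * v).im := by
  rw [fderiv_hamiltonian a hz, ← fderiv_eq_mul_of_hasDerivAt
    (hasDerivAt_potential a hc (sub_ne_zero_of_mem_farSet hz hc) hzc)]
  rfl

theorem fderiv_hamiltonian_eq_zero_iff {z : ℂ} (hz : z ∈ farSet g i) :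
    fderiv ℝ (hamiltonian a i) z = 0 ↔ IsSaddle g i z := by
  constructor
  · intro h
    rw [fderiv_hamiltonian a hz] at h
    exact of_not_not fun hsaddle => imCLM_comp_ne_zero (fderiv_potential_injective a hz hsaddle) h
  · rintro ⟨c, hc, hsq⟩
    ext v
    rw [fderiv_hamiltonian_near a hz hc (by rw [norm_eq_of_sq_eq hsq]; norm_num), hsq]
    norm_num

end Potential

/-! ### Hamiltonian vector fields in a parametrization -/

section HamiltonianField

theorem apply_eq_re_im (L : ℂ →L[ℝ] ℝ) (w : ℂ) : L w = w.re * L 1 + w.im * L Complex.I := by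
  have hw : w = w.re • (1 : ℂ) + w.im • Complex.I := by apply Complex.ext <;> simp
  conv_lhs => rw [hw, map_add, map_smul, map_smul, smul_eq_mul, smul_eq_mul]

theorem apply_eq_mul_im_of_alternating {B : ℂ →L[ℝ] ℂ →L[ℝ] ℝ} (hB : ∀ v, B v v = 0)
    (v w : ℂ) : B v w = B 1 Complex.I * (starRingEnd ℂ v * w).im := by
  have hskew : B Complex.I 1 = -B 1 Complex.I := by
    have hsum := hB (1 + Complex.I)
    simp only [map_add, add_apply, hB, zero_add, add_zero] at hsum
    linarith
  have hv (w : ℂ) : B v w = v.re * B 1 w + v.im * B Complex.I w := apply_eq_re_im (B.flip w) v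
  rw [hv, apply_eq_re_im (B 1), apply_eq_re_im (B Complex.I), hB, hB, hskew]
  simp only [Complex.mul_im, Complex.conj_re, Complex.conj_im]
  ring

variable {S : Type*} [TopologicalSpace S] [ChartedSpace (EuclideanSpace ℝ (Fin 2)) S]
  {Ω : BilinForm S} {e : ℂ → S} {U : Set ℂ} {H : ℂ → ℝ} {z : ℂ}

/-- The density, with respect to the standard area form, of the pull-back of a 2-form to the
plane. -/
def density (Ω : BilinForm S) (e : ℂ → S) (z : ℂ) : ℝ :=
  formAt Ω (e z) (diffParam e z 1) (diffParam e z Complex.I)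

/-- The planar vector field with Hamiltonian `H` for the pull-back of `Ω` under `e`; it is only
meaningful where this pull-back is non-degenerate. -/
def planarField (Ω : BilinForm S) (e : ℂ → S) (H : ℂ → ℝ) (z : ℂ) : ℂ :=
  (density Ω e z)⁻¹ • (⟨fderiv ℝ H z Complex.I, -fderiv ℝ H z 1⟩ : ℂ)

theorem density_mul_planarField (h : density Ω e z ≠ 0) (w : ℂ) :
    density Ω e z * (starRingEnd ℂ (planarField Ω e H z) * w).im = fderiv ℝ H z w := by
  rw [apply_eq_re_im]
  simp only [planarField, Complex.mul_im, Complex.conj_re, Complex.conj_im, Complex.smul_re,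
    Complex.smul_im, smul_eq_mul]
  field_simp
  ring

theorem planarField_eq_zero_iff (h : density Ω e z ≠ 0) :
    planarField Ω e H z = 0 ↔ fderiv ℝ H z = 0 := by
  refine ⟨fun h0 => ContinuousLinearMap.ext fun w => ?_, fun h0 => ?_⟩
  · rw [← density_mul_planarField h, h0]
    simp
  · apply Complex.ext <;> simp [planarField, h0]

theorem diffParam_bijective (he : IsLocalDiffeomorphAt 𝓘(ℝ, ℂ) (𝓡 2) ∞ e z) :
    Function.Bijective (diffParam e z) :=
  (he.mfderivToContinuousLinearEquiv (by simp)).bijective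

variable [IsManifold (𝓡 2) ∞ S]

theorem contDiffOn_density (hΩ : IsSymplecticForm Ω) (hU : IsOpen U)
    (he : ∀ z ∈ U, IsLocalDiffeomorphAt 𝓘(ℝ, ℂ) (𝓡 2) ∞ e z) :
    ContDiffOn ℝ ∞ (density Ω e) U := fun z hz => by
  have hDe (v : ℂ) := contMDiffAt_mfderiv_apply hU
    (fun w hw => (he w hw).contMDiffAt.contMDiffWithinAt) hz (contDiffAt_const (c := v))
  have happly := ContMDiffAt.clm_bundle_apply₂ (E₃ := fun _ : S => ℝ) (F₃ := ℝ) (b := e)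
    (ψ := fun w => Ω (e w)) (hΩ.smooth.contMDiffAt.comp z (he z hz).contMDiffAt) (hDe 1)
    (hDe Complex.I)
  exact (Bundle.contMDiffAt_totalSpace.1 happly).2.contDiffAt.contDiffWithinAt

theorem formAt_diffParam (hΩ : IsSymplecticForm Ω) (e : ℂ → S) (z v w : ℂ) :
    formAt Ω (e z) (diffParam e z v) (diffParam e z w) =
      density Ω e z * (starRingEnd ℂ v * w).im :=
  apply_eq_mul_im_of_alternating
    (B := (formAt Ω (e z)).bilinearComp (diffParam e z) (diffParam e z))
    (fun _ => hΩ.alternating _ _) v w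

theorem eq_of_formAt_diffParam_eq (hΩ : IsSymplecticForm Ω)
    (he : IsLocalDiffeomorphAt 𝓘(ℝ, ℂ) (𝓡 2) ∞ e z) {x y : EuclideanSpace ℝ (Fin 2)}
    (h : ∀ v, formAt Ω (e z) x (diffParam e z v) = formAt Ω (e z) y (diffParam e z v)) :
    x = y := by
  refine sub_eq_zero.1 (hΩ.nondegenerate (e z) _ fun w => ?_)
  obtain ⟨v, rfl⟩ := (diffParam_bijective he).surjective w
  change formAt Ω (e z) (x - y) (diffParam e z v) = 0
  rw [map_sub, sub_apply, h, sub_self]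

theorem density_ne_zero (hΩ : IsSymplecticForm Ω)
    (he : IsLocalDiffeomorphAt 𝓘(ℝ, ℂ) (𝓡 2) ∞ e z) : density Ω e z ≠ 0 := by
  intro h
  have hD : diffParam e z 1 = 0 := eq_of_formAt_diffParam_eq hΩ he fun w => by
    rw [formAt_diffParam hΩ, h, map_zero, zero_apply, zero_mul]
  exact one_ne_zero ((map_eq_zero_iff _ (diffParam_bijective he).injective).1 hD)

theorem contDiffOn_planarField (hΩ : IsSymplecticForm Ω) (hU : IsOpen U)
    (he : ∀ z ∈ U, IsLocalDiffeomorphAt 𝓘(ℝ, ℂ) (𝓡 2) ∞ e z) (hH : ContDiffOn ℝ ∞ H U) :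
    ContDiffOn ℝ ∞ (planarField Ω e H) U := fun z hz => by
  have hdH (v : ℂ) : ContDiffAt ℝ ∞ (fun z => fderiv ℝ H z v) z :=
    ((hH.contDiffAt (hU.mem_nhds hz)).fderiv_right (by simp)).clm_apply contDiffAt_const
  have hρ : ContDiffAt ℝ ∞ (fun z => (density Ω e z)⁻¹) z :=
    ((contDiffOn_density hΩ hU he).contDiffAt (hU.mem_nhds hz)).inv (density_ne_zero hΩ (he z hz))
  exact (hρ.smul (Complex.equivRealProdCLM.symm.contDiff.contDiffAt.comp z
    ((hdH Complex.I).prodMk (hdH 1).neg))).contDiffWithinAt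

theorem isHamiltonianOn_planarField (hΩ : IsSymplecticForm Ω) (hU : IsOpen U)
    (he : ∀ z ∈ U, IsLocalDiffeomorphAt 𝓘(ℝ, ℂ) (𝓡 2) ∞ e z) (hH : ContDiffOn ℝ ∞ H U) :
    IsHamiltonianOn Ω e U (planarField Ω e H) (density Ω e) H where
  form_eq := fun z _ => formAt_diffParam hΩ e z
  smooth_density := contDiffOn_density hΩ hU he
  smooth_hamiltonian := hH
  fderiv_eq := fun z hz => density_mul_planarField (density_ne_zero hΩ (he z hz))

end HamiltonianField

/-! ### The vector field on the surface -/

section Gluing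

variable {g : ℕ} {i j : Fin g} {z w : ℂ}

theorem Rel.eq_or_exists_inversion (h : Rel g i z j w) :
    (i = j ∧ IsLattice (z - w)) ∨ ∃ c c', IsHoleCentre g i c ∧ IsHoleCentre g j c' ∧
      (z - c) * (w - c') = 1 / 64 ∧ ∀ z' w', (z' - c) * (w' - c') = 1 / 64 → Rel g i z' j w' := by
  rcases h with h | ⟨hij, l, m, hl, hm, h⟩ | ⟨hij, l, m, hl, hm, h⟩
  · exact Or.inl h
  · refine Or.inr ⟨rightCentre + l, leftCentre + m, isHoleCentre_right (by lia) hl,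
      isHoleCentre_left (by lia) hm, by rwa [← sub_sub, ← sub_sub], fun z' w' h' => ?_⟩
    exact Or.inr (Or.inl ⟨hij, l, m, hl, hm, by rwa [sub_sub, sub_sub]⟩)
  · refine Or.inr ⟨leftCentre + m, rightCentre + l, isHoleCentre_left (by lia) hm,
      isHoleCentre_right (by lia) hl, by rwa [← sub_sub, ← sub_sub, mul_comm], fun z' w' h' => ?_⟩
    exact Or.inr (Or.inr ⟨hij, l, m, hl, hm, by rwa [sub_sub, sub_sub, mul_comm]⟩)

theorem norm_lt_of_mul_eq {ζ η : ℂ} (h : ζ * η = 1 / 64) (hη : 1 / 12 < ‖η‖) : ‖ζ‖ < 3 / 16 := by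
  have hnorm : ‖ζ‖ * ‖η‖ = 1 / 64 := by rw [← norm_mul, h]; norm_num
  nlinarith [norm_nonneg ζ]

/-- The function `ζ + 1 / (64 ζ)` is invariant under the inversion `ζ ↦ 1 / (64 ζ)`. -/
theorem potential_eq_of_mul_eq (a : Slopes g) {c c' : ℂ} (hz : z ∈ farSet g i)
    (hw : w ∈ farSet g j) (hc : IsHoleCentre g i c) (hc' : IsHoleCentre g j c')
    (h : (z - c) * (w - c') = 1 / 64) :
    potential a i z = potential a j w + (a.μ i * c - a.μ j * c') := by
  have hz0 := sub_ne_zero_of_mem_farSet hz hc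
  have hw0 := sub_ne_zero_of_mem_farSet hw hc'
  have hinv : 1 / (64 * (z - c)) = w - c' := by
    rw [div_eq_iff (by simpa using hz0)]
    linear_combination -64 * h
  have hinv' : 1 / (64 * (w - c')) = z - c := by
    rw [div_eq_iff (by simpa using hw0)]
    linear_combination -64 * h
  rw [potential_eq_joukowski a hc (norm_lt_of_mul_eq h (hw c' hc')),
    potential_eq_joukowski a hc' (norm_lt_of_mul_eq ((mul_comm _ _).trans h) (hz c hc)), hinv,
    hinv']
  ring

variable {S : Type*} [TopologicalSpace S] [ChartedSpace (EuclideanSpace ℝ (Fin 2)) S]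
  (d : TorusSum g S) (a : Slopes g)

theorem TorusSum.param_eq_iff (hz : z ∈ holedPlane g i) (hw : w ∈ holedPlane g j) :
    d.param i z = d.param j w ↔ Rel g i z j w := by
  rcases lt_trichotomy i j with hij | rfl | hij
  · have hne : (i : ℕ) ≠ j + 1 := by rw [Fin.lt_def] at hij; lia
    rw [d.eq_lt i j hij z hz w hw]
    simp only [Rel, hij.ne, hne, false_and, false_or, or_false]
  · rw [d.eq_same i z hz w hw]
    simp [Rel]
  · have hne : (j : ℕ) ≠ i + 1 := by rw [Fin.lt_def] at hij; lia
    rw [eq_comm, d.eq_lt j i hij w hw z hz]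
    simp only [Rel, hij.ne', hne, false_and, false_or]

theorem TorusSum.exists_mem_coreSet (p : S) : ∃ i, ∃ z ∈ coreSet g i, d.param i z = p := by
  obtain ⟨i, z, hz, rfl⟩ := d.cover p
  obtain ⟨j, w, h, hw⟩ := exists_far (proj i ⟨z, hz⟩)
  exact ⟨j, w, hw, (d.param_eq_iff w.2 hz).2 (proj_eq.1 h)⟩

theorem TorusSum.isLocalDiffeomorphAt_param (hz : z ∈ farSet g i) :
    IsLocalDiffeomorphAt 𝓘(ℝ, ℂ) (𝓡 2) ∞ (d.param i) z :=
  d.localDiffeo i z (farSet_subset_holedPlane g i hz)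

/-- `f` is a change of parameter from the `i`-th to the `j`-th holed plane near `z`, and it changes
the potential only by an additive constant. -/
structure TorusSum.IsTransition (i j : Fin g) (f : ℂ → ℂ) (z : ℂ) : Prop where
  contDiffAt : ContDiffAt ℝ ∞ f z
  mem_farSet : f z ∈ farSet g j
  param_eventuallyEq : d.param i =ᶠ[𝓝 z] d.param j ∘ f
  exists_potential_eventuallyEq :
    ∃ k : ℂ, potential a i =ᶠ[𝓝 z] fun z' => potential a j (f z') + k

theorem TorusSum.isTransition_add_lattice {l : ℂ} (hz : z ∈ farSet g i) (hl : IsLattice l) :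
    d.IsTransition a i i (· + l) z where
  contDiffAt := by fun_prop
  mem_farSet := add_mem_farSet hz hl
  param_eventuallyEq := by
    filter_upwards [farSet_mem_nhds hz] with z' hz'
    have hz'' := farSet_subset_holedPlane g i hz'
    exact (d.eq_same i _ hz'' _ (add_mem_holedPlane hz'' hl)).2 (by simpa using hl.neg)
  exists_potential_eventuallyEq := by
    refine ⟨-(a.μ i * l), Eventually.of_forall fun z' => ?_⟩
    simp only [potential_add_lattice a hl, add_neg_cancel_right]

theorem TorusSum.exists_isTransition_of_mul_eq {c c' : ℂ} (hz : z ∈ farSet g i)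
    (hw : w ∈ farSet g j) (hc : IsHoleCentre g i c) (hc' : IsHoleCentre g j c')
    (hzw : (z - c) * (w - c') = 1 / 64)
    (hrel : ∀ z' w', (z' - c) * (w' - c') = 1 / 64 → Rel g i z' j w') :
    ∃ f, d.IsTransition a i j f z ∧ f z = w := by
  have hz0 := sub_ne_zero_of_mem_farSet hz hc
  set f : ℂ → ℂ := fun z' => c' + 1 / 64 * (z' - c)⁻¹ with hf
  have hfz : f z = w := by
    rw [hf, ← hzw]
    field_simp
    ring
  have hfsmooth : ContDiffAt ℝ ∞ f z :=
    contDiffAt_const.add (contDiffAt_const.mul (ContDiffAt.inv (by fun_prop) hz0))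
  have hmul : ∀ z' ∈ farSet g i, (z' - c) * (f z' - c') = 1 / 64 := fun z' hz' => by
    have := sub_ne_zero_of_mem_farSet hz' hc
    rw [hf]
    field_simp
    ring
  have hfar : ∀ᶠ z' in 𝓝 z, z' ∈ farSet g i ∧ f z' ∈ farSet g j :=
    Filter.inter_mem (farSet_mem_nhds hz) (hfsmooth.continuousAt (farSet_mem_nhds (hfz ▸ hw)))
  refine ⟨f, ⟨hfsmooth, hfz ▸ hw, ?_, a.μ i * c - a.μ j * c', ?_⟩, hfz⟩
  · filter_upwards [hfar] with z' ⟨hz', hfz'⟩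
    exact (d.param_eq_iff (farSet_subset_holedPlane g i hz')
      (farSet_subset_holedPlane g j hfz')).2 (hrel _ _ (hmul z' hz'))
  · filter_upwards [hfar] with z' ⟨hz', hfz'⟩
    exact potential_eq_of_mul_eq a hz' hfz' hc hc' (hmul z' hz')

theorem TorusSum.exists_isTransition (hz : z ∈ farSet g i) (hw : w ∈ farSet g j)
    (h : d.param i z = d.param j w) : ∃ f, d.IsTransition a i j f z ∧ f z = w := by
  rcases ((d.param_eq_iff (farSet_subset_holedPlane g i hz)
      (farSet_subset_holedPlane g j hw)).1 h).eq_or_exists_inversion with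
    ⟨rfl, hl⟩ | ⟨c, c', hc, hc', hzw, hrel⟩
  · exact ⟨_, d.isTransition_add_lattice a hz hl.neg, by ring⟩
  · exact d.exists_isTransition_of_mul_eq a hz hw hc hc' hzw hrel

variable {d a} {f : ℂ → ℂ}

theorem TorusSum.IsTransition.diffParam_eq (h : d.IsTransition a i j f z) (v : ℂ) :
    diffParam (d.param i) z v = diffParam (d.param j) (f z) (fderiv ℝ f z v) := by
  have hf := (h.contDiffAt.differentiableAt (by simp)).hasFDerivAt
  have hparam := (d.isLocalDiffeomorphAt_param h.mem_farSet).mdifferentiableAt (by simp)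
  exact DFunLike.congr_fun ((hparam.hasMFDerivAt.comp z hf.hasMFDerivAt).congr_of_eventuallyEq
    h.param_eventuallyEq).mfderiv v

theorem TorusSum.IsTransition.fderiv_hamiltonian_eq (h : d.IsTransition a i j f z) (v : ℂ) :
    fderiv ℝ (hamiltonian a i) z v = fderiv ℝ (hamiltonian a j) (f z) (fderiv ℝ f z v) := by
  obtain ⟨k, hk⟩ := h.exists_potential_eventuallyEq
  have hf := (h.contDiffAt.differentiableAt (by simp)).hasFDerivAt
  have hH := ((contDiffAt_hamiltonian a h.mem_farSet).differentiableAt (by simp)).hasFDerivAt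
  have heq : hamiltonian a i =ᶠ[𝓝 z] fun z' => hamiltonian a j (f z') + k.im :=
    hk.mono fun z' hz' => by simp only [hamiltonian, hz', Complex.add_im]
  rw [(((hH.comp z hf).add_const k.im).congr_of_eventuallyEq heq).fderiv]
  rfl

variable (d a) (Ω : BilinForm S)

/-- The Hamiltonian vector field of the `i`-th Hamiltonian, read in the `i`-th holed plane. -/
def liftedField (i : Fin g) : ℂ → ℂ := planarField Ω (d.param i) (hamiltonian a i)

theorem liftedField_add_lattice {l : ℂ} (hz : z ∈ farSet g i) (hl : IsLattice l) :
    liftedField d a Ω i (z + l) = liftedField d a Ω i z := by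
  have htrans := d.isTransition_add_lattice a hz hl
  have hid : fderiv ℝ (fun z : ℂ => z + l) z = .id ℝ ℂ := by simp
  have hdiff : diffParam (d.param i) z = diffParam (d.param i) (z + l) :=
    ContinuousLinearMap.ext fun v => by rw [htrans.diffParam_eq, hid, ContinuousLinearMap.id_apply]
  have hH : fderiv ℝ (hamiltonian a i) z = fderiv ℝ (hamiltonian a i) (z + l) :=
    ContinuousLinearMap.ext fun v => by
      rw [htrans.fderiv_hamiltonian_eq, hid, ContinuousLinearMap.id_apply]
  have hparam : d.param i z = d.param i (z + l) := htrans.param_eventuallyEq.self_of_nhds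
  simp only [liftedField, planarField, density, hdiff, hH, hparam]

/-- The Hamiltonian vector field on the surface of the imaginary part of the multivalued
potential. -/
def surfaceField : VField S := fun p =>
  let h := d.exists_mem_coreSet p
  diffParam (d.param h.choose) h.choose_spec.choose
    (liftedField d a Ω h.choose h.choose_spec.choose)

variable {Ω} [IsManifold (𝓡 2) ∞ S] (hΩ : IsSymplecticForm Ω)
include hΩ

theorem isHamiltonianOn_liftedField (i : Fin g) :
    IsHamiltonianOn Ω (d.param i) (farSet g i) (liftedField d a Ω i) (density Ω (d.param i))
      (hamiltonian a i) :=
  isHamiltonianOn_planarField hΩ (isOpen_farSet g i) (fun _ hz => d.isLocalDiffeomorphAt_param hz)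
    fun _ hz => (contDiffAt_hamiltonian a hz).contDiffWithinAt

theorem formAt_diffParam_liftedField (hz : z ∈ farSet g i) (v : ℂ) :
    formAt Ω (d.param i z) (diffParam (d.param i) z (liftedField d a Ω i z))
      (diffParam (d.param i) z v) = fderiv ℝ (hamiltonian a i) z v := by
  have hH := isHamiltonianOn_liftedField d a hΩ i
  rw [hH.form_eq z hz, hH.fderiv_eq z hz]

theorem diffParam_liftedField_eq (hz : z ∈ farSet g i) (hw : w ∈ farSet g j)
    (h : d.param i z = d.param j w) :
    diffParam (d.param i) z (liftedField d a Ω i z) =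
      diffParam (d.param j) w (liftedField d a Ω j w) := by
  refine eq_of_formAt_diffParam_eq hΩ (d.isLocalDiffeomorphAt_param hz) fun v => ?_
  obtain ⟨f, hf, rfl⟩ := d.exists_isTransition a hz hw h
  rw [formAt_diffParam_liftedField d a hΩ hz, hf.diffParam_eq v, h,
    formAt_diffParam_liftedField d a hΩ hw, hf.fderiv_hamiltonian_eq]

theorem surfaceField_param (hz : z ∈ farSet g i) :
    surfaceField d a Ω (d.param i z) = diffParam (d.param i) z (liftedField d a Ω i z) := by
  obtain ⟨hcore, hparam⟩ := (d.exists_mem_coreSet (d.param i z)).choose_spec.choose_spec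
  exact diffParam_liftedField_eq d a hΩ (coreSet_subset_farSet g _ hcore) hz hparam

theorem isPushforwardOn_surfaceField (i : Fin g) :
    IsPushforwardOn (d.param i) (farSet g i) (liftedField d a Ω i) (surfaceField d a Ω) where
  isOpen := isOpen_farSet g i
  smooth := contDiffOn_planarField hΩ (isOpen_farSet g i)
    (fun _ hz => d.isLocalDiffeomorphAt_param hz)
    fun _ hz => (contDiffAt_hamiltonian a hz).contDiffWithinAt
  localDiffeo := fun _ hz => d.isLocalDiffeomorphAt_param hz
  map_eq := fun _ hz => surfaceField_param d a hΩ hz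

theorem contMDiff_surfaceField : ContMDiff (𝓡 2) (𝓡 2).tangent ∞
    (fun p => (⟨p, surfaceField d a Ω p⟩ : TangentBundle (𝓡 2) S)) := by
  intro p
  obtain ⟨i, z, hz, rfl⟩ := d.exists_mem_coreSet p
  exact (isPushforwardOn_surfaceField d a hΩ i).contMDiffAt (coreSet_subset_farSet g i hz)

theorem formAt_surfaceField (hz : z ∈ farSet g i) (v : ℂ) :
    formAt Ω (d.param i z) (surfaceField d a Ω (d.param i z)) (diffParam (d.param i) z v) =
      fderiv ℝ (hamiltonian a i) z v := by
  rw [surfaceField_param d a hΩ hz, formAt_diffParam_liftedField d a hΩ hz]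

theorem liftedField_eq_zero_iff (hz : z ∈ farSet g i) :
    liftedField d a Ω i z = 0 ↔ IsSaddle g i z := by
  rw [← fderiv_hamiltonian_eq_zero_iff a hz]
  exact planarField_eq_zero_iff (density_ne_zero hΩ (d.isLocalDiffeomorphAt_param hz))

theorem surfaceField_eq_zero_iff (hz : z ∈ farSet g i) :
    surfaceField d a Ω (d.param i z) = 0 ↔ IsSaddle g i z := by
  rw [surfaceField_param d a hΩ hz, ← liftedField_eq_zero_iff d a hΩ hz]
  exact map_eq_zero_iff _ (diffParam_bijective (d.isLocalDiffeomorphAt_param hz)).injective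

end Gluing

/-! ### The saddle points -/

section SaddleLinearization

variable {z : ℂ}

theorem units_div_eight_sq (s : ℤˣ) : ((s : ℤ) / 8 : ℂ) ^ 2 = 1 / 64 := by
  rcases Int.units_eq_one_or s with rfl | rfl <;> norm_num

theorem hasDerivAt_joukowski_deriv (ε : ℂ) {c : ℂ} (hz : (z - c) ^ 2 = 1 / 64) :
    HasDerivAt (fun w => ε * (1 - 1 / (64 * (w - c) ^ 2))) (128 * ε * (z - c)) z := by
  have hne : (z - c) ^ 2 ≠ 0 := by rw [hz]; norm_num
  have hsq : HasDerivAt (fun w : ℂ => 64 * (w - c) ^ 2) (128 * (z - c)) z := by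
    refine ((((hasDerivAt_id z).sub_const c).pow 2).const_mul 64).congr_deriv ?_
    simp only [id_eq]
    ring
  simp only [one_div]
  refine (((hsq.inv (mul_ne_zero (by norm_num) hne)).const_sub 1).const_mul ε).congr_deriv ?_
  rw [hz]
  ring

theorem fderiv_smul_conj_of_eq_zero {r : ℂ → ℝ} {F : ℂ → ℂ} {F' : ℂ} (hr : DifferentiableAt ℝ r z)
    (hF : HasDerivAt F F' z) (h0 : F z = 0) (v : ℂ) :
    fderiv ℝ (fun w => r w • starRingEnd ℂ (F w)) z v = r z • starRingEnd ℂ (F' * v) := by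
  have hconj : HasFDerivAt (fun w => starRingEnd ℂ (F w)) _ z :=
    Complex.conjCLE.toContinuousLinearMap.hasFDerivAt.comp z (hF.hasFDerivAt.restrictScalars ℝ)
  have hprod : HasFDerivAt (fun w => r w • starRingEnd ℂ (F w)) _ z := hr.hasFDerivAt.smul hconj
  rw [hprod.fderiv]
  simp [h0, mul_comm]

variable {S : Type*} [TopologicalSpace S] [ChartedSpace (EuclideanSpace ℝ (Fin 2)) S]
  {g : ℕ} (d : TorusSum g S) (a : Slopes g) {Ω : BilinForm S} {i : Fin g}

theorem liftedField_eq_conj {c : ℂ} (hz : z ∈ farSet g i) (hc : IsHoleCentre g i c)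
    (hzc : ‖z - c‖ < 3 / 16) : liftedField d a Ω i z = (density Ω (d.param i) z)⁻¹ •
      starRingEnd ℂ (a.ε * (1 - 1 / (64 * (z - c) ^ 2))) := by
  simp only [liftedField, planarField, fderiv_hamiltonian_near a hz hc hzc]
  congr 1
  apply Complex.ext <;> simp only [Complex.mul_I_im, mul_one, Complex.conj_re, Complex.conj_im]

theorem IsSaddle.exists_eq (h : IsSaddle g i z) :
    ∃ c, IsHoleCentre g i c ∧ ∃ s : ℤˣ, z = c + (s : ℤ) / 8 := by
  obtain ⟨c, hc, hzc⟩ := h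
  rcases sq_eq_sq_iff_eq_or_eq_neg.1 (hzc.trans (by norm_num : 1 / 64 = (1 / 8 : ℂ) ^ 2))
    with h | h
  · exact ⟨c, hc, 1, by rw [eq_add_of_sub_eq' h]; norm_num⟩
  · exact ⟨c, hc, -1, by rw [eq_add_of_sub_eq' h]; norm_num⟩

theorem IsSaddle.mem_coreSet (h : IsSaddle g i z) : z ∈ coreSet g i := by
  obtain ⟨c, hc, hzc⟩ := h
  have hnorm := norm_eq_of_sq_eq hzc
  exact mem_coreSet_of_near hc (hnorm.trans_lt (by norm_num)) hnorm.ge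

/-- At a zero of the field the derivative of the density does not contribute, so the linearization
is a real multiple of the conjugation. -/
theorem exists_fderiv_liftedField_eq_conj [IsManifold (𝓡 2) ∞ S] (hΩ : IsSymplecticForm Ω)
    (hz : IsSaddle g i z) :
    ∃ κ : ℝ, κ ≠ 0 ∧ ∀ v, fderiv ℝ (liftedField d a Ω i) z v = κ • starRingEnd ℂ v := by
  have hfar := coreSet_subset_farSet g i hz.mem_coreSet
  obtain ⟨c, hc, s, hzc⟩ := hz.exists_eq
  have hsub : z - c = (s : ℤ) / 8 := sub_eq_of_eq_add' hzc
  have hsq : (z - c) ^ 2 = 1 / 64 := by rw [hsub, units_div_eight_sq]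
  have hρ := density_ne_zero hΩ (d.isLocalDiffeomorphAt_param hfar)
  have hρsmooth : DifferentiableAt ℝ (fun w => (density Ω (d.param i) w)⁻¹) z :=
    ((((isHamiltonianOn_liftedField d a hΩ i).smooth_density.contDiffAt
      (farSet_mem_nhds hfar)).inv hρ).differentiableAt (by simp))
  have hlocal : liftedField d a Ω i =ᶠ[𝓝 z] fun w => (density Ω (d.param i) w)⁻¹ •
      starRingEnd ℂ (a.ε * (1 - 1 / (64 * (w - c) ^ 2))) := by
    have hnear : ‖z - c‖ < 3 / 16 := by rw [norm_eq_of_sq_eq hsq]; norm_num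
    have hcont : ContinuousAt (fun w => ‖w - c‖) z := by fun_prop
    filter_upwards [farSet_mem_nhds hfar, hcont.eventually_lt_const hnear]
      with w hw hwc using liftedField_eq_conj d a hw hc hwc
  refine ⟨(density Ω (d.param i) z)⁻¹ * (16 * a.ε * (s : ℤ)), ?_, fun v => ?_⟩
  · have hs : ((s : ℤ) : ℝ) ≠ 0 := by exact_mod_cast s.ne_zero
    have := a.pos.ne'
    positivity
  · rw [hlocal.fderiv_eq, fderiv_smul_conj_of_eq_zero hρsmooth
      (hasDerivAt_joukowski_deriv a.ε hsq) (by rw [hsq]; norm_num), hsub]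
    simp only [map_mul, map_div₀, map_ofNat, Complex.conj_ofReal, map_intCast,
      Complex.real_smul]
    push_cast
    ring

end SaddleLinearization

section SaddleCount

variable {S : Type*} [TopologicalSpace S] [ChartedSpace (EuclideanSpace ℝ (Fin 2)) S]
  {g : ℕ} (d : TorusSum g S)

theorem isSaddle_right (x : Fin (g - 1) × ℤˣ) :
    IsSaddle g ⟨x.1, by lia⟩ (rightCentre + (x.2 : ℤ) / 8) := by
  refine ⟨rightCentre, ?_, by rw [add_sub_cancel_left, units_div_eight_sq]⟩
  simpa only [add_zero] using isHoleCentre_right (g := g) (i := ⟨x.1, by lia⟩)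
    (by simp only; lia) isLattice_zero

/-- The saddle points of the vector field: two on each neck, both represented near the right hole of
the torus to the left of the neck. -/
def saddle (x : Fin (g - 1) × ℤˣ) : S :=
  d.param ⟨x.1, by lia⟩ (rightCentre + (x.2 : ℤ) / 8)

theorem saddle_mem_holedPlane (x : Fin (g - 1) × ℤˣ) :
    rightCentre + (x.2 : ℤ) / 8 ∈ holedPlane g ⟨x.1, by lia⟩ :=
  farSet_subset_holedPlane _ _ (coreSet_subset_farSet _ _ (isSaddle_right x).mem_coreSet)

theorem eq_of_isLattice_sub {s t : ℤˣ}
    (h : IsLattice (rightCentre + (s : ℤ) / 8 - (rightCentre + (t : ℤ) / 8))) : s = t := by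
  rw [add_sub_add_left_eq_sub] at h
  have hzero := h.eq_zero <| (norm_sub_le _ _).trans_lt <| by
    rw [norm_eq_of_sq_eq (units_div_eight_sq _), norm_eq_of_sq_eq (units_div_eight_sq _)]
    norm_num
  rw [sub_eq_zero, div_left_inj' (by norm_num)] at hzero
  exact Units.ext (by exact_mod_cast hzero)

/-- A point glued to the left neighbour is close to a left centre. -/
theorem not_glued_right {i j : Fin g} {z : ℂ} {s : ℤˣ} (hij : (j : ℕ) = i + 1)
    (hz : z ∈ holedPlane g i) (hw : rightCentre + (s : ℤ) / 8 ∈ holedPlane g j) :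
    ¬ Glued z (rightCentre + (s : ℤ) / 8) := by
  rintro ⟨l, m, hl, hm, h⟩
  have hnear := (glued_bounds hij hz hw hl hm h).2.2.2
  have hapart := half_le_norm (c := leftCentre + m) (d := rightCentre) (by simpa using hm)
    (by simpa using isLattice_zero)
  have htri := norm_sub_le ((s : ℤ) / 8 : ℂ) (rightCentre + (s : ℤ) / 8 - leftCentre - m)
  rw [show (s : ℤ) / 8 - (rightCentre + (s : ℤ) / 8 - leftCentre - m) =
    leftCentre + m - rightCentre by ring, norm_eq_of_sq_eq (units_div_eight_sq _)] at htri
  linarith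

theorem saddle_injective : Function.Injective (saddle d) := by
  intro x y h
  wlog hxy : (x.1 : ℕ) ≤ y.1 generalizing x y
  · exact (this h.symm (le_of_not_ge hxy)).symm
  rcases (d.param_eq_iff (saddle_mem_holedPlane x) (saddle_mem_holedPlane y)).1 h with
    ⟨hindex, hl⟩ | ⟨hindex, hglued⟩ | ⟨hindex, -⟩
  · exact Prod.ext (Fin.ext (Fin.mk.inj hindex)) (eq_of_isLattice_sub hl)
  · exact absurd hglued
      (not_glued_right hindex (saddle_mem_holedPlane x) (saddle_mem_holedPlane y))
  · simp only at hindex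
    lia

theorem IsSaddle.exists_saddle_eq {i : Fin g} {z : ℂ} (h : IsSaddle g i z) :
    ∃ x, saddle d x = d.param i z := by
  have hz := farSet_subset_holedPlane g i (coreSet_subset_farSet g i h.mem_coreSet)
  obtain ⟨c, ⟨hi, hc⟩ | ⟨hi, hc⟩, s, rfl⟩ := h.exists_eq
  · let x : Fin (g - 1) × ℤˣ := (⟨i - 1, by lia⟩, s)
    refine ⟨x, (d.param_eq_iff (saddle_mem_holedPlane x) hz).2 (Or.inr (Or.inl
      ⟨by simp only [x]; lia, 0, c - leftCentre, isLattice_zero, hc, ?_⟩))⟩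
    rw [← units_div_eight_sq s]
    ring
  · let x : Fin (g - 1) × ℤˣ := (⟨i, by lia⟩, s)
    refine ⟨x, (d.param_eq_iff (saddle_mem_holedPlane x) hz).2 (Or.inl ⟨rfl, ?_⟩)⟩
    simpa only [x, add_sub_add_right_eq_sub, neg_sub] using hc.neg

variable [IsManifold (𝓡 2) ∞ S] (a : Slopes g) {Ω : BilinForm S}

theorem range_saddle (hΩ : IsSymplecticForm Ω) :
    range (saddle d) = {p | surfaceField d a Ω p = 0} := by
  ext p
  constructor
  · rintro ⟨x, rfl⟩
    have hx := isSaddle_right x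
    exact (surfaceField_eq_zero_iff d a hΩ (coreSet_subset_farSet _ _ hx.mem_coreSet)).2 hx
  · intro hp
    obtain ⟨i, z, hz, rfl⟩ := d.exists_mem_coreSet p
    exact ((surfaceField_eq_zero_iff d a hΩ (coreSet_subset_farSet g i hz)).1 hp).exists_saddle_eq d

theorem encard_zeros_surfaceField (hΩ : IsSymplecticForm Ω) :
    {p | surfaceField d a Ω p = 0}.encard = (2 * g - 2 : ℕ) := by
  rw [← range_saddle d a hΩ, ← image_univ, (saddle_injective d).encard_image, encard_univ,
    ENat.card_eq_coe_fintype_card, Fintype.card_prod, Fintype.card_fin, Fintype.card_units_int]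
  congr 1
  lia

end SaddleCount

/-! ### The flux -/

section ClosedForms

variable {S : Type*} [TopologicalSpace S] [ChartedSpace (EuclideanSpace ℝ (Fin 2)) S]

/-- The 1-form `α` is exact near `p`, with a smooth primitive. -/
def OneForm.IsExactNear (α : OneForm S) (p : S) : Prop :=
  ∃ K : S → ℝ, ContMDiffAt (𝓡 2) 𝓘(ℝ, ℝ) ∞ K p ∧
    ∀ᶠ q in 𝓝 p, HasMFDerivAt (𝓡 2) 𝓘(ℝ, ℝ) K q (α q)

variable [IsManifold (𝓡 2) ∞ S] {α : OneForm S}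

theorem OneForm.IsExactNear.exists_inChart_eventuallyEq {p : S} {y : EuclideanSpace ℝ (Fin 2)}
    (hy : y ∈ (extChartAt (𝓡 2) p).target)
    (h : OneForm.IsExactNear α ((extChartAt (𝓡 2) p).symm y)) :
    ∃ k : EuclideanSpace ℝ (Fin 2) → ℝ,
      ContDiffAt ℝ ∞ k y ∧ OneForm.inChart α p =ᶠ[𝓝 y] fderiv ℝ k := by
  have hopen := isOpen_extChartAt_target (I := 𝓡 2) p
  have hchart : ∀ y ∈ (extChartAt (𝓡 2) p).target, ContMDiffAt
      𝓘(ℝ, EuclideanSpace ℝ (Fin 2)) (𝓡 2) ∞ (extChartAt (𝓡 2) p).symm y :=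
    fun y hy => (contMDiffOn_extChartAt_symm p).contMDiffAt (hopen.mem_nhds hy)
  obtain ⟨K, hK, hprim⟩ := h
  refine ⟨K ∘ (extChartAt (𝓡 2) p).symm, (hK.comp y (hchart y hy)).contDiffAt, ?_⟩
  filter_upwards [hopen.mem_nhds hy, (hchart y hy).continuousAt.eventually hprim] with x hx hKx
  have hcomp : HasFDerivAt (K ∘ (extChartAt (𝓡 2) p).symm) (OneForm.inChart α p x) x :=
    hasMFDerivAt_iff_hasFDerivAt.1
      (hKx.comp x ((hchart x hx).mdifferentiableAt (by simp)).hasMFDerivAt)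
  exact hcomp.fderiv.symm

theorem OneForm.isClosed_of_isExactNear (h : ∀ p, OneForm.IsExactNear α p) :
    OneForm.IsClosed α := by
  refine fun p => ⟨fun y hy => ?_, fun y hy v w => ?_⟩
  · obtain ⟨k, hk, heq⟩ := (h _).exists_inChart_eventuallyEq hy
    exact ((hk.fderiv_right (by simp)).congr_of_eventuallyEq heq).contDiffWithinAt
  · obtain ⟨k, hk, heq⟩ := (h _).exists_inChart_eventuallyEq hy
    rw [heq.fderiv_eq]
    exact ((contDiffAt_infty.1 hk 2).isSymmSndFDerivAt (by simp)) v w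

variable {e : ℂ → S} {z : ℂ}

theorem eventually_diffParam_mfderiv_localInverse
    (he : IsLocalDiffeomorphAt 𝓘(ℝ, ℂ) (𝓡 2) ∞ e z) :
    ∀ᶠ q in 𝓝 (e z), MDifferentiableAt (𝓡 2) 𝓘(ℝ, ℂ) he.localInverse q ∧
      e (he.localInverse q) = q ∧ ∀ x : EuclideanSpace ℝ (Fin 2),
        diffParam e (he.localInverse q) (mfderiv (𝓡 2) 𝓘(ℝ, ℂ) he.localInverse q x) = x := by
  have hsmooth : ∀ᶠ q in 𝓝 (e z), ContMDiffAt (𝓡 2) 𝓘(ℝ, ℂ) 1 he.localInverse q :=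
    (contMDiffAt_iff_contMDiffAt_nhds (by simp)).1
      (he.localInverse_contMDiffAt.of_le (by simp))
  have hdiff : ∀ᶠ w in 𝓝 z, MDifferentiableAt 𝓘(ℝ, ℂ) (𝓡 2) e w :=
    ((contMDiffAt_iff_contMDiffAt_nhds (n := 1) (by simp)).1
      (he.contMDiffAt.of_le (by simp))).mono fun w hw => hw.mdifferentiableAt (by simp)
  filter_upwards [hsmooth, (tendsto_localInverse he).eventually hdiff,
    he.localInverse_eventuallyEq_right.eventually_nhds] with q hσ heq hinv
  have hσq := hσ.mdifferentiableAt (by simp)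
  refine ⟨hσq, hinv.self_of_nhds, fun x => ?_⟩
  have hid := (hasMFDerivAt_id (I := 𝓡 2) q).congr_of_eventuallyEq hinv
  exact (DFunLike.congr_fun
    (hasMFDerivAt_unique hid (heq.hasMFDerivAt.comp q hσq.hasMFDerivAt)) x).symm

theorem OneForm.isExactNear_of_eq_fderiv {H : ℂ → ℝ} {U : Set ℂ} (hU : U ∈ 𝓝 z)
    (he : IsLocalDiffeomorphAt 𝓘(ℝ, ℂ) (𝓡 2) ∞ e z) (hH : ∀ w ∈ U, ContDiffAt ℝ ∞ H w)
    (h : ∀ w ∈ U, ∀ v, α (e w) (diffParam e w v) = fderiv ℝ H w v) :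
    OneForm.IsExactNear α (e z) := by
  refine ⟨fun q => H (he.localInverse q), ?_, ?_⟩
  · have hHz : ContMDiffAt 𝓘(ℝ, ℂ) 𝓘(ℝ, ℝ) ∞ H (he.localInverse (e z)) := by
      rw [localInverse_apply_self]
      exact (hH z (mem_of_mem_nhds hU)).contMDiffAt
    exact hHz.comp _ he.localInverse_contMDiffAt
  · filter_upwards [eventually_diffParam_mfderiv_localInverse he,
      (tendsto_localInverse he).eventually hU] with q ⟨hσ, hq, hinv⟩ hqU
    have hform : ∀ x : EuclideanSpace ℝ (Fin 2), α q x =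
        fderiv ℝ H (he.localInverse q) (mfderiv (𝓡 2) 𝓘(ℝ, ℂ) he.localInverse q x) := by
      intro x
      have hx := h _ hqU (mfderiv (𝓡 2) 𝓘(ℝ, ℂ) he.localInverse q x)
      rwa [hinv, hq] at hx
    have hcomp := ((hH _ hqU).differentiableAt (by simp)).hasFDerivAt.hasMFDerivAt.comp q
      hσ.hasMFDerivAt
    rwa [show α q = (fderiv ℝ H (he.localInverse q)).comp
      (mfderiv (𝓡 2) 𝓘(ℝ, ℂ) he.localInverse q) from ContinuousLinearMap.ext hform]

end ClosedForms

section Flux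

theorem quarter_le_abs {t : ℝ} {m : ℤ} (h : t = 1 / 4 - m ∨ t = -1 / 4 - m) : 1 / 4 ≤ |t| := by
  have hm : (m : ℝ) ≤ -1 ∨ m = 0 ∨ (1 : ℝ) ≤ m := by
    rcases lt_trichotomy m 0 with hm | hm | hm
    · exact Or.inl (by exact_mod_cast (show m ≤ -1 by lia))
    · exact Or.inr (Or.inl hm)
    · exact Or.inr (Or.inr (by exact_mod_cast hm))
  rw [le_abs]
  rcases h with rfl | rfl <;> rcases hm with hm | rfl | hm <;>
    first
    | (left; push_cast; linarith)
    | (right; push_cast; linarith)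

theorem IsHoleCentre.exists_re_im {g : ℕ} {i : Fin g} {c : ℂ} (hc : IsHoleCentre g i c) :
    ∃ m n : ℤ, (c.re = m ∧ c.im = n) ∨ (c.re = 1 / 2 + m ∧ c.im = 1 / 2 + n) := by
  rcases hc with ⟨_, m, n, h⟩ | ⟨_, m, n, h⟩
  · refine ⟨m, n, Or.inl ?_⟩
    rw [sub_eq_iff_eq_add.1 h]
    simp [leftCentre]
  · refine ⟨m, n, Or.inr ?_⟩
    rw [sub_eq_iff_eq_add.1 h]
    constructor <;> simp [rightCentre] <;> ring

theorem quarter_le_norm_sub {g : ℕ} {i : Fin g} {z c : ℂ} (h : z.re = 1 / 4 ∨ z.im = 1 / 4)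
    (hc : IsHoleCentre g i c) : 1 / 4 ≤ ‖z - c‖ := by
  obtain ⟨m, n, hmn⟩ := hc.exists_re_im
  rcases h with h | h
  · refine le_trans (quarter_le_abs (m := m) ?_) (Complex.abs_re_le_norm _)
    rw [Complex.sub_re, h]
    rcases hmn with ⟨hre, -⟩ | ⟨hre, -⟩
    · exact Or.inl (by rw [hre])
    · exact Or.inr (by rw [hre]; ring)
  · refine le_trans (quarter_le_abs (m := n) ?_) (Complex.abs_im_le_norm _)
    rw [Complex.sub_im, h]
    rcases hmn with ⟨-, him⟩ | ⟨-, him⟩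
    · exact Or.inl (by rw [him])
    · exact Or.inr (by rw [him]; ring)

variable {S : Type*} [TopologicalSpace S] [ChartedSpace (EuclideanSpace ℝ (Fin 2)) S]
  {g : ℕ} {i : Fin g} {z : ℂ}

theorem mfderiv_comp_line {e : ℂ → S} {x v : ℂ} {s : ℝ}
    (he : MDifferentiableAt 𝓘(ℝ, ℂ) (𝓡 2) e (x + s * v)) :
    mfderiv 𝓘(ℝ, ℝ) (𝓡 2) (fun s : ℝ => e (x + s * v)) s (1 : ℝ) = diffParam e (x + s * v) v := by
  have hline : HasDerivAt (fun s : ℝ => x + s * v) v s := by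
    simpa using ((Complex.ofRealCLM.hasDerivAt (x := s)).mul_const v).const_add x
  refine (DFunLike.congr_fun
    (he.hasMFDerivAt.comp s hline.hasFDerivAt.hasMFDerivAt).mfderiv (1 : ℝ)).trans ?_
  exact congrArg (diffParam e (x + s * v)) (one_smul ℝ v)

theorem fderiv_hamiltonian_of_quarter_le (a : Slopes g)
    (h : ∀ c, IsHoleCentre g i c → 1 / 4 ≤ ‖z - c‖) (v : ℂ) :
    fderiv ℝ (hamiltonian a i) z v = (a.μ i * v).im := by
  have hz : z ∈ farSet g i := fun c hc => lt_of_lt_of_le (by norm_num) (h c hc)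
  have hlinear : HasDerivAt (potential a i) (a.μ i) z := by
    simpa using ((hasDerivAt_id z).const_mul (a.μ i)).congr_of_eventuallyEq
      (potential_eventuallyEq_linear a h)
  rw [fderiv_hamiltonian a hz, ← fderiv_eq_mul_of_hasDerivAt hlinear]
  rfl

variable [IsManifold (𝓡 2) ∞ S] (d : TorusSum g S) (a : Slopes g) {Ω : BilinForm S}
  (hΩ : IsSymplecticForm Ω)
include hΩ

theorem isClosed_contraction_surfaceField :
    OneForm.IsClosed (contraction Ω (surfaceField d a Ω)) := by
  refine OneForm.isClosed_of_isExactNear fun p => ?_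
  obtain ⟨i, z, hz, rfl⟩ := d.exists_mem_coreSet p
  have hzf := coreSet_subset_farSet g i hz
  exact OneForm.isExactNear_of_eq_fderiv (farSet_mem_nhds hzf) (d.isLocalDiffeomorphAt_param hzf)
    (fun w hw => contDiffAt_hamiltonian a hw) fun w hw => formAt_surfaceField d a hΩ hw

theorem fluxOn_line (i : Fin g) (x v : ℂ)
    (h : ∀ s : ℝ, (x + s * v).re = 1 / 4 ∨ (x + s * v).im = 1 / 4) :
    fluxOn Ω (fun _ => surfaceField d a Ω) (fun s => d.param i (x + s * v)) =
      (a.μ i * v).im := by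
  have hintegrand : ∀ s : ℝ, contraction Ω (surfaceField d a Ω) (d.param i (x + s * v))
      (mfderiv 𝓘(ℝ, ℝ) (𝓡 2) (fun s : ℝ => d.param i (x + s * v)) s (1 : ℝ)) =
        (a.μ i * v).im := by
    intro s
    have hquarter : ∀ c, IsHoleCentre g i c → 1 / 4 ≤ ‖x + s * v - c‖ := fun c hc =>
      quarter_le_norm_sub (h s) hc
    have hfar : x + s * v ∈ farSet g i := fun c hc =>
      lt_of_lt_of_le (by norm_num) (hquarter c hc)
    rw [mfderiv_comp_line ((d.isLocalDiffeomorphAt_param hfar).mdifferentiableAt (by simp)),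
      ← fderiv_hamiltonian_of_quarter_le a hquarter v]
    exact formAt_surfaceField d a hΩ hfar v
  simp only [fluxOn, OneForm.period, hintegrand, intervalIntegral.integral_const, sub_zero,
    one_smul]

theorem fluxOn_loopA (i : Fin g) :
    fluxOn Ω (fun _ => surfaceField d a Ω) (d.loopA i) = (a.μ i).re :=
  (fluxOn_line d a hΩ i (1 / 4) Complex.I fun s => Or.inl (by simp)).trans (by simp)

theorem fluxOn_loopB (i : Fin g) :
    fluxOn Ω (fun _ => surfaceField d a Ω) (d.loopB i) = (a.μ i).im := by
  have hloop : d.loopB i = fun s : ℝ => d.param i (1 / 4 * Complex.I + s * 1) := by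
    funext s
    rw [TorusSum.loopB, mul_one, add_comm]
  rw [hloop, fluxOn_line d a hΩ i (1 / 4 * Complex.I) 1 fun s => Or.inr (by simp), mul_one]

end Flux

/-! ### Flow lines in the cores -/

section OrdinaryDifferentialEquation

theorem nonneg_of_hasDerivAt_mul_self {F b : ℝ → ℝ} {ε : ℝ} (hε : 0 < ε)
    (hb : ContinuousOn b (Ioo (-ε) ε)) (hF : ∀ t ∈ Ioo (-ε) ε, HasDerivAt F (b t * F t) t)
    (h0 : 0 ≤ F 0) {t : ℝ} (ht : t ∈ Ioo (-ε) ε) : 0 ≤ F t := by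
  have hI : (0 : ℝ) ∈ Ioo (-ε) ε := ⟨neg_lt_zero.2 hε, hε⟩
  let A : ℝ → ℝ := fun t => ∫ s in (0 : ℝ)..t, b s
  have hA : ∀ t ∈ Ioo (-ε) ε, HasDerivAt A (b t) t := by
    intro t ht
    have hsub : uIcc 0 t ⊆ Ioo (-ε) ε := ordConnected_Ioo.uIcc_subset hI ht
    exact intervalIntegral.integral_hasDerivAt_right (hb.mono hsub).intervalIntegrable
      (hb.stronglyMeasurableAtFilter isOpen_Ioo t ht) (hb.continuousAt (isOpen_Ioo.mem_nhds ht))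
  have hexp : ∀ t ∈ Ioo (-ε) ε, HasDerivAt (fun t => Real.exp (-A t) * F t) 0 t := by
    intro t ht
    refine ((hA t ht).neg.exp.mul (hF t ht)).congr_deriv ?_
    simp only [Pi.neg_apply]
    ring
  have hconst : Real.exp (-A t) * F t = Real.exp (-A 0) * F 0 :=
    isOpen_Ioo.is_const_of_deriv_eq_zero isPreconnected_Ioo
      (fun t ht => (hexp t ht).differentiableAt.differentiableWithinAt)
      (fun t ht => (hexp t ht).deriv) ht hI
  exact nonneg_of_mul_nonneg_right (hconst ▸ mul_nonneg (Real.exp_pos _).le h0) (Real.exp_pos _)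

theorem exists_interval_of_eventually {Y : Type*} [TopologicalSpace Y] {y : Y}
    {Q : ℝ × Y → Prop} (h : ∀ᶠ x in 𝓝 ((0 : ℝ), y), Q x) :
    ∃ ε > 0, ∀ᶠ y' in 𝓝 y, ∀ t ∈ Ioo (-ε) ε, Q (t, y') := by
  rw [nhds_prod_eq, eventually_prod_iff] at h
  obtain ⟨P, hP, R, hR, h⟩ := h
  obtain ⟨ε, hε, hball⟩ := Metric.eventually_nhds_iff.1 hP
  refine ⟨ε, hε, hR.mono fun y' hy' t ht => h (hball ?_) hy'⟩
  rw [Real.dist_eq, sub_zero]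
  exact abs_lt.2 ht

theorem IsLocalFlow.mono {E : Type*} [NormedAddCommGroup E] [NormedSpace ℝ E] {f : E → E}
    {U : Set E} {x₀ : E} {ε δ : ℝ} {φ : ℝ × E → E} (hφ : IsLocalFlow f U x₀ ε φ) (hδ : 0 < δ)
    (hle : δ ≤ ε) : IsLocalFlow f U x₀ δ φ where
  __ := hφ
  pos := hδ
  eventually_hasDerivAt := hφ.eventually_hasDerivAt.mono fun _ hx t ht =>
    hx t (Ioo_subset_Ioo (neg_le_neg hle) hle ht)

end OrdinaryDifferentialEquation

section InvariantCircles

theorem re_mul_joukowski_deriv (ε : ℝ) {ζ : ℂ} (h : ζ ≠ 0) :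
    (ζ * (ε * (1 - 1 / (64 * ζ ^ 2)))).re = ε * ζ.re / ‖ζ‖ ^ 2 * (‖ζ‖ ^ 2 - 1 / 64) := by
  have hmul : ζ * (ε * (1 - 1 / (64 * ζ ^ 2))) = ε * (ζ - (1 / 64 : ℝ) * ζ⁻¹) := by
    push_cast
    field_simp
  rw [hmul, Complex.re_ofReal_mul, Complex.sub_re, Complex.re_ofReal_mul, Complex.inv_re,
    Complex.normSq_eq_norm_sq]
  field_simp

variable {S : Type*} [TopologicalSpace S] [ChartedSpace (EuclideanSpace ℝ (Fin 2)) S]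
  {g : ℕ} {i : Fin g} {c z : ℂ} (d : TorusSum g S) (a : Slopes g) {Ω : BilinForm S}

variable (Ω i c) in
/-- The logarithmic growth rate of `‖z - c‖ ^ 2 - 1 / 64` along the flow lines near the hole
centre `c`. -/
def radialRate (z : ℂ) : ℝ :=
  (density Ω (d.param i) z)⁻¹ * (2 * (a.ε * (z - c).re / ‖z - c‖ ^ 2))

theorem inner_sub_liftedField (hz : z ∈ farSet g i) (hc : IsHoleCentre g i c)
    (hzc : ‖z - c‖ < 3 / 16) : 2 * inner ℝ (z - c) (liftedField d a Ω i z) =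
      radialRate i c d a Ω z * (‖z - c‖ ^ 2 - 1 / 64) := by
  rw [liftedField_eq_conj d a hz hc hzc, inner_smul_right, Complex.inner, ← map_mul,
    Complex.conj_re, mul_comm _ (z - c),
    re_mul_joukowski_deriv a.ε (sub_ne_zero_of_mem_farSet hz hc), radialRate]
  ring

theorem continuousOn_radialRate [IsManifold (𝓡 2) ∞ S] (hΩ : IsSymplecticForm Ω)
    (hc : IsHoleCentre g i c) : ContinuousOn (radialRate i c d a Ω) (farSet g i) := by
  have hparam : ∀ z ∈ farSet g i, IsLocalDiffeomorphAt 𝓘(ℝ, ℂ) (𝓡 2) ∞ (d.param i) z :=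
    fun _ hz => d.isLocalDiffeomorphAt_param hz
  have hdensity := (contDiffOn_density hΩ (isOpen_farSet g i) hparam).continuousOn
  have hnorm : ∀ z ∈ farSet g i, ‖z - c‖ ^ 2 ≠ 0 := fun z hz =>
    pow_ne_zero 2 (norm_ne_zero_iff.2 (sub_ne_zero_of_mem_farSet hz hc))
  have hre : Continuous fun z : ℂ => a.ε * (z - c).re :=
    continuous_const.mul (Complex.continuous_re.comp (continuous_sub_right c))
  exact (hdensity.inv₀ fun z hz => density_ne_zero hΩ (hparam z hz)).mul
    (continuousOn_const.mul (hre.continuousOn.div (by fun_prop) hnorm))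

theorem eighth_le_norm_sub_of_flow [IsManifold (𝓡 2) ∞ S] (hΩ : IsSymplecticForm Ω)
    (hc : IsHoleCentre g i c) {φ : ℝ → ℂ} {ε : ℝ} (hε : 0 < ε)
    (hφ : ∀ t ∈ Ioo (-ε) ε, φ t ∈ farSet g i ∧ HasDerivAt φ (liftedField d a Ω i (φ t)) t)
    (hnear : ∀ t ∈ Ioo (-ε) ε, ‖φ t - c‖ < 3 / 16) (h0 : 1 / 8 ≤ ‖φ 0 - c‖) {t : ℝ}
    (ht : t ∈ Ioo (-ε) ε) : 1 / 8 ≤ ‖φ t - c‖ := by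
  have hcont : ContinuousOn φ (Ioo (-ε) ε) := fun t ht =>
    (hφ t ht).2.continuousAt.continuousWithinAt
  have hrate := (continuousOn_radialRate d a hΩ hc).comp hcont fun t ht => (hφ t ht).1
  have hderiv : ∀ t ∈ Ioo (-ε) ε, HasDerivAt (fun t => ‖φ t - c‖ ^ 2 - 1 / 64)
      (radialRate i c d a Ω (φ t) * (‖φ t - c‖ ^ 2 - 1 / 64)) t := fun t ht => by
    rw [← inner_sub_liftedField d a (hφ t ht).1 hc (hnear t ht)]
    exact (((hφ t ht).2.sub_const c).norm_sq).sub_const _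
  have hnonneg := nonneg_of_hasDerivAt_mul_self hε hrate hderiv (by nlinarith) ht
  nlinarith [norm_nonneg (φ t - c)]

end InvariantCircles

section CoreLift

variable {S : Type*} [TopologicalSpace S] [ChartedSpace (EuclideanSpace ℝ (Fin 2)) S]
  {g : ℕ} {i : Fin g} (d : TorusSum g S) (a : Slopes g) {Ω : BilinForm S} {ψ : ℝ → S → S}

variable (Ω ψ i) in
/-- The orbit of `d.param i z` under `ψ` lifts, over the time interval `(-ε, ε)`, to a flow line in
the core of the `i`-th holed plane. -/
def HasCoreLift (ε : ℝ) (z : ℂ) : Prop :=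
  ∃ φ : ℝ → ℂ, φ 0 = z ∧ ∀ t ∈ Ioo (-ε) ε, φ t ∈ coreSet g i ∧
    HasDerivAt φ (liftedField d a Ω i (φ t)) t ∧ ψ t (d.param i z) = d.param i (φ t)

variable {d a} in
theorem HasCoreLift.mono {ε ε' : ℝ} {z : ℂ} (hle : ε' ≤ ε) (h : HasCoreLift i d a Ω ψ ε z) :
    HasCoreLift i d a Ω ψ ε' z := by
  obtain ⟨φ, hφ0, hφ⟩ := h
  exact ⟨φ, hφ0, fun t ht => hφ t (Ioo_subset_Ioo (neg_le_neg hle) hle ht)⟩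

theorem TorusSum.param_add_lattice {z l : ℂ} (hz : z ∈ farSet g i) (hl : IsLattice l) :
    d.param i (z + l) = d.param i z :=
  (d.eq_same i _ (farSet_subset_holedPlane g i (add_mem_farSet hz hl)) _
    (farSet_subset_holedPlane g i hz)).2 (by rwa [add_sub_cancel_left])

variable {d a} in
theorem HasCoreLift.add_lattice {ε : ℝ} {z l : ℂ} (hz : z ∈ coreSet g i) (hl : IsLattice l)
    (h : HasCoreLift i d a Ω ψ ε z) : HasCoreLift i d a Ω ψ ε (z + l) := by
  obtain ⟨φ, hφ0, hφ⟩ := h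
  refine ⟨fun t => φ t + l, by simp only [hφ0], fun t ht => ?_⟩
  obtain ⟨hcore, hderiv, hflow⟩ := hφ t ht
  have hfar := coreSet_subset_farSet g i hcore
  refine ⟨add_mem_coreSet hcore hl, ?_, ?_⟩
  · rw [liftedField_add_lattice d a Ω hfar hl]
    exact hderiv.add_const l
  · rw [d.param_add_lattice (coreSet_subset_farSet g i hz) hl, hflow, d.param_add_lattice hfar hl]

variable [IsManifold (𝓡 2) ∞ S]

theorem eventually_mem_coreSet_of_near (hΩ : IsSymplecticForm Ω) {z₀ c : ℂ} {ε : ℝ}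
    {φ : ℝ × ℂ → ℂ} (hφ : IsLocalFlow (liftedField d a Ω i) (farSet g i) z₀ ε φ)
    (hc : IsHoleCentre g i c) (hzc : ‖z₀ - c‖ ≤ 1 / 8) :
    ∃ δ > 0, ∀ᶠ z in 𝓝 z₀, z ∈ coreSet g i → ∀ t ∈ Ioo (-δ) δ, φ (t, z) ∈ coreSet g i := by
  have hnear : ∀ᶠ x in 𝓝 ((0 : ℝ), z₀), ‖φ x - c‖ < 3 / 16 := by
    have hcont : ContinuousAt (fun x => ‖φ x - c‖) (0, z₀) :=
      (hφ.contDiffAt.continuousAt.sub continuousAt_const).norm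
    refine hcont.eventually_lt continuousAt_const ?_
    rw [hφ.eventually_map_zero.self_of_nhds]
    exact hzc.trans_lt (by norm_num)
  obtain ⟨δ, hδ, hnear⟩ := exists_interval_of_eventually hnear
  have hmin := hφ.mono (lt_min hφ.pos hδ) (min_le_left ε δ)
  refine ⟨min ε δ, hmin.pos, ?_⟩
  filter_upwards [hφ.eventually_map_zero, hmin.eventually_hasDerivAt, hnear]
    with z hz0 hflow hnear hz t ht
  have hnear' : ∀ s ∈ Ioo (-min ε δ) (min ε δ), ‖φ (s, z) - c‖ < 3 / 16 := fun s hs =>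
    hnear s (Ioo_subset_Ioo (neg_le_neg (min_le_right _ _)) (min_le_right _ _) hs)
  refine mem_coreSet_of_near hc ((hnear' t ht).trans (by norm_num)) ?_
  refine eighth_le_norm_sub_of_flow d a hΩ hc (φ := fun t => φ (t, z)) hmin.pos hflow hnear' ?_ ht
  rw [hz0]
  exact hz c hc

theorem IsLocalFlow.eventually_mem_coreSet (hΩ : IsSymplecticForm Ω) {z₀ : ℂ} {ε : ℝ}
    {φ : ℝ × ℂ → ℂ} (hφ : IsLocalFlow (liftedField d a Ω i) (farSet g i) z₀ ε φ) :
    ∃ δ > 0, ∀ᶠ z in 𝓝 z₀, z ∈ coreSet g i → ∀ t ∈ Ioo (-δ) δ, φ (t, z) ∈ coreSet g i := by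
  by_cases hnear : ∃ c, IsHoleCentre g i c ∧ ‖z₀ - c‖ ≤ 1 / 8
  · obtain ⟨c, hc, hzc⟩ := hnear
    exact eventually_mem_coreSet_of_near d a hΩ hφ hc hzc
  · push Not at hnear
    have hinterior : ∀ᶠ x in 𝓝 ((0 : ℝ), z₀), ∀ c, IsHoleCentre g i c → 1 / 8 < ‖φ x - c‖ := by
      refine hφ.contDiffAt.continuousAt.eventually
        ((isOpen_setOf_lt_norm_sub g i le_rfl).mem_nhds ?_)
      rwa [hφ.eventually_map_zero.self_of_nhds]
    obtain ⟨δ, hδ, hmem⟩ := exists_interval_of_eventually hinterior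
    exact ⟨δ, hδ, hmem.mono fun z hz _ t ht c hc => (hz t ht c hc).le⟩

theorem exists_eventually_hasCoreLift [T2Space S] (hΩ : IsSymplecticForm Ω)
    (hψ : IsSmoothFlow (surfaceField d a Ω) ψ) {z₀ : ℂ} (hz₀ : z₀ ∈ coreSet g i) :
    ∃ ε > 0, ∀ᶠ z in 𝓝 z₀, z ∈ coreSet g i → HasCoreLift i d a Ω ψ ε z := by
  have hpush := isPushforwardOn_surfaceField d a hΩ i
  obtain ⟨ε, φ, hφ⟩ := exists_isLocalFlow hpush.isOpen hpush.smooth (coreSet_subset_farSet g i hz₀)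
  obtain ⟨δ, hδ, hcore⟩ := hφ.eventually_mem_coreSet d a hΩ
  have hmin := hφ.mono (lt_min hφ.pos hδ) (min_le_left ε δ)
  refine ⟨min ε δ, hmin.pos, ?_⟩
  filter_upwards [hmin.eventually_map_zero, hmin.eventually_hasDerivAt, hcore,
    hmin.eventually_flow_apply hpush (hψ.field_smooth.of_le (by simp)) hψ.map_zero hψ.generates]
    with z hz0 hderiv hcore hflow hz
  exact ⟨fun t => φ (t, z), hz0, fun t ht => ⟨hcore hz t (Ioo_subset_Ioo
    (neg_le_neg (min_le_right _ _)) (min_le_right _ _) ht), (hderiv t ht).2, hflow t ht⟩⟩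

theorem exists_isLattice_add_mem_closedBall (z : ℂ) :
    ∃ l, IsLattice l ∧ z - l ∈ Metric.closedBall (0 : ℂ) 2 := by
  refine ⟨⌊z.re⌋ + ⌊z.im⌋ * Complex.I, ⟨_, _, rfl⟩, ?_⟩
  rw [mem_closedBall_zero_iff]
  refine (Complex.norm_le_abs_re_add_abs_im _).trans ?_
  have hre : (z - (⌊z.re⌋ + ⌊z.im⌋ * Complex.I)).re = Int.fract z.re := by simp
  have him : (z - (⌊z.re⌋ + ⌊z.im⌋ * Complex.I)).im = Int.fract z.im := by simp
  rw [hre, him, Int.abs_fract, Int.abs_fract]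
  linarith [Int.fract_lt_one z.re, Int.fract_lt_one z.im]

theorem exists_forall_hasCoreLift [T2Space S] (hΩ : IsSymplecticForm Ω)
    (hψ : IsSmoothFlow (surfaceField d a Ω) ψ) (i : Fin g) :
    ∃ ε > 0, ∀ z ∈ coreSet g i, HasCoreLift i d a Ω ψ ε z := by
  have hcompact : IsCompact (coreSet g i ∩ Metric.closedBall 0 2) :=
    (isCompact_closedBall 0 2).inter_left (isClosed_coreSet g i)
  obtain ⟨ε, hε, h⟩ := exists_uniform_of_isCompact hcompact
    (P := fun ε z => z ∈ coreSet g i → HasCoreLift i d a Ω ψ ε z)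
    (fun hle h hz => (h hz).mono hle)
    (fun z hz => exists_eventually_hasCoreLift d a hΩ hψ hz.1)
  refine ⟨ε, hε, fun z hz => ?_⟩
  obtain ⟨l, hl, hball⟩ := exists_isLattice_add_mem_closedBall z
  have hcore : z - l ∈ coreSet g i := by
    rw [sub_eq_add_neg]
    exact add_mem_coreSet hz hl.neg
  simpa using (h _ ⟨hcore, hball⟩ hcore).add_lattice hcore hl

end CoreLift

/-! ### Periodic orbits -/

section FlowLine

variable {S : Type*} [TopologicalSpace S] [ChartedSpace (EuclideanSpace ℝ (Fin 2)) S]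
  {g : ℕ} {i : Fin g} {z : ℂ} (d : TorusSum g S) (a : Slopes g) (Ω : BilinForm S)

variable (i) in
/-- The rate of change of the real part of the potential along the flow lines. -/
def speed (z : ℂ) : ℝ := (fderiv ℝ (potential a i) z (liftedField d a Ω i z)).re

variable (i) in
/-- `φ` is, over the time interval `[0, T]`, a flow line in the `i`-th holed plane that does not
meet the saddles. -/
structure IsRegularFlowLine (φ : ℝ → ℂ) (T : ℝ) : Prop where
  pos : 0 < T
  mem_farSet : ∀ t ∈ Icc 0 T, φ t ∈ farSet g i
  hasDerivAt : ∀ t ∈ Icc 0 T, HasDerivAt φ (liftedField d a Ω i (φ t)) t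
  not_isSaddle : ∀ t ∈ Icc 0 T, ¬ IsSaddle g i (φ t)

variable [IsManifold (𝓡 2) ∞ S] {Ω} (hΩ : IsSymplecticForm Ω) {d a}
include hΩ

theorem fderiv_potential_liftedField (hz : z ∈ farSet g i) :
    fderiv ℝ (potential a i) z (liftedField d a Ω i z) = speed i d a Ω z := by
  refine Complex.ext rfl ?_
  change (Complex.imCLM.comp (fderiv ℝ (potential a i) z)) (liftedField d a Ω i z) = 0
  rw [← fderiv_hamiltonian a hz, ← (isHamiltonianOn_liftedField d a hΩ i).fderiv_eq z hz,
    mul_comm (starRingEnd ℂ _), Complex.mul_conj, Complex.ofReal_im, mul_zero]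

theorem speed_eq_zero_iff (hz : z ∈ farSet g i) : speed i d a Ω z = 0 ↔ IsSaddle g i z := by
  refine ⟨fun h => ?_, fun h => ?_⟩
  · by_contra hsaddle
    have hzero : fderiv ℝ (potential a i) z (liftedField d a Ω i z) = 0 := by
      rw [fderiv_potential_liftedField hΩ hz, h, Complex.ofReal_zero]
    exact hsaddle ((liftedField_eq_zero_iff d a hΩ hz).1
      ((map_eq_zero_iff _ (fderiv_potential_injective a hz hsaddle)).1 hzero))
  · rw [speed, (liftedField_eq_zero_iff d a hΩ hz).2 h, map_zero, Complex.zero_re]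

theorem continuousOn_speed : ContinuousOn (speed i d a Ω) (farSet g i) := by
  intro z hz
  have hpotential : ContinuousAt (fderiv ℝ (potential a i)) z :=
    ((contDiffAt_potential a hz).fderiv_right (m := 0) (by simp)).continuousAt
  have hfield : ContinuousAt (liftedField d a Ω i) z :=
    (isPushforwardOn_surfaceField d a hΩ i).smooth.continuousOn.continuousAt (farSet_mem_nhds hz)
  exact (Complex.continuous_re.continuousAt.comp
    (hpotential.clm_apply hfield)).continuousWithinAt

namespace IsRegularFlowLine

variable {φ : ℝ → ℂ} {T s : ℝ} (h : IsRegularFlowLine i d a Ω φ T)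
include h

theorem hasDerivAt_potential {t : ℝ} (ht : t ∈ Icc 0 T) :
    HasDerivAt (fun t => potential a i (φ t)) (speed i d a Ω (φ t)) t := by
  rw [← fderiv_potential_liftedField hΩ (h.mem_farSet t ht)]
  exact ((contDiffAt_potential a (h.mem_farSet t ht)).differentiableAt
    (by simp)).hasFDerivAt.comp_hasDerivAt t (h.hasDerivAt t ht)

theorem hamiltonian_eq : hamiltonian a i (φ T) = hamiltonian a i (φ 0) := by
  have hderiv : ∀ t ∈ Icc 0 T, HasDerivAt (fun t => hamiltonian a i (φ t)) 0 t := fun t ht =>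
    (Complex.imCLM.hasFDerivAt.comp_hasDerivAt t (h.hasDerivAt_potential hΩ ht)).congr_deriv
      (Complex.ofReal_im (speed i d a Ω (φ t)))
  exact constant_of_has_deriv_right_zero
    (fun t ht => (hderiv t ht).continuousAt.continuousWithinAt)
    (fun t ht => (hderiv t (Ico_subset_Icc_self ht)).hasDerivWithinAt) T (right_mem_Icc.2 h.pos.le)

theorem speed_pos (hs : 0 < s * speed i d a Ω (φ 0)) {t : ℝ} (ht : t ∈ Icc 0 T) :
    0 < s * speed i d a Ω (φ t) := by
  have hcont : ContinuousOn (fun t => s * speed i d a Ω (φ t)) (Icc 0 T) :=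
    continuousOn_const.mul ((continuousOn_speed hΩ).comp
      (fun t ht => (h.hasDerivAt t ht).continuousAt.continuousWithinAt) h.mem_farSet)
  by_contra! hneg
  obtain ⟨r, hr, hr0⟩ := intermediate_value_Icc' ht.1 (hcont.mono (Icc_subset_Icc_right ht.2))
    ⟨hneg, hs.le⟩
  have hrT : r ∈ Icc 0 T := Icc_subset_Icc_right ht.2 hr
  exact h.not_isSaddle r hrT ((speed_eq_zero_iff hΩ (h.mem_farSet r hrT)).1
    ((mul_eq_zero.1 hr0).resolve_left (left_ne_zero_of_mul hs.ne')))

theorem re_potential_lt (hs : 0 < s * speed i d a Ω (φ 0)) :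
    s * (potential a i (φ 0)).re < s * (potential a i (φ T)).re := by
  have hderiv : ∀ t ∈ Icc 0 T, HasDerivAt (fun t => s * (potential a i (φ t)).re)
      (s * speed i d a Ω (φ t)) t := fun t ht =>
    (Complex.reCLM.hasFDerivAt.comp_hasDerivAt t (h.hasDerivAt_potential hΩ ht)).const_mul s
  refine strictMonoOn_of_deriv_pos (convex_Icc 0 T)
    (fun t ht => (hderiv t ht).continuousAt.continuousWithinAt) (fun t ht => ?_)
    (left_mem_Icc.2 h.pos.le) (right_mem_Icc.2 h.pos.le) h.pos
  have htT : t ∈ Icc 0 T := interior_subset ht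
  rw [(hderiv t htT).deriv]
  exact h.speed_pos hΩ hs htT

end IsRegularFlowLine

end FlowLine

section PeriodicOrbit

variable {S : Type*} [TopologicalSpace S] [ChartedSpace (EuclideanSpace ℝ (Fin 2)) S]
  {g : ℕ} {i : Fin g} (d : TorusSum g S) (a : Slopes g) (Ω : BilinForm S) (ψ : ℝ → S → S)

variable (i) in
/-- In the core of the `i`-th holed plane, the point `z'` lifts the image of `z` under the time-`τ`
map of `ψ`, on the same level set of the Hamiltonian; the real part of the potential has moved from
`z` to `z'` in the direction of the sign of `s`, in which it keeps moving. -/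
structure IsAhead (s τ : ℝ) (z z' : ℂ) : Prop where
  mem_coreSet : z' ∈ coreSet g i
  map_eq : ψ τ (d.param i z) = d.param i z'
  hamiltonian_eq : hamiltonian a i z' = hamiltonian a i z
  re_lt : s * (potential a i z).re < s * (potential a i z').re
  speed_pos : 0 < s * speed i d a Ω z'

variable {d a Ω ψ} {s τ τ' : ℝ} {z z' z'' : ℂ}

theorem IsAhead.map_ne (h : IsAhead i d a Ω ψ s τ z z') (hz : z ∈ coreSet g i)
    (hμ : ∀ l, IsLattice l → (a.μ i * l).im = 0 → l = 0) :
    ψ τ (d.param i z) ≠ d.param i z := by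
  intro heq
  have hholed : ∀ w ∈ coreSet g i, w ∈ holedPlane g i := fun w hw =>
    farSet_subset_holedPlane g i (coreSet_subset_farSet g i hw)
  have hl : IsLattice (z' - z) :=
    (d.eq_same i _ (hholed z' h.mem_coreSet) _ (hholed z hz)).1 (h.map_eq.symm.trans heq)
  have hpotential : potential a i z' = potential a i z + a.μ i * (z' - z) := by
    rw [← potential_add_lattice a hl, add_sub_cancel]
  have him : (a.μ i * (z' - z)).im = 0 := by
    have hham := h.hamiltonian_eq
    rwa [hamiltonian, hamiltonian, hpotential, Complex.add_im, add_eq_left] at hham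
  exact h.re_lt.ne' (by rw [sub_eq_zero.1 (hμ _ hl him)])

variable [IsManifold (𝓡 2) ∞ S]

theorem IsAhead.trans (hψ : IsSmoothFlow (surfaceField d a Ω) ψ)
    (h : IsAhead i d a Ω ψ s τ z z') (h' : IsAhead i d a Ω ψ s τ' z' z'') :
    IsAhead i d a Ω ψ s (τ' + τ) z z'' where
  mem_coreSet := h'.mem_coreSet
  map_eq := by rw [hψ.map_add, h.map_eq, h'.map_eq]
  hamiltonian_eq := h'.hamiltonian_eq.trans h.hamiltonian_eq
  re_lt := h.re_lt.trans h'.re_lt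
  speed_pos := h'.speed_pos

variable [T2Space S]

theorem IsSmoothFlow.field_ne_zero {X : VField S} (hψ : IsSmoothFlow X ψ) {p : S} (hp : X p ≠ 0)
    (t : ℝ) : X (ψ t p) ≠ 0 := by
  intro h
  have hfix : ψ (-t) (ψ t p) = ψ t p := (hψ.map_eq_self_iff (ψ t p)).2 h (-t)
  rw [← hψ.map_add, neg_add_cancel, hψ.map_zero] at hfix
  exact hp (hfix ▸ h)

variable (hψ : IsSmoothFlow (surfaceField d a Ω) ψ) (hΩ : IsSymplecticForm Ω)
include hψ hΩ

theorem HasCoreLift.exists_isAhead {ε : ℝ} (h : HasCoreLift i d a Ω ψ ε z) (hτ : 0 < τ)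
    (hτε : τ < ε) (hs : 0 < s * speed i d a Ω z) : ∃ z', IsAhead i d a Ω ψ s τ z z' := by
  obtain ⟨φ, rfl, hφ⟩ := h
  have hsub : ∀ t ∈ Icc 0 τ, t ∈ Ioo (-ε) ε := fun t ht =>
    ⟨(neg_lt_zero.2 (hτ.trans hτε)).trans_le ht.1, ht.2.trans_lt hτε⟩
  have hfar : ∀ t ∈ Icc 0 τ, φ t ∈ farSet g i := fun t ht =>
    coreSet_subset_farSet g i (hφ t (hsub t ht)).1
  have h0 : (0 : ℝ) ∈ Icc 0 τ := left_mem_Icc.2 hτ.le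
  have hfield : surfaceField d a Ω (d.param i (φ 0)) ≠ 0 := fun hzero =>
    right_ne_zero_of_mul hs.ne' ((speed_eq_zero_iff hΩ (hfar 0 h0)).2
      ((surfaceField_eq_zero_iff d a hΩ (hfar 0 h0)).1 hzero))
  have hline : IsRegularFlowLine i d a Ω φ τ :=
    { pos := hτ
      mem_farSet := hfar
      hasDerivAt := fun t ht => (hφ t (hsub t ht)).2.1
      not_isSaddle := fun t ht hsaddle => hψ.field_ne_zero hfield t <| by
        rw [(hφ t (hsub t ht)).2.2]
        exact (surfaceField_eq_zero_iff d a hΩ (hfar t ht)).2 hsaddle }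
  have hτmem : τ ∈ Icc 0 τ := right_mem_Icc.2 hτ.le
  exact ⟨φ τ, (hφ τ (hsub τ hτmem)).1, (hφ τ (hsub τ hτmem)).2.2, hline.hamiltonian_eq hΩ,
    hline.re_potential_lt hΩ hs, hline.speed_pos hΩ hs hτmem⟩

theorem exists_isAhead (hz : z ∈ coreSet g i) (hs : 0 < s * speed i d a Ω z) (hτ : 0 < τ) :
    ∃ z', IsAhead i d a Ω ψ s τ z z' := by
  obtain ⟨ε, hε, hlift⟩ := exists_forall_hasCoreLift d a hΩ hψ i
  obtain ⟨N, hN⟩ := exists_nat_gt (τ / ε)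
  have hN0 : (0 : ℝ) < N + 1 := by positivity
  have hη : 0 < τ / (N + 1) := by positivity
  have hηε : τ / (N + 1) < ε := (div_lt_comm₀ hN0 hε).2 (hN.trans (lt_add_one _))
  have hiterate : ∀ n : ℕ, ∃ z', IsAhead i d a Ω ψ s ((n + 1) * (τ / (N + 1))) z z' := by
    intro n
    induction n with
    | zero => simpa using (hlift z hz).exists_isAhead hψ hΩ hη hηε hs
    | succ n ih =>
      obtain ⟨z', hz'⟩ := ih
      obtain ⟨z'', hz''⟩ :=
        (hlift z' hz'.mem_coreSet).exists_isAhead hψ hΩ hη hηε hz'.speed_pos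
      refine ⟨z'', ?_⟩
      convert IsAhead.trans hψ hz' hz'' using 1
      push_cast
      ring
  simpa [mul_div_cancel₀ _ hN0.ne'] using hiterate N

theorem surfaceField_eq_zero_of_map_eq_self
    (hμ : ∀ i l, IsLattice l → (a.μ i * l).im = 0 → l = 0) {p : S} (hτ : 0 < τ)
    (hp : ψ τ p = p) : surfaceField d a Ω p = 0 := by
  by_contra hX
  obtain ⟨i, z, hz, rfl⟩ := d.exists_mem_coreSet p
  have hfar := coreSet_subset_farSet g i hz
  have hspeed : speed i d a Ω z ≠ 0 := fun h =>
    hX ((surfaceField_eq_zero_iff d a hΩ hfar).2 ((speed_eq_zero_iff hΩ hfar).1 h))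
  obtain ⟨z', hz'⟩ := exists_isAhead hψ hΩ hz (mul_self_pos.2 hspeed) hτ
  exact hz'.map_ne hz (hμ i) hp

end PeriodicOrbit

theorem isLattice_eq_zero_of_im_mul_eq_zero {u v : ℝ} (hu : u ≠ 0) (huv : Irrational (v / u))
    {l : ℂ} (hl : IsLattice l) (h : ((⟨u, v⟩ : ℂ) * l).im = 0) : l = 0 := by
  obtain ⟨m, n, rfl⟩ := hl
  have hrel : u * n + v * m = 0 := by simpa using h
  have hm : m = 0 := by
    by_contra hm
    have hm' : (m : ℝ) ≠ 0 := Int.cast_ne_zero.2 hm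
    refine huv ⟨-n / m, ?_⟩
    push_cast
    field_simp
    linarith
  subst hm
  have hn : n = 0 := by simpa [hu] using hrel
  simp [hn]

section SymplecticFlow

variable {S : Type*} [TopologicalSpace S] [ChartedSpace (EuclideanSpace ℝ (Fin 2)) S]
  [IsManifold (𝓡 2) ∞ S] {g : ℕ} {d : TorusSum g S} {a : Slopes g} {Ω : BilinForm S}
  (hΩ : IsSymplecticForm Ω)
include hΩ

theorem hasFlux_of_field_eq {Ψ : SymplecticFlow Ω} (hΨ : Ψ.field = surfaceField d a Ω) :
    HasFlux d Ψ (fun i => (a.μ i).re) fun i => (a.μ i).im := by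
  simp only [HasFlux, hΨ]
  exact ⟨isClosed_contraction_surfaceField d a hΩ, fun i =>
    ⟨fluxOn_loopA d a hΩ i, fluxOn_loopB d a hΩ i⟩⟩

variable [T2Space S] {ψ : ℝ → S → S}

theorem hasDerivAt_formAt_diffMap (hψ : IsSmoothFlow (surfaceField d a Ω) ψ) (p : S)
    (v w : EuclideanSpace ℝ (Fin 2)) :
    HasDerivAt (fun t => formAt Ω (ψ t p) (diffMap (ψ t) p v) (diffMap (ψ t) p w)) 0 0 := by
  obtain ⟨i, z, hz, rfl⟩ := d.exists_mem_coreSet p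
  have hfar := coreSet_subset_farSet g i hz
  have hsurj := (diffParam_bijective (d.isLocalDiffeomorphAt_param hfar)).surjective
  obtain ⟨v, rfl⟩ := hsurj v
  obtain ⟨w, rfl⟩ := hsurj w
  exact (isHamiltonianOn_liftedField d a hΩ i).hasDerivAt_form
    (isPushforwardOn_surfaceField d a hΩ i) hψ hfar v w

theorem isHyperbolicFixedPoint_of_surfaceField_eq_zero
    (hψ : IsSmoothFlow (surfaceField d a Ω) ψ) {p : S} (hp : surfaceField d a Ω p = 0) :
    IsHyperbolicFixedPoint (ψ 1) p := by
  have hfix := (hψ.map_eq_self_iff p).2 hp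
  obtain ⟨i, z, hz, rfl⟩ := d.exists_mem_coreSet p
  have hfar := coreSet_subset_farSet g i hz
  obtain ⟨κ, hκ, hderiv⟩ := exists_fderiv_liftedField_eq_conj d a hΩ
    ((surfaceField_eq_zero_iff d a hΩ hfar).1 hp)
  exact (isPushforwardOn_surfaceField d a hΩ i).isHyperbolicFixedPoint hψ hfar hfix hκ hderiv

variable (d a) in
theorem exists_symplecticFlow [CompactSpace S] : ∃ Ψ : SymplecticFlow Ω,
    Ψ.field = surfaceField d a Ω ∧ IsSmoothFlow (surfaceField d a Ω) Ψ.toFun := by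
  obtain ⟨ψ, hψ⟩ := exists_isSmoothFlow (contMDiff_surfaceField d a hΩ)
  exact ⟨{ toFun := ψ
           field := surfaceField d a Ω
           smooth := hψ.smooth
           map_zero := hψ.map_zero
           map_add := hψ.map_add
           generates := hψ.generates
           preserves := hψ.form_eq (hasDerivAt_formAt_diffMap hΩ hψ) }, rfl, hψ⟩

end SymplecticFlow

end SurfaceFlow

end

open SurfaceFlow in
theorem theorem1p2 {S : Type*} [TopologicalSpace S] [T2Space S] [CompactSpace S]
    [ChartedSpace (EuclideanSpace ℝ (Fin 2)) S] [IsManifold (𝓡 2) ∞ S]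
    (g : ℕ) (hg : 2 ≤ g) (d : TorusSum g S)
    (Ω : BilinForm S) (hΩ : IsSymplecticForm Ω)
    (u v : Fin g → ℝ) (hu : ∀ i, u i ≠ 0) (huv : ∀ i, Irrational (v i / u i)) :
    ∃ ψ : SymplecticFlow Ω,
      (∀ p, ψ.IsPeriodicPoint p → p ∈ ψ.fixedPoints) ∧
      ψ.fixedPoints.encard = ((2 * g - 2 : ℕ) : ℕ∞) ∧
      (∀ p ∈ ψ.fixedPoints, IsHyperbolicFixedPoint (ψ.toFun 1) p) ∧
      HasFlux d ψ u v := by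
  obtain ⟨a, ha⟩ := Slopes.exists_of_ne_zero (fun i => (⟨u i, v i⟩ : ℂ))
    fun i h => hu i (congrArg Complex.re h)
  obtain ⟨ψ, hfield, hψ⟩ := exists_symplecticFlow d a hΩ
  have hfixed : ψ.fixedPoints = {p | surfaceField d a Ω p = 0} := Set.ext hψ.map_eq_self_iff
  have hμ : ∀ i l, IsLattice l → (a.μ i * l).im = 0 → l = 0 := fun i l hl h =>
    isLattice_eq_zero_of_im_mul_eq_zero (hu i) (huv i) hl (by rwa [ha] at h)
  refine ⟨ψ, ?_, ?_, ?_, ?_⟩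
  · rintro p ⟨T, hT, hp⟩
    rw [hfixed]
    exact surfaceField_eq_zero_of_map_eq_self hψ hΩ hμ hT hp
  · rw [hfixed, encard_zeros_surfaceField d a hΩ]
  · rw [hfixed]
    exact fun p hp => isHyperbolicFixedPoint_of_surfaceField_eq_zero hΩ hψ hp
  · simpa only [ha] using hasFlux_of_field_eq hΩ hfield
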